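/- Let $K$ be a commutative ring. A (non-unital, $\mathbb Z$-graded) $A_\infty$ category $\mathcal A$ over $K$ consists of a set of objects, graded $K$-modules $\mathcal A(A,A')$ and $K$-linear maps $m_i\colon \mathcal A(A_{i-1},A_i)\otimes\cdots\otimes\mathcal A(A_0,A_1)\to\mathcal A(A_0,A_i)$ of degree $2-i$ ($i>0$) such that, for every $n>0$, $$\sum_{k=1}^n\sum_{i=0}^{n-k}(-1)^{i+k(n-i-k)}\,m_{n-k+1}\circ(\mathrm{id}^{\otimes n-i-k}\otimes m_k\otimes\mathrm{id}^{\otimes i})=0 .$$ A (non-unital) $A_\infty$ functor $F\colon\mathcal A\to\mathcal B$ consists of a map $F^0$ on objects and $K$-linear maps $F^i\colon \mathcal A(A_{i-1},A_i)\otimes\cdots\otimes\mathcal A(A_0,A_1)\to\mathcal B(F^0A_0,F^0A_i)$ of degree $1-i$ ($i>0$) such that, for every $n>0$, $$\sum_{k=1}^n\sum_{i=0}^{n-k}(-1)^{i+k(n-i-k)}F^{n-k+1}\circ(\mathrm{id}^{\otimes n-i-k}\otimes m_k\otimes\mathrm{id}^{\otimes i})=\sum_{i_1+\cdots+i_r=n,\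 i_t>0}(-1)^{\sum_{t<u}(1-i_t)i_u}\,m_r\circ(F^{i_r}\otimes\cdots\otimes F^{i_1}).$$ Tensor products of maps are evaluated with the Koszul sign rule. A strict unit of an object $A$ is a degree $0$ element $\mathrm{id}_A\in\mathcal A(A,A)$ with $m_2(f\otimes\mathrm{id}_A)=f$ and $m_2(\mathrm{id}_A\otimes g)=g$ for all $f\in\mathcal A(A,A')$, $g\in\mathcal A(A',A)$, and $m_i(f_i\otimes\cdots\otimes f_1)=0$ whenever $i\neq2$ and some $f_j=\mathrm{id}_A$. The category $\mathcal A$ is strictly unital if every object has a (necessarily unique) strict unit. A strictly unital $\mathcal A$ has split units if, for every object $A$, $K\cong K\,\mathrm{id}_A$ and the inclusion $K\,\mathrm{id}_A\hookrightarrow\mathcal A(A,A)^0$ is a split monomorphism of $K$-modules. The category $\mathcal A$ is unital if its cohomology category $H(\mathcal A)$ has identities and, for every object $A$ and a closed degree $0$ element $u_A$ representing the identity of $A$ in $H(\mathcal A)$, the maps $m_2(-\otimes u_A)$ on $\mathcal A(A,A')$ and $m_2(u_A\otimes-)$ on $\mathcal A(A',A)$ are homotopic to the identity for every $A'$ (every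 strictly unital $A_\infty$ category is unital). An $A_\infty$ functor $F\colon\mathcal A\to\mathcal B$ is unital if $\mathcal A$ and $\mathcal B$ are unital and $H(F)\colon H(\mathcal A)\to H(\mathcal B)$ preserves identities. It is strictly unital if $\mathcal A$ and $\mathcal B$ are strictly unital, $F^1(\mathrm{id}_A)=\mathrm{id}_{F^0(A)}$ for every $A$, and $F^i(f_i\otimes\cdots\otimes f_1)=0$ whenever $i>1$ and some $f_j$ is a strict unit. Two $A_\infty$ functors $F,G\colon\mathcal A\to\mathcal B$ are homotopic if $F^0=G^0$ and there are $K$-linear maps $\theta^i\colon\mathcal A(A_{i-1},A_i)\otimes\cdots\otimes\mathcal A(A_0,A_1)\to\mathcal B(F^0A_0,G^0A_i)$ of degree $-i$, $i\ge0$, with $\theta^0=0$, such that $G^n=F^n+m_1(\theta)^n$ for every $n>0$, where, with $p=0$ the degree of $\theta$, $$m_1(\theta)^n=\sum_{k=1}^n\sum_{i=0}^{n-k}(-1)^{i+k(n-i-k)}\theta^{n-k+1}\circ(\mathrm{id}^{\otimes n-i-k}\otimes m_k\otimes\mathrm{id}^{\otimes i})+\sum(-1)^{\varepsilon}\,m_{r+s+1}\circ(G^{j_s}\otimes\cdots\otimes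 G^{j_1}\otimes\theta^k\otimes F^{i_r}\otimes\cdots\otimes F^{i_1}),$$ the last sum being over $r,s,k\ge0$ and $i_1,\dots,i_r,j_1,\dots,j_s>0$ with $i_1+\cdots+i_r+k+j_1+\cdots+j_s=n$, and $$\varepsilon=p+r(p-1)+\sum_{t=1}^r(1-i_t)\Bigl(n-\sum_{u=1}^{t-1}i_u\Bigr)+(p-k)\sum_{t=1}^sj_t+\sum_{1\le t<u\le s}(1-j_t)j_u .$$ **Lemma.** Let $F\colon\mathcal A\to\mathcal B$ be a unital $A_\infty$ functor between two strictly unital $A_\infty$ categories. If $\mathcal A$ has split units, then $F$ is homotopic to a strictly unital $A_\infty$ functor $\mathcal A\to\mathcal B$. -/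

import Mathlib

universe w u v u' v'

noncomputable section

namespace AInf

/-! ### Composable sequences -/

/-- `Chain H X Y` is the type of composable sequences `f_n ⊗ ⋯ ⊗ f_1` (`n ≥ 0`) with
`f_1` starting at `X` and `f_n` ending at `Y`; as in the order of composition, the outermost
entry of `cons` is the leftmost factor `f_n`. -/
inductive Chain {O : Type u} (H : O → O → Type v) (X : O) : O → Type (max u v)
  | nil : Chain H X X
  | cons {Y Z : O} (f : H Y Z) (c : Chain H X Y) : Chain H X Z

namespace Chain

variable {O : Type u} {H : O → O → Type v}

/-- The sequence with the single entry `f`. -/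
def single {X Y : O} (f : H X Y) : Chain H X Y := cons f nil

/-- The sequence `g ⊗ f`. -/
def pair {X Y Z : O} (g : H Y Z) (f : H X Y) : Chain H X Z := cons g (single f)

/-- The number of entries. -/
def length {X : O} : {Y : O} → Chain H X Y → ℕ
  | _, nil => 0
  | _, cons _ c => c.length + 1

/-- Concatenation: `l.append r` is `l ⊗ r`. -/
def append {X Y : O} : {Z : O} → Chain H Y Z → Chain H X Y → Chain H X Z
  | _, nil, r => r
  | _, cons f l, r => cons f (l.append r)

/-- Apply a map to every entry. -/
def map {H' : O → O → Type v'} (φ : ∀ {X Y : O}, H X Y → H' X Y) {X : O} :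
    {Y : O} → Chain H X Y → Chain H' X Y
  | _, nil => nil
  | _, cons f c => cons (φ f) (c.map φ)

/-- All ways to write a sequence as `l ⊗ r`, with `l` and `r` possibly empty. -/
def splits {X : O} : {Z : O} → Chain H X Z → List (Σ Y : O, Chain H Y Z × Chain H X Y)
  | _, nil => [⟨X, nil, nil⟩]
  | Z, cons f c => ⟨Z, nil, cons f c⟩ :: c.splits.map fun s => ⟨s.1, cons f s.2.1, s.2.2⟩

/-- A decomposition `left ⊗ mid ⊗ right` of a sequence from `X` to `W`. -/
structure Split₃ (H : O → O → Type v) (X W : O) where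
  {Y Z : O}
  left : Chain H Z W
  mid : Chain H Y Z
  right : Chain H X Y

/-- All ways to write a sequence as `left ⊗ mid ⊗ right`, each factor possibly empty. -/
def splits₃ {X W : O} (c : Chain H X W) : List (Split₃ H X W) :=
  c.splits.flatMap fun s => s.2.2.splits.map fun t => ⟨s.2.1, t.2.1, t.2.2⟩

/-- Given a decomposition of `c` in blocks, the (one or two) decompositions of `f ⊗ c` in blocks
which induce it: `f` is a block of its own, or it is added to the leftmost block. -/
def extendBlocks {X Y Z : O} (f : H Y Z) :
    Chain (Chain H) X Y → List (Chain (Chain H) X Z)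
  | nil => [cons (single f) nil]
  | cons b I => [cons (single f) (cons b I), cons (cons f b) I]

/-- All ways to write a sequence as `c_r ⊗ ⋯ ⊗ c_1` with every block `c_t` non-empty, that is one
for each `(i_1, …, i_r)` with `i_1 + ⋯ + i_r = n` and `i_1, …, i_r > 0` (`r = 0` if `n = 0`). -/
def blocks {X : O} : {Y : O} → Chain H X Y → List (Chain (Chain H) X Y)
  | _, nil => [nil]
  | _, cons f c => c.blocks.flatMap (extendBlocks f)

/-- `i_1 + ⋯ + i_r`, where `i_t` is the length of the `t`-th block from the right. -/
def total {X : O} : {Y : O} → Chain (Chain H) X Y → ℤ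
  | _, nil => 0
  | _, cons b I => b.length + total I

/-- `∑_t (1 - i_t)`. -/
def defect {X : O} : {Y : O} → Chain (Chain H) X Y → ℤ
  | _, nil => 0
  | _, cons b I => (1 - b.length) + defect I

/-- `∑_{t < u} (1 - i_t) i_u`. -/
def blockSign {X : O} : {Y : O} → Chain (Chain H) X Y → ℤ
  | _, nil => 0
  | _, cons b I => defect I * b.length + blockSign I

/-- `∑_t (1 - i_t) (n - ∑_{u < t} i_u)`. -/
def rightSign (n : ℤ) {X : O} : {Y : O} → Chain (Chain H) X Y → ℤ
  | _, nil => 0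
  | _, cons b I => (1 - b.length) * (n - total I) + rightSign n I

end Chain

/-! ### Graded quivers -/

/-- Objects together with graded `K`-modules of morphisms. -/
structure GradedQuiver (K : Type w) [CommRing K] where
  Obj : Type u
  Hom : Obj → Obj → Type v
  [addCommGroup : ∀ X Y, AddCommGroup (Hom X Y)]
  [module : ∀ X Y, Module K (Hom X Y)]
  gr : ∀ X Y, ℤ → Submodule K (Hom X Y)
  isInternal : ∀ X Y, DirectSum.IsInternal (gr X Y)

attribute [instance] GradedQuiver.addCommGroup GradedQuiver.module

namespace GradedQuiver

variable {K : Type w} [CommRing K]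

/-- The `K`-linear map with `x ↦ (-1)^(k d) x` for `x` homogeneous of degree `d`. -/
def twist (Q : GradedQuiver.{w, u, v} K) (k : ℤ) {X Y : Q.Obj} : Q.Hom X Y →ₗ[K] Q.Hom X Y :=
  letI := (Q.isInternal X Y).chooseDecomposition
  (DirectSum.toModule K ℤ (Q.Hom X Y) fun d => (k * d).negOnePow • (Q.gr X Y d).subtype) ∘ₗ
    (DirectSum.decomposeLinearEquiv (Q.gr X Y)).toLinearMap

theorem twist_of_mem (Q : GradedQuiver.{w, u, v} K) (k : ℤ) {X Y : Q.Obj} {d : ℤ}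
    {x : Q.Hom X Y} (hx : x ∈ Q.gr X Y d) : Q.twist k x = (k * d).negOnePow • x := by
  let _ := (Q.isInternal X Y).chooseDecomposition
  simp only [twist, LinearMap.comp_apply, LinearEquiv.coe_coe,
    DirectSum.decomposeLinearEquiv_apply, DirectSum.decompose_of_mem _ hx]
  erw [DirectSum.toModule_lof]
  rfl

/-- The Koszul sign of moving a map of degree `k` past `f_n ⊗ ⋯ ⊗ f_1`, which on homogeneous
entries is multiplication by `(-1)^(k (deg f_n + ⋯ + deg f_1))`. -/
def koszul (Q : GradedQuiver.{w, u, v} K) (k : ℤ) {X Y : Q.Obj} (c : Chain Q.Hom X Y) :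
    Chain Q.Hom X Y :=
  c.map (Q.twist k)

/-- `f_n ⊗ ⋯ ⊗ f_1` has homogeneous entries of total degree `d`. -/
inductive HasDegree (Q : GradedQuiver.{w, u, v} K) {X : Q.Obj} :
    {Y : Q.Obj} → Chain Q.Hom X Y → ℤ → Prop
  | nil : HasDegree Q Chain.nil 0
  | cons {Y Z : Q.Obj} {f : Q.Hom Y Z} {c : Chain Q.Hom X Y} {d e : ℤ}
      (hf : f ∈ Q.gr Y Z d) (hc : HasDegree Q c e) : HasDegree Q (Chain.cons f c) (d + e)

/-- A family of maps `φ` on composable sequences is, in each length `i`, given by `K`-linear maps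
`Q(X_{i-1}, X_i) ⊗ ⋯ ⊗ Q(X_0, X_1) → R(a X_0, b X_i)` of degree `p - i`. -/
structure IsMultilinear (Q : GradedQuiver.{w, u, v} K) (R : GradedQuiver.{w, u', v'} K)
    (a b : Q.Obj → R.Obj) (p : ℤ)
    (φ : ∀ {X Y : Q.Obj}, Chain Q.Hom X Y → R.Hom (a X) (b Y)) : Prop where
  linear : ∀ {W X Y Z : Q.Obj} (l : Chain Q.Hom Y Z) (r : Chain Q.Hom W X),
    IsLinearMap K fun f : Q.Hom X Y => φ (l.append (Chain.cons f r))
  degree : ∀ {X Y : Q.Obj} (c : Chain Q.Hom X Y) (d : ℤ), Q.HasDegree c d →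
    φ c ∈ R.gr (a X) (b Y) (d + p - c.length)

/-- Transport of a morphism along equalities of objects. -/
def castHom (Q : GradedQuiver.{w, u, v} K) {X X' Y Y' : Q.Obj} (hX : X = X') (hY : Y = Y')
    (f : Q.Hom X Y) : Q.Hom X' Y' :=
  cast (by rw [hX, hY]) f

end GradedQuiver

/-! ### `A∞` categories -/

/-- `∑_{k ≥ 1, i} (-1)^(i + k(n-i-k)) φ^(n-k+1) ∘ (id^(n-i-k) ⊗ m_k ⊗ id^i)`, evaluated on a
sequence of length `n`; here `m_k` has degree `2 - k`. -/
def precompSum {K : Type w} [CommRing K] (Q : GradedQuiver.{w, u, v} K)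
    (m : ∀ {X Y : Q.Obj}, Chain Q.Hom X Y → Q.Hom X Y)
    {T : Q.Obj → Q.Obj → Type v'} [∀ X Y, AddCommGroup (T X Y)]
    (φ : ∀ {X Y : Q.Obj}, Chain Q.Hom X Y → T X Y)
    {X Y : Q.Obj} (c : Chain Q.Hom X Y) : T X Y :=
  (c.splits₃.map fun s =>
    if s.mid.length = 0 then 0 else
      ((s.right.length : ℤ) + s.mid.length * s.left.length).negOnePow •
        φ ((Q.koszul (2 - s.mid.length) s.left).append
          (Chain.cons (m s.mid) s.right))).sum

/-- Non-unital `A∞` categories. The operation `m_i`, `i > 0`, is the restriction of `m` to sequences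
of length `i`; as there is no `m_0`, the value on empty sequences is set to be zero. -/
structure AInfCat (K : Type w) [CommRing K] extends GradedQuiver.{w, u, v} K where
  m : ∀ {X Y : Obj}, Chain Hom X Y → Hom X Y
  m_nil : ∀ X : Obj, m (Chain.nil : Chain Hom X X) = 0
  isMultilinear : toGradedQuiver.IsMultilinear toGradedQuiver id id 2 m
  relation : ∀ {X Y : Obj} (c : Chain Hom X Y), 0 < c.length →
    precompSum toGradedQuiver m m c = 0

namespace AInfCat

variable {K : Type w} [CommRing K] (A : AInfCat.{w, u, v} K)

/-- The differential `m_1`. -/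
def d {X Y : A.Obj} (f : A.Hom X Y) : A.Hom X Y := A.m (Chain.single f)

/-- The composition `m_2(g ⊗ f)`. -/
def comp {X Y Z : A.Obj} (g : A.Hom Y Z) (f : A.Hom X Y) : A.Hom X Z := A.m (Chain.pair g f)

/-- `x` and `y` differ by a coboundary. -/
def Cohomologous {X Y : A.Obj} (x y : A.Hom X Y) : Prop := ∃ h : A.Hom X Y, x - y = A.d h

/-- `u` is a closed element of degree `0` representing the identity of `X` in the cohomology
category. -/
structure IsCohUnit {X : A.Obj} (u : A.Hom X X) : Prop where
  mem : u ∈ A.gr X X 0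
  closed : A.d u = 0
  right : ∀ {Y : A.Obj} (f : A.Hom X Y), A.d f = 0 → A.Cohomologous (A.comp f u) f
  left : ∀ {Y : A.Obj} (f : A.Hom Y X), A.d f = 0 → A.Cohomologous (A.comp u f) f

/-- The cohomology category has identities. -/
def IsCohUnital : Prop := ∀ X : A.Obj, ∃ u : A.Hom X X, A.IsCohUnit u

/-- The map `φ` of complexes is homotopic to the identity. -/
def HomotopicToId {X Y : A.Obj} (φ : A.Hom X Y → A.Hom X Y) : Prop :=
  ∃ h : A.Hom X Y →ₗ[K] A.Hom X Y,
    (∀ (i : ℤ) (f : A.Hom X Y), f ∈ A.gr X Y i → h f ∈ A.gr X Y (i - 1)) ∧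
    ∀ f : A.Hom X Y, φ f - f = A.d (h f) + h (A.d f)

/-- Unital `A∞` categories. -/
def IsUnital : Prop :=
  A.IsCohUnital ∧ ∀ X : A.Obj, ∃ u : A.Hom X X, A.IsCohUnit u ∧
    (∀ Y : A.Obj, A.HomotopicToId fun f : A.Hom X Y => A.comp f u) ∧
    (∀ Y : A.Obj, A.HomotopicToId fun f : A.Hom Y X => A.comp u f)

/-- `e` is a strict unit of `X`. -/
structure IsStrictUnit {X : A.Obj} (e : A.Hom X X) : Prop where
  mem : e ∈ A.gr X X 0
  right : ∀ {Y : A.Obj} (f : A.Hom X Y), A.comp f e = f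
  left : ∀ {Y : A.Obj} (f : A.Hom Y X), A.comp e f = f
  vanish : ∀ {Y Z : A.Obj} (l : Chain A.Hom X Z) (r : Chain A.Hom Y X),
    (l.append (Chain.cons e r)).length ≠ 2 → A.m (l.append (Chain.cons e r)) = 0

/-- Strictly unital `A∞` categories. -/
def IsStrictlyUnital : Prop := ∀ X : A.Obj, ∃ e : A.Hom X X, A.IsStrictUnit e

variable {A} in
theorem IsStrictUnit.span_le {X : A.Obj} {e : A.Hom X X} (he : A.IsStrictUnit e) :
    Submodule.span K {e} ≤ A.gr X X 0 :=
  (Submodule.span_singleton_le_iff_mem _ _).2 he.mem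

variable {A} in
theorem IsStrictUnit.eq {X : A.Obj} {e e' : A.Hom X X} (he : A.IsStrictUnit e)
    (he' : A.IsStrictUnit e') : e = e' :=
  (he'.right e).symm.trans (he.left e')

/-- Strictly unital, and for every object `X` with strict unit `e` one has `K ≅ K e` and the
inclusion of `K e` in the degree `0` part of `A(X, X)` is a split monomorphism of `K`-modules. -/
def HasSplitUnits : Prop :=
  A.IsStrictlyUnital ∧ ∀ (X : A.Obj) (e : A.Hom X X) (he : A.IsStrictUnit e),
    Nonempty (K ≃ₗ[K] Submodule.span K {e}) ∧
    ∃ r : A.gr X X 0 →ₗ[K] Submodule.span K {e},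
      r ∘ₗ Submodule.inclusion he.span_le = LinearMap.id

end AInfCat

/-! ### `A∞` functors -/

/-- `(F^{i_r} ⊗ ⋯ ⊗ F^{i_1})(c_r ⊗ ⋯ ⊗ c_1)`, Koszul signs included (`F^i` has degree `1 - i`). -/
def mapBlocks {K : Type w} [CommRing K] (Q : GradedQuiver.{w, u, v} K)
    (R : GradedQuiver.{w, u', v'} K) (obj : Q.Obj → R.Obj)
    (F : ∀ {X Y : Q.Obj}, Chain Q.Hom X Y → R.Hom (obj X) (obj Y)) {X : Q.Obj} :
    {Y : Q.Obj} → Chain (Chain Q.Hom) X Y → Chain R.Hom (obj X) (obj Y)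
  | _, Chain.nil => Chain.nil
  | _, Chain.cons b I => Chain.cons (F (Q.koszul (Chain.defect I) b)) (mapBlocks Q R obj F I)

/-- Non-unital `A∞` functors. The component `F^0` is `obj`, and `F^i`, `i > 0`, is the restriction
of `map` to sequences of length `i`; the value of `map` on empty sequences is set to be zero. -/
structure AInfFunctor {K : Type w} [CommRing K] (A : AInfCat.{w, u, v} K)
    (B : AInfCat.{w, u', v'} K) where
  obj : A.Obj → B.Obj
  map : ∀ {X Y : A.Obj}, Chain A.Hom X Y → B.Hom (obj X) (obj Y)
  map_nil : ∀ X : A.Obj, map (Chain.nil : Chain A.Hom X X) = 0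
  isMultilinear : A.toGradedQuiver.IsMultilinear B.toGradedQuiver obj obj 1 map
  relation : ∀ {X Y : A.Obj} (c : Chain A.Hom X Y), 0 < c.length →
    precompSum A.toGradedQuiver A.m (T := fun X Y => B.Hom (obj X) (obj Y)) map c =
      (c.blocks.map fun I => (Chain.blockSign I).negOnePow •
        B.m (mapBlocks A.toGradedQuiver B.toGradedQuiver obj map I)).sum

/-- Prenatural transformations of degree `p`; `θ^i`, `i ≥ 0`, is the restriction of `app` to
sequences of length `i`. -/
structure PrenatTrans {K : Type w} [CommRing K] {A : AInfCat.{w, u, v} K}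
    {B : AInfCat.{w, u', v'} K} (F G : AInfFunctor A B) (p : ℤ) where
  app : ∀ {X Y : A.Obj}, Chain A.Hom X Y → B.Hom (F.obj X) (G.obj Y)
  isMultilinear : A.toGradedQuiver.IsMultilinear B.toGradedQuiver F.obj G.obj p app

namespace PrenatTrans

variable {K : Type w} [CommRing K] {A : AInfCat.{w, u, v} K} {B : AInfCat.{w, u', v'} K}
  {F G : AInfFunctor A B} {p : ℤ}

/-- One summand
`± m_{r+s+1} ∘ (G^{j_s} ⊗ ⋯ ⊗ G^{j_1} ⊗ θ^k ⊗ F^{i_r} ⊗ ⋯ ⊗ F^{i_1})` of the differential of `θ`,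
evaluated on `J ⊗ mid ⊗ I`. The exponent of the sign is
`p + r(p-1) + ∑_t (1-i_t)(n - ∑_{u<t} i_u) + (p-k) ∑_t j_t + ∑_{t<u} (1-j_t) j_u`,
and the Koszul sign of moving the maps on the right (of total degree `∑_t (1-i_t)`) past `mid`
comes from `koszul`. The sign of moving `θ^k` and the `F^{i_t}` past the blocks of `J` is not
included here. -/
def term (θ : PrenatTrans F G p) {X Y Z W : A.Obj} (J : Chain (Chain A.Hom) Z W)
    (mid : Chain A.Hom Y Z) (I : Chain (Chain A.Hom) X Y) : B.Hom (F.obj X) (G.obj W) :=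
  (p + I.length * (p - 1) + Chain.rightSign (Chain.total J + mid.length + Chain.total I) I +
      (p - mid.length) * Chain.total J + Chain.blockSign J).negOnePow •
    B.m ((mapBlocks A.toGradedQuiver B.toGradedQuiver G.obj G.map J).append
      (Chain.cons (θ.app (A.koszul (Chain.defect I) mid))
        (mapBlocks A.toGradedQuiver B.toGradedQuiver F.obj F.map I)))

/-- The differential `m_1(θ)` of the `A∞` category of functors, evaluated on a sequence. In the
second sum the sequence is written as `left ⊗ mid ⊗ right` in all ways, and then `left` and `right`
are cut in non-empty blocks in all ways. -/
def diff (θ : PrenatTrans F G p) {X Y : A.Obj} (c : Chain A.Hom X Y) :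
    B.Hom (F.obj X) (G.obj Y) :=
  precompSum A.toGradedQuiver A.m (T := fun X Y => B.Hom (F.obj X) (G.obj Y)) θ.app c +
    (c.splits₃.map fun s =>
      (s.right.blocks.map fun I =>
        ((A.koszul ((p - s.mid.length) + Chain.defect I) s.left).blocks.map fun J =>
          θ.term J s.mid I).sum).sum).sum

end PrenatTrans

namespace AInfFunctor

variable {K : Type w} [CommRing K] {A : AInfCat.{w, u, v} K} {B : AInfCat.{w, u', v'} K}

/-- `F` and `G` agree on objects, and there is a prenatural transformation `θ : F → G` of degree `0`
with `θ^0 = 0` and `G^i = F^i + m_1(θ)^i` for every `i > 0`. -/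
def Homotopic (F G : AInfFunctor A B) : Prop :=
  ∃ (h : ∀ X : A.Obj, F.obj X = G.obj X) (θ : PrenatTrans F G 0),
    (∀ X : A.Obj, θ.app (Chain.nil : Chain A.Hom X X) = 0) ∧
    ∀ {X Y : A.Obj} (c : Chain A.Hom X Y), 0 < c.length →
      B.castHom (h X).symm rfl (G.map c) = B.castHom rfl (h Y) (F.map c) + θ.diff c

/-- `F` is a unital functor: source and target are unital, and the functor induced in cohomology
preserves identities. -/
def IsUnital (F : AInfFunctor A B) : Prop :=
  A.IsUnital ∧ B.IsUnital ∧
    ∀ (X : A.Obj) (u : A.Hom X X), A.IsCohUnit u → B.IsCohUnit (F.map (Chain.single u))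

/-- `F` is a strictly unital functor: source and target are strictly unital, `F^1` sends strict units
to strict units, and `F^i`, `i > 1`, vanishes if one of the arguments is a strict unit. -/
def IsStrictlyUnital (F : AInfFunctor A B) : Prop :=
  A.IsStrictlyUnital ∧ B.IsStrictlyUnital ∧
    ∀ (X : A.Obj) (e : A.Hom X X), A.IsStrictUnit e →
      B.IsStrictUnit (F.map (Chain.single e)) ∧
      ∀ {Y Z : A.Obj} (l : Chain A.Hom X Z) (r : Chain A.Hom Y X),
        1 < (l.append (Chain.cons e r)).length → F.map (l.append (Chain.cons e r)) = 0

end AInfFunctor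

end AInf

end

/-! Shift all degrees by one. Up to the sign twists `sg` and `om`, the operations become one family
`b`, and families of maps from composable sequences to tensors form a ring `Conv` under convolution.
In it a functor is a family `F`, zero on empty sequences, whose sum of tensor powers `F.hat`, the
inverse of `1 - F`, satisfies `beta F.hat = bd F`. Here `beta` applies the operations of the target
and `bd` precomposes with the coderivation of the source. A closed degree `0` transformation `T`
from `F` to `G` satisfies `bd T + beta ((post G).hat * (T * F.hat)) = 0`, where `post` is the sign
of moving the odd `T` past the factors `G`.

Homotopies are gauge transformations. For a functor `f` and a degree `0` cochain `t` vanishing on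
empty sequences, the equation `g = f + bd t + beta ((post g).hat * (t * f.hat))` is solved
recursively in the length (`gaugeMap_gauge`). If `ε` is the strict unit on empty sequences, the
equation says that `τ = t - ε` is closed from `f` to `g` (`relation_of_gauge`). Then `g` is
automatically a functor: its defect `r = beta g.hat - bd g` satisfies a Bianchi identity
(`gauge_bianchi`), and since `τ` is minus a unit on empty sequences, the lowest nonzero part of `r`
would contradict it (`eq_zero_of_beta`).

The functor is normalized in two steps. First, `F^1(e) - e = d h` because `F` is unital. Split units
give a linear form `ρ` with `ρ e = 1`, so `x ↦ -ρ x • h` is defined on all endomorphisms, and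
gauging by it makes the functor preserve the units themselves (`exists_normal_zero`). Secondly, as
in the normalization of the bar complex, inserting a unit is a contracting homotopy. If `f` already
behaves well when a unit is among its first `n` arguments from the left, gauging by `t (l ⊗ r) = -f
(σ l ⊗ e ⊗ r)` with `l` of length `n` and `σ` the Koszul sign repairs the next position
(`normalTo_gauge`). This `t` vanishes on sequences shorter than `n`, so the infinite tower is
stationary in each length and has a limit.

The homotopies are composed as closed transformations (`IsTrans.comp`), which also stabilize, and
the composite is again minus the unit on empty sequences. Adding `ε` turns it back into a homotopy
(`homotopic_functor`). -/

noncomputable section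

/-! ### Sums over splittings of composable sequences. -/

namespace AInf
namespace Chain

variable {O : Type u} {H : O → O → Type v} {H' : O → O → Type v'}

@[simp] theorem nil_append {X Y : O} (c : Chain H X Y) : nil.append c = c := rfl

@[simp] theorem cons_append {W X Y Z : O} (f : H Y Z) (l : Chain H X Y) (r : Chain H W X) :
    (cons f l).append r = cons f (l.append r) := rfl

@[simp] theorem append_nil {X : O} : ∀ {Y : O} (c : Chain H X Y), c.append nil = c
  | _, nil => rfl
  | _, cons f c => by rw [cons_append, append_nil c]

theorem append_assoc {V W X : O} : ∀ {Y : O} (a : Chain H X Y) (b : Chain H W X) (c : Chain H V W),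
    (a.append b).append c = a.append (b.append c)
  | _, nil, _, _ => rfl
  | _, cons f a, b, c => by simp only [cons_append, append_assoc a b c]

@[simp] theorem length_nil {X : O} : (nil : Chain H X X).length = 0 := rfl

@[simp] theorem length_cons {X Y Z : O} (f : H Y Z) (c : Chain H X Y) :
    (cons f c).length = c.length + 1 := rfl

@[simp] theorem length_append {W X : O} : ∀ {Y : O} (l : Chain H X Y) (r : Chain H W X),
    (l.append r).length = l.length + r.length
  | _, nil, r => by simp
  | _, cons f l, r => by simp [length_append l r]; omega

@[simp] theorem map_nil (φ : ∀ {X Y : O}, H X Y → H' X Y) {X : O} :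
    (nil : Chain H X X).map φ = nil := rfl

@[simp] theorem map_cons (φ : ∀ {X Y : O}, H X Y → H' X Y) {X Y Z : O} (f : H Y Z)
    (c : Chain H X Y) : (cons f c).map φ = cons (φ f) (c.map φ) := rfl

@[simp] theorem map_append (φ : ∀ {X Y : O}, H X Y → H' X Y) {W X : O} :
    ∀ {Y : O} (l : Chain H X Y) (r : Chain H W X),
      (l.append r).map φ = (l.map φ).append (r.map φ)
  | _, nil, _ => rfl
  | _, cons f l, r => by simp [map_append φ l r]

@[simp] theorem length_map (φ : ∀ {X Y : O}, H X Y → H' X Y) {X : O} :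
    ∀ {Y : O} (c : Chain H X Y), (c.map φ).length = c.length
  | _, nil => rfl
  | _, cons f c => by simp [length_map φ c]

/-- The sum of `g l r` over all ways to write `c` as `l ⊗ r`. -/
def spl {M : Type*} [AddCommMonoid M] {X Z : O} (c : Chain H X Z)
    (g : ∀ Y, Chain H Y Z → Chain H X Y → M) : M :=
  (c.splits.map fun s => g s.1 s.2.1 s.2.2).sum

variable {M : Type*} [AddCommMonoid M]

@[simp] theorem spl_nil {X : O} (g : ∀ Y, Chain H Y X → Chain H X Y → M) :
    spl nil g = g X nil nil := by simp [spl, splits]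

@[simp] theorem spl_cons {X Y Z : O} (f : H Y Z) (c : Chain H X Y)
    (g : ∀ Y, Chain H Y Z → Chain H X Y → M) :
    spl (cons f c) g = g Z nil (cons f c) + spl c fun W l r => g W (cons f l) r := by
  simp [spl, splits, Function.comp_def]

theorem spl_congr {X : O} : ∀ {Z : O} (c : Chain H X Z) {g g' : ∀ Y, Chain H Y Z → Chain H X Y → M},
    (∀ Y l r, l.append r = c → g Y l r = g' Y l r) → spl c g = spl c g'
  | _, nil, g, g', h => by simp [h]
  | _, cons f c, g, g', h => by
    rw [spl_cons, spl_cons, h _ _ _ rfl]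
    congr 1
    exact spl_congr c fun Y l r e => h _ _ _ (by simp [e])

theorem spl_congr' {X Z : O} (c : Chain H X Z) {g g' : ∀ Y, Chain H Y Z → Chain H X Y → M}
    (h : ∀ Y l r, l.length + r.length = c.length → g Y l r = g' Y l r) : spl c g = spl c g' :=
  spl_congr c fun Y l r e => h Y l r (by simp [← e])

theorem spl_zero {X Z : O} (c : Chain H X Z) : (spl c fun _ _ _ => (0 : M)) = 0 := by
  simp [spl]

theorem spl_eq_zero {X Z : O} (c : Chain H X Z) {g : ∀ Y, Chain H Y Z → Chain H X Y → M}
    (h : ∀ Y l r, l.append r = c → g Y l r = 0) : spl c g = 0 :=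
  (spl_congr c h).trans (spl_zero c)

theorem spl_add {X Z : O} (c : Chain H X Z) (g g' : ∀ Y, Chain H Y Z → Chain H X Y → M) :
    (spl c fun Y l r => g Y l r + g' Y l r) = spl c g + spl c g' := by
  simp [spl]

theorem map_spl {N : Type*} [AddCommMonoid N] {F : Type*} [FunLike F M N] [AddMonoidHomClass F M N]
    (φ : F) {X Z : O} (c : Chain H X Z) (g : ∀ Y, Chain H Y Z → Chain H X Y → M) :
    φ (spl c g) = spl c fun Y l r => φ (g Y l r) := by
  simp [spl, map_list_sum, Function.comp_def]

/-- Coassociativity of deconcatenation; it makes the convolution product associative. -/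
theorem spl_spl {X : O} : ∀ {Z : O} (c : Chain H X Z)
    (g : ∀ Y Y', Chain H Y' Z → Chain H Y Y' → Chain H X Y → M),
    (spl c fun Y' l r' => spl r' fun Y m r => g Y Y' l m r) =
      spl c fun Y l' r => spl l' fun Y' l m => g Y Y' l m r
  | _, nil, g => by simp
  | _, cons f c, g => by
    simp only [spl_cons, spl_add, spl_nil]
    rw [spl_spl c, add_assoc]

theorem spl_append_cons {W X Y : O} (f : H X Y) (r : Chain H W X) : ∀ {Z : O} (l : Chain H Y Z)
    (g : ∀ V, Chain H V Z → Chain H W V → M),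
    spl (l.append (cons f r)) g =
      (spl l fun V l₁ l₂ => g V l₁ (l₂.append (cons f r))) +
        spl r fun V r₁ r₂ => g V (l.append (cons f r₁)) r₂
  | _, nil, g => by simp
  | _, cons x l, g => by
    simp only [cons_append, spl_cons]
    rw [spl_append_cons f r l, add_assoc]

theorem spl_map (φ : ∀ {X Y : O}, H X Y → H' X Y) {X : O} : ∀ {Z : O} (c : Chain H X Z)
    (g : ∀ Y, Chain H' Y Z → Chain H' X Y → M),
    spl (c.map φ) g = spl c fun Y l r => g Y (l.map φ) (r.map φ)
  | _, nil, g => by simp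
  | _, cons f c, g => by
    simp only [map_cons, spl_cons]
    rw [spl_map φ c]
    rfl

theorem spl_length_zero_right {X : O} : ∀ {Z : O} (c : Chain H X Z)
    (g : ∀ Y, Chain H Y Z → Chain H X Y → M) (_ : ∀ Y l r, r.length ≠ 0 → g Y l r = 0),
    spl c g = g X c nil
  | _, nil, g, _ => by simp
  | _, cons f c, g, h => by
    rw [spl_cons, h _ _ _ (by simp), zero_add]
    exact spl_length_zero_right c (fun W l r => g W (cons f l) r) fun _ _ _ hr => h _ _ _ hr

theorem spl_length_zero_left {X : O} {Z : O} (c : Chain H X Z)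
    (g : ∀ Y, Chain H Y Z → Chain H X Y → M) (h : ∀ Y l r, l.length ≠ 0 → g Y l r = 0) :
    spl c g = g Z nil c := by
  cases c with
  | nil => simp
  | cons f c =>
    rw [spl_cons, spl_eq_zero, add_zero]
    intro Y l r _
    exact h _ _ _ (by simp)

theorem sum_splits₃ {X Z : O} (c : Chain H X Z) (g : Split₃ H X Z → M) :
    (c.splits₃.map g).sum = spl c fun _ l r' => spl r' fun _ m r => g ⟨l, m, r⟩ := by
  rw [splits₃, List.map_flatMap, List.flatMap, List.sum_flatten, List.map_map]
  simp only [spl, Function.comp_def, List.map_map]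

/-- A decomposition in blocks is a leftmost block together with a decomposition of the rest. This is
the recursion matched later with `P.hat = P * P.hat + 1`. -/
theorem sum_blocks_cons {X Y : O} : ∀ {Z : O} (c : Chain H X Y) (f : H Y Z)
    (φ : Chain (Chain H) X Z → M),
    ((cons f c).blocks.map φ).sum = spl c fun _ l r => (r.blocks.map fun I => φ (cons (cons f l) I)).sum
  | _, nil, f, φ => by simp [blocks, extendBlocks, single]
  | _, cons h c, f, φ => by
    have key : ∀ ψ : Chain (Chain H) X Y → M, ((cons h c).blocks.map ψ).sum = spl c fun _ l r =>
        (r.blocks.map fun I => ψ (cons (cons h l) I)).sum := sum_blocks_cons c h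
    rw [blocks, List.map_flatMap, List.flatMap, List.sum_flatten, List.map_map]
    simp only [Function.comp_def]
    rw [key, spl_cons, key, ← spl_add]
    congr 1
    funext W l r
    simp only [extendBlocks, List.map_cons, List.map_nil, List.sum_cons, List.sum_nil, add_zero]
    exact List.sum_map_add

end Chain
end AInf

/-! ### The sign involution of the shifted degrees. -/

namespace AInf

theorem negOnePow_smul_smul {M : Type*} [AddCommGroup M] (a b : ℤ) (x : M) :
    a.negOnePow • b.negOnePow • x = (a + b).negOnePow • x := by
  rw [smul_smul, Int.negOnePow_add]

theorem negOnePow_smul_congr {M : Type*} [AddCommGroup M] {a b : ℤ} (h : Even (a - b)) {x y : M}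
    (e : x = y) : a.negOnePow • x = b.negOnePow • y := by
  rw [(Int.negOnePow_eq_iff a b).2 h, e]

namespace GradedQuiver

variable {K : Type w} [CommRing K] (Q : GradedQuiver.{w, u, v} K)

/-- The `K`-linear map with `x ↦ (-1)^(k (d + 1)) x` for `x` homogeneous of degree `d`, that is
the `k`-th power of the sign involution for the degree shifted by one. -/
def sg (k : ℤ) {X Y : Q.Obj} : Q.Hom X Y →ₗ[K] Q.Hom X Y := k.negOnePow • Q.twist k

variable {Q} in
theorem sg_of_mem (k : ℤ) {X Y : Q.Obj} {d : ℤ} {x : Q.Hom X Y} (hx : x ∈ Q.gr X Y d) :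
    Q.sg k x = (k * (d + 1)).negOnePow • x := by
  rw [sg, LinearMap.smul_apply, twist_of_mem Q k hx, negOnePow_smul_smul]
  congr 2; ring

variable {Q} in
theorem hom_ext {X Y : Q.Obj} {M : Type*} [AddCommGroup M] [Module K M] {f g : Q.Hom X Y →ₗ[K] M}
    (h : ∀ d, ∀ x ∈ Q.gr X Y d, f x = g x) : f = g := by
  have ht := (Q.isInternal X Y).submodule_iSup_eq_top
  rw [← LinearMap.eqLocus_eq_top, eq_top_iff, ← ht, iSup_le_iff]
  exact fun d x hx => h d x hx

variable {Q} in
theorem unit_smul_mem {M : Type*} [AddCommGroup M] [Module K M] (S : Submodule K M) (k : ℤ) {x : M}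
    (hx : x ∈ S) : k.negOnePow • x ∈ S := by
  rcases Int.even_or_odd k with h | h
  · simpa [Int.negOnePow_even k h] using hx
  · simpa [Int.negOnePow_odd k h, Units.smul_def] using hx

variable {Q} in
theorem sg_mem (k : ℤ) {X Y : Q.Obj} {d : ℤ} {x : Q.Hom X Y} (hx : x ∈ Q.gr X Y d) :
    Q.sg k x ∈ Q.gr X Y d := by
  rw [sg_of_mem k hx]
  exact unit_smul_mem _ _ hx

theorem sg_sg (k l : ℤ) {X Y : Q.Obj} (x : Q.Hom X Y) : Q.sg k (Q.sg l x) = Q.sg (k + l) x := by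
  have : Q.sg k ∘ₗ Q.sg l = (Q.sg (k + l) : Q.Hom X Y →ₗ[K] Q.Hom X Y) := by
    refine hom_ext fun d x hx => ?_
    rw [LinearMap.comp_apply, sg_of_mem k (sg_mem l hx), sg_of_mem l hx, sg_of_mem _ hx,
      negOnePow_smul_smul]
    congr 2; ring
  exact LinearMap.congr_fun this x

theorem sg_congr {k l : ℤ} (h : Even (k - l)) {X Y : Q.Obj} :
    (Q.sg k : Q.Hom X Y →ₗ[K] Q.Hom X Y) = Q.sg l := by
  refine hom_ext fun d x hx => ?_
  rw [sg_of_mem k hx, sg_of_mem l hx]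
  exact negOnePow_smul_congr (by rw [← sub_mul]; exact h.mul_right _) rfl

theorem sg_even {k : ℤ} (h : Even k) {X Y : Q.Obj} (x : Q.Hom X Y) : Q.sg k x = x := by
  have : Q.sg k = (LinearMap.id : Q.Hom X Y →ₗ[K] Q.Hom X Y) := by
    refine hom_ext fun d x hx => ?_
    rw [sg_of_mem k hx, Int.negOnePow_even _ (h.mul_right _), one_smul, LinearMap.id_apply]
  rw [this, LinearMap.id_apply]

@[simp] theorem sg_zero {X Y : Q.Obj} (x : Q.Hom X Y) : Q.sg 0 x = x := Q.sg_even (by simp) x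

@[simp] theorem sg_one_one {X Y : Q.Obj} (x : Q.Hom X Y) : Q.sg 1 (Q.sg 1 x) = x := by
  rw [sg_sg]; exact Q.sg_even (by decide) x

theorem twist_eq (k : ℤ) {X Y : Q.Obj} (x : Q.Hom X Y) : Q.twist k x = k.negOnePow • Q.sg k x := by
  rw [sg, LinearMap.smul_apply, negOnePow_smul_smul, Int.negOnePow_even _ ⟨k, rfl⟩, one_smul]

/-- `sg k` applied to every entry. -/
def sgc (k : ℤ) {X Y : Q.Obj} (c : Chain Q.Hom X Y) : Chain Q.Hom X Y := c.map (Q.sg k)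

@[simp] theorem sgc_nil (k : ℤ) {X : Q.Obj} :
    Q.sgc k (Chain.nil : Chain Q.Hom X X) = Chain.nil := rfl

@[simp] theorem sgc_cons (k : ℤ) {X Y Z : Q.Obj} (f : Q.Hom Y Z) (c : Chain Q.Hom X Y) :
    Q.sgc k (Chain.cons f c) = Chain.cons (Q.sg k f) (Q.sgc k c) := rfl

@[simp] theorem sgc_append (k : ℤ) {X Y Z : Q.Obj} (l : Chain Q.Hom Y Z) (r : Chain Q.Hom X Y) :
    Q.sgc k (l.append r) = (Q.sgc k l).append (Q.sgc k r) := Chain.map_append _ l r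

@[simp] theorem length_sgc (k : ℤ) {X Y : Q.Obj} (c : Chain Q.Hom X Y) :
    (Q.sgc k c).length = c.length := Chain.length_map _ c

theorem sgc_sgc (k l : ℤ) {X : Q.Obj} : ∀ {Y : Q.Obj} (c : Chain Q.Hom X Y),
    Q.sgc k (Q.sgc l c) = Q.sgc (k + l) c
  | _, Chain.nil => rfl
  | _, Chain.cons f c => by simp [sgc_sgc k l c, sg_sg]

theorem sgc_congr {k l : ℤ} (h : Even (k - l)) {X : Q.Obj} : ∀ {Y : Q.Obj} (c : Chain Q.Hom X Y),
    Q.sgc k c = Q.sgc l c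
  | _, Chain.nil => rfl
  | _, Chain.cons f c => by simp [sgc_congr h c, Q.sg_congr h]

theorem sgc_even {k : ℤ} (h : Even k) {X : Q.Obj} : ∀ {Y : Q.Obj} (c : Chain Q.Hom X Y),
    Q.sgc k c = c
  | _, Chain.nil => rfl
  | _, Chain.cons f c => by simp [sgc_even h c, Q.sg_even h]

@[simp] theorem sgc_one_one {X Y : Q.Obj} (c : Chain Q.Hom X Y) : Q.sgc 1 (Q.sgc 1 c) = c := by
  rw [sgc_sgc]; exact Q.sgc_even (by decide) c

theorem spl_sgc (k : ℤ) {M : Type*} [AddCommMonoid M] {X Z : Q.Obj} (c : Chain Q.Hom X Z)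
    (g : ∀ Y, Chain Q.Hom Y Z → Chain Q.Hom X Y → M) :
    (Q.sgc k c).spl g = c.spl fun Y l r => g Y (Q.sgc k l) (Q.sgc k r) := Chain.spl_map _ c g

variable {Q} in
theorem HasDegree.sgc (k : ℤ) {X Y : Q.Obj} {c : Chain Q.Hom X Y} {d : ℤ} (h : Q.HasDegree c d) :
    Q.HasDegree (Q.sgc k c) d := by
  induction h with
  | nil => exact .nil
  | cons hf _ ih => exact .cons (sg_mem k hf) ih

/-! ### Multilinear functions on chains -/

/-- A function on composable sequences which is linear in every entry. -/
def Multilin {Q : GradedQuiver.{w, u, v} K} {X Y : Q.Obj} {M : Type*} [AddCommGroup M] [Module K M]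
    (φ : Chain Q.Hom X Y → M) : Prop :=
  ∀ ⦃V W : Q.Obj⦄ (l : Chain Q.Hom W Y) (r : Chain Q.Hom X V),
    IsLinearMap K fun f : Q.Hom V W => φ (l.append (Chain.cons f r))

variable {Q} {M N : Type*} [AddCommGroup M] [Module K M] [AddCommGroup N] [Module K N]

theorem Multilin.map_zero {X Y : Q.Obj} {φ : Chain Q.Hom X Y → M} (h : Multilin φ) {V W : Q.Obj}
    (l : Chain Q.Hom W Y) (r : Chain Q.Hom X V) : φ (l.append (Chain.cons 0 r)) = 0 :=
  (h l r).map_zero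

theorem Multilin.cons {X Y Z : Q.Obj} {φ : Chain Q.Hom X Z → M} (h : Multilin φ) (f : Q.Hom Y Z) :
    Multilin fun c : Chain Q.Hom X Y => φ (Chain.cons f c) :=
  fun _ _ l r => h (Chain.cons f l) r

theorem Multilin.append_left {X Y Z : Q.Obj} {φ : Chain Q.Hom X Z → M} (h : Multilin φ)
    (a : Chain Q.Hom Y Z) : Multilin fun c : Chain Q.Hom X Y => φ (a.append c) := fun _ _ l r => by
  simpa only [Chain.append_assoc] using h (a.append l) r

theorem Multilin.append_right {X Y Z : Q.Obj} {φ : Chain Q.Hom X Z → M} (h : Multilin φ)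
    (a : Chain Q.Hom X Y) : Multilin fun c : Chain Q.Hom Y Z => φ (c.append a) := fun _ _ l r => by
  simpa only [Chain.append_assoc, Chain.cons_append] using h l (r.append a)

theorem isLinearMap_add {f g : N → M} (hf : IsLinearMap K f) (hg : IsLinearMap K g) :
    IsLinearMap K fun x => f x + g x :=
  (hf.mk' f + hg.mk' g).isLinear

theorem Multilin.comp {X Y : Q.Obj} {φ : Chain Q.Hom X Y → M} (h : Multilin φ) (f : M →ₗ[K] N) :
    Multilin fun c => f (φ c) := fun _ _ l r => (f ∘ₗ (h l r).mk' _).isLinear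

theorem Multilin.add {X Y : Q.Obj} {φ ψ : Chain Q.Hom X Y → M} (h : Multilin φ) (h' : Multilin ψ) :
    Multilin fun c => φ c + ψ c := fun _ _ l r => isLinearMap_add (h l r) (h' l r)

theorem Multilin.neg {X Y : Q.Obj} {φ : Chain Q.Hom X Y → M} (h : Multilin φ) :
    Multilin fun c => -φ c := fun _ _ l r => (-((h l r).mk' _)).isLinear

theorem multilin_zero {X Y : Q.Obj} : Multilin fun _ : Chain Q.Hom X Y => (0 : M) :=
  fun _ _ _ _ => (0 : _ →ₗ[K] M).isLinear

theorem Multilin.sgc (k : ℤ) {X Y : Q.Obj} {φ : Chain Q.Hom X Y → M} (h : Multilin φ) :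
    Multilin fun c => φ (Q.sgc k c) := fun _ _ l r => by
  simp only [sgc_append, sgc_cons]
  exact (((h (Q.sgc k l) (Q.sgc k r)).mk' _) ∘ₗ Q.sg k).isLinear

theorem isLinearMap_spl {O : Type*} {H : O → O → Type*} {X Z : O} (c : Chain H X Z)
    (g : ∀ Y, Chain H Y Z → Chain H X Y → N → M) (h : ∀ Y l r, IsLinearMap K (g Y l r)) :
    IsLinearMap K fun x => c.spl fun Y l r => g Y l r x := by
  constructor
  · intro x y
    rw [← Chain.spl_add]
    exact Chain.spl_congr c fun Y l r _ => (h Y l r).map_add x y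
  · intro a x
    rw [← DistribMulAction.toAddMonoidHom_apply M a, Chain.map_spl]
    exact Chain.spl_congr c fun Y l r _ => (h Y l r).map_smul a x

/-- The sum over all splittings of a function linear in all entries. -/
theorem Multilin.spl {X Z : Q.Obj} {g : ∀ Y, Chain Q.Hom Y Z → Chain Q.Hom X Y → M}
    (hl : ∀ Y r, Multilin fun l => g Y l r) (hr : ∀ Y l, Multilin fun r => g Y l r) :
    Multilin fun c : Chain Q.Hom X Z => c.spl g := by
  intro V W l r
  simp only [Chain.spl_append_cons]
  exact isLinearMap_add (isLinearMap_spl l _ fun Y l₁ l₂ => hr Y l₁ l₂ r)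
    (isLinearMap_spl r _ fun Y r₁ r₂ => hl Y r₂ l r₁)

/-- Each morphism module is spanned by its homogeneous elements, so the entries can be made
homogeneous one at a time. All sign identities below are checked in this way. -/
theorem multilin_ext {X : Q.Obj} : ∀ {Y : Q.Obj} {φ ψ : Chain Q.Hom X Y → M}, Multilin φ →
    Multilin ψ → (∀ c d, Q.HasDegree c d → φ c = ψ c) → ∀ c, φ c = ψ c
  | _, φ, ψ, hφ, hψ, h, Chain.nil => h _ _ .nil
  | _, φ, ψ, hφ, hψ, h, Chain.cons f c => by
    have : ∀ d, ∀ x ∈ Q.gr _ _ d, φ (.cons x c) = ψ (.cons x c) := fun d x hx =>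
      multilin_ext (hφ.cons x) (hψ.cons x) (fun c e hc => h _ _ (.cons hx hc)) c
    exact LinearMap.congr_fun
      (hom_ext (f := (hφ Chain.nil c).mk' _) (g := (hψ Chain.nil c).mk' _) this) f

theorem isMultilinear_multilin {R : GradedQuiver.{w, u', v'} K} {a b : Q.Obj → R.Obj} {p : ℤ}
    {φ : ∀ {X Y : Q.Obj}, Chain Q.Hom X Y → R.Hom (a X) (b Y)} (h : Q.IsMultilinear R a b p φ)
    {X Y : Q.Obj} : Multilin fun c : Chain Q.Hom X Y => φ c :=
  fun _ _ l r => h.linear l r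

theorem HasDegree.sgc_eq {X Y : Q.Obj} {c : Chain Q.Hom X Y} {d : ℤ} (h : Q.HasDegree c d) (k : ℤ) :
    ∀ {φ : Chain Q.Hom X Y → M}, Multilin φ →
      φ (Q.sgc k c) = (k * (d + c.length)).negOnePow • φ c := by
  induction h with
  | nil => intro φ _; simp
  | @cons Y Z f c d e hf hc ih =>
    intro φ hφ
    have := ih (hφ.cons (Q.sg k f))
    rw [sgc_cons, this, sg_of_mem k hf]
    have h2 : ∀ n : ℤ, φ (Chain.cons (n.negOnePow • f) c) = n.negOnePow • φ (Chain.cons f c) :=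
      fun n => map_zsmul ((hφ Chain.nil c).mk' _) _ f
    rw [h2, negOnePow_smul_smul]
    congr 2
    push_cast [Chain.length_cons]
    ring

/-- A multilinear family of degree `p` has the parity of `p + 1` for the shifted degrees. -/
theorem IsMultilinear.map_sgc {R : GradedQuiver.{w, u', v'} K} {a b : Q.Obj → R.Obj} {p : ℤ}
    {φ : ∀ {X Y : Q.Obj}, Chain Q.Hom X Y → R.Hom (a X) (b Y)} (h : Q.IsMultilinear R a b p φ)
    (k : ℤ) {X Y : Q.Obj} (c : Chain Q.Hom X Y) :
    φ (Q.sgc k c) = (k * (p + 1)).negOnePow • R.sg k (φ c) := by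
  have hm : Multilin fun c : Chain Q.Hom X Y => φ c := isMultilinear_multilin h
  have e : ∀ n : ℤ, Multilin fun c : Chain Q.Hom X Y => n.negOnePow • R.sg k (φ c) := by
    intro n
    have := hm.comp (n.negOnePow • (R.sg k : R.Hom (a X) (b Y) →ₗ[K] _))
    simpa only [LinearMap.smul_apply] using this
  refine multilin_ext (hm.sgc k) (e _) (fun c d hc => ?_) c
  rw [hc.sgc_eq k hm, sg_of_mem k (h.degree c d hc), negOnePow_smul_smul]
  refine negOnePow_smul_congr ?_ rfl
  have : k * (d + c.length) - (k * (p + 1) + k * (d + p - c.length + 1)) =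
    2 * (k * (c.length - p - 1)) := by ring
  rw [this]; exact even_two_mul _

end GradedQuiver
end AInf

namespace AInf
namespace GradedQuiver

variable {K : Type w} [CommRing K]

/-! ### Tensor products of composable sequences -/

section Tens

variable (R : GradedQuiver.{w, u', v'} K)

/-- The relations expressing linearity in every entry. -/
def tensRel (X Y : R.Obj) : Submodule K (Chain R.Hom X Y →₀ K) :=
  Submodule.span K {z | ∃ (V W : R.Obj) (l : Chain R.Hom W Y) (r : Chain R.Hom X V) (k : K)
    (f g : R.Hom V W), z = Finsupp.single (l.append (Chain.cons (k • f + g) r)) 1 -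
      (k • Finsupp.single (l.append (Chain.cons f r)) 1 +
        Finsupp.single (l.append (Chain.cons g r)) 1)}

/-- The direct sum of all tensor products `R(X_{n-1}, Y) ⊗ ⋯ ⊗ R(X, X_1)`. -/
def Tens (X Y : R.Obj) : Type (max w u' v') := (Chain R.Hom X Y →₀ K) ⧸ R.tensRel X Y

instance (X Y : R.Obj) : AddCommGroup (R.Tens X Y) :=
  inferInstanceAs (AddCommGroup ((Chain R.Hom X Y →₀ K) ⧸ R.tensRel X Y))

instance (X Y : R.Obj) : Module K (R.Tens X Y) :=
  inferInstanceAs (Module K ((Chain R.Hom X Y →₀ K) ⧸ R.tensRel X Y))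

/-- The quotient map. -/
def tproj (X Y : R.Obj) : (Chain R.Hom X Y →₀ K) →ₗ[K] R.Tens X Y := (R.tensRel X Y).mkQ

/-- The class of a sequence. -/
def tmk {X Y : R.Obj} (c : Chain R.Hom X Y) : R.Tens X Y := R.tproj X Y (Finsupp.single c 1)

variable {R} {M : Type*} [AddCommGroup M] [Module K M]

theorem tmk_multilin {X Y : R.Obj} : Multilin (R.tmk : Chain R.Hom X Y → R.Tens X Y) := by
  have key : ∀ {V W : R.Obj} (l : Chain R.Hom W Y) (r : Chain R.Hom X V) (k : K) (f g : R.Hom V W),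
      R.tmk (l.append (Chain.cons (k • f + g) r)) =
        k • R.tmk (l.append (Chain.cons f r)) + R.tmk (l.append (Chain.cons g r)) := by
    intro V W l r k f g
    have : R.tproj X Y (Finsupp.single (l.append (Chain.cons (k • f + g) r)) 1 -
      (k • Finsupp.single (l.append (Chain.cons f r)) 1 +
        Finsupp.single (l.append (Chain.cons g r)) 1)) = 0 := by
      refine (Submodule.Quotient.mk_eq_zero _).2 (Submodule.subset_span ?_)
      exact ⟨V, W, l, r, k, f, g, rfl⟩
    rw [map_sub, map_add, map_smul, sub_eq_zero] at this
    exact this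
  intro V W l r
  have hz : R.tmk (l.append (Chain.cons (0 : R.Hom V W) r)) = 0 := by
    have := key l r 1 0 0
    rw [smul_zero, add_zero, one_smul] at this
    exact left_eq_add.1 this
  refine ⟨fun f g => ?_, fun k f => ?_⟩
  · simpa using key l r 1 f g
  · simpa [hz] using key l r k f 0

/-- The linear map induced by a multilinear function. -/
def tlift {X Y : R.Obj} (φ : Chain R.Hom X Y → M) (h : Multilin φ) : R.Tens X Y →ₗ[K] M :=
  (R.tensRel X Y).liftQ (Finsupp.linearCombination K φ) <| by
    rw [tensRel, Submodule.span_le]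
    rintro _ ⟨V, W, l, r, k, f, g, rfl⟩
    simp [(h l r).map_add, (h l r).map_smul]

@[simp] theorem tlift_tmk {X Y : R.Obj} (φ : Chain R.Hom X Y → M) (h : Multilin φ)
    (c : Chain R.Hom X Y) : tlift φ h (R.tmk c) = φ c := by
  refine (Submodule.liftQ_apply _ _ _).trans ?_
  simp

theorem tens_ext {X Y : R.Obj} {f g : R.Tens X Y →ₗ[K] M} (h : ∀ c, f (R.tmk c) = g (R.tmk c)) :
    f = g := by
  refine Submodule.linearMap_qext (R.tensRel X Y) (Finsupp.lhom_ext' fun c => LinearMap.ext_ring ?_)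
  exact h c

theorem tens_induction {X Y : R.Obj} {p : R.Tens X Y → Prop} (h : ∀ c, p (R.tmk c))
    (hadd : ∀ x y, p x → p y → p (x + y)) (hsmul : ∀ (k : K) x, p x → p (k • x)) (x) : p x := by
  obtain ⟨z, rfl⟩ : ∃ z, R.tproj X Y z = x := Submodule.mkQ_surjective _ x
  induction z using Finsupp.induction_linear with
  | zero => simpa using hsmul 0 _ (h (Chain.single 0))
  | add f g hf hg => rw [map_add]; exact hadd _ _ hf hg
  | single c k =>
    have := hsmul k _ (h c)
    rwa [tmk, ← map_smul, Finsupp.smul_single, smul_eq_mul, mul_one] at this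

/-- Concatenation of tensors. -/
def tmul {X Y Z : R.Obj} : R.Tens Y Z →ₗ[K] R.Tens X Y →ₗ[K] R.Tens X Z :=
  tlift (fun l => tlift (fun r => R.tmk (l.append r)) (tmk_multilin.append_left l))
    fun V W l r => by
      constructor
      · intro x y
        refine tens_ext fun c => ?_
        simpa using ((tmk_multilin.append_right c) l r).map_add x y
      · intro k x
        refine tens_ext fun c => ?_
        simpa using ((tmk_multilin.append_right c) l r).map_smul k x

@[simp] theorem tmul_tmk {X Y Z : R.Obj} (l : Chain R.Hom Y Z) (r : Chain R.Hom X Y) :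
    tmul (R.tmk l) (R.tmk r) = R.tmk (l.append r) :=
  (LinearMap.congr_fun (tlift_tmk _ _ l) _).trans (tlift_tmk _ _ r)

@[simp] theorem tmul_nil {X Y : R.Obj} (x : R.Tens X Y) : tmul x (R.tmk Chain.nil) = x := by
  induction x using tens_induction with
  | h c => simp
  | hadd x y hx hy => simp [hx, hy]
  | hsmul k x hx => simp [hx]

@[simp] theorem nil_tmul {X Y : R.Obj} (x : R.Tens X Y) : tmul (R.tmk Chain.nil) x = x := by
  induction x using tens_induction with
  | h c => simp
  | hadd x y hx hy => simp [hx, hy]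
  | hsmul k x hx => simp [hx]

theorem tmul_assoc {W X Y Z : R.Obj} (x : R.Tens Y Z) (y : R.Tens X Y) (z : R.Tens W X) :
    tmul (tmul x y) z = tmul x (tmul y z) := by
  induction x using tens_induction with
  | hadd x y hx hy => simp [hx, hy]
  | hsmul k x hx => simp [hx]
  | h a =>
    induction y using tens_induction with
    | hadd x y hx hy => simp [hx, hy]
    | hsmul k x hx => simp [hx]
    | h b =>
      induction z using tens_induction with
      | hadd x y hx hy => simp only [map_add, hx, hy]
      | hsmul k x hx => simp only [map_smul, hx]
      | h c => simp [Chain.append_assoc]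

theorem tmul_spl {O : Type*} {H : O → O → Type*} {V W : O} (c : Chain H V W) {X Y Z : R.Obj}
    (x : R.Tens Y Z) (g : ∀ U, Chain H U W → Chain H V U → R.Tens X Y) :
    tmul x (c.spl g) = c.spl fun U l r => tmul x (g U l r) := Chain.map_spl _ _ _

theorem spl_tmul {O : Type*} {H : O → O → Type*} {V W : O} (c : Chain H V W) {X Y Z : R.Obj}
    (x : R.Tens X Y) (g : ∀ U, Chain H U W → Chain H V U → R.Tens Y Z) :
    tmul (c.spl g) x = c.spl fun U l r => tmul (g U l r) x :=
  Chain.map_spl (tmul.flip x) _ _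

/-- The inclusion of the tensors of length one. -/
def tone {X Y : R.Obj} : R.Hom X Y →ₗ[K] R.Tens X Y :=
  (tmk_multilin (R := R) (Chain.nil : Chain R.Hom Y Y) Chain.nil).mk' _

theorem tone_apply {X Y : R.Obj} (f : R.Hom X Y) : tone f = R.tmk (Chain.single f) := rfl

@[simp] theorem tmul_tone {X Y Z : R.Obj} (f : R.Hom Y Z) (c : Chain R.Hom X Y) :
    tmul (tone f) (R.tmk c) = R.tmk (Chain.cons f c) := by
  simp [tone_apply, Chain.single]

/-- `sg k` applied to every entry. -/
def tsg (k : ℤ) {X Y : R.Obj} : R.Tens X Y →ₗ[K] R.Tens X Y :=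
  tlift (fun c => R.tmk (R.sgc k c)) (tmk_multilin.sgc k)

@[simp] theorem tsg_tmk (k : ℤ) {X Y : R.Obj} (c : Chain R.Hom X Y) :
    tsg k (R.tmk c) = R.tmk (R.sgc k c) := by simp [tsg]

theorem tsg_tmul (k : ℤ) {X Y Z : R.Obj} (x : R.Tens Y Z) (y : R.Tens X Y) :
    tsg k (tmul x y) = tmul (tsg k x) (tsg k y) := by
  induction x using tens_induction with
  | hadd x y hx hy => simp [hx, hy]
  | hsmul k x hx => simp [hx]
  | h a =>
    induction y using tens_induction with
    | hadd x y hx hy => simp [hx, hy]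
    | hsmul k x hx => simp [hx]
    | h b => simp

theorem tsg_tsg (k l : ℤ) {X Y : R.Obj} (x : R.Tens X Y) : tsg k (tsg l x) = tsg (k + l) x := by
  induction x using tens_induction with
  | hadd x y hx hy => simp [hx, hy]
  | hsmul k x hx => simp [hx]
  | h a => simp [sgc_sgc]

theorem tsg_congr {k l : ℤ} (h : Even (k - l)) {X Y : R.Obj} (x : R.Tens X Y) :
    tsg k x = tsg l x := by
  induction x using tens_induction with
  | hadd x y hx hy => simp [hx, hy]
  | hsmul k x hx => simp [hx]
  | h a => simp [sgc_congr R h]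

theorem tsg_even {k : ℤ} (h : Even k) {X Y : R.Obj} (x : R.Tens X Y) : tsg k x = x := by
  induction x using tens_induction with
  | hadd x y hx hy => simp [hx, hy]
  | hsmul k x hx => simp [hx]
  | h a => simp [sgc_even R h]

@[simp] theorem tsg_tone (k : ℤ) {X Y : R.Obj} (f : R.Hom X Y) :
    tsg k (tone f) = tone (R.sg k f) := by
  simp [tone_apply, Chain.single]

end Tens

/-! ### The convolution ring -/

section Conv

variable (Q : GradedQuiver.{w, u, v} K) (R : GradedQuiver.{w, u', v'} K) (o : Q.Obj → R.Obj)

/-- Families of functions from composable sequences to tensors; a ring under convolution. -/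
def Conv : Type (max w u v u' v') := ∀ X Y : Q.Obj, Chain Q.Hom X Y → R.Tens (o X) (o Y)

/-- Families of functions from composable sequences to morphisms. -/
abbrev Cochain : Type (max u v v') := ∀ X Y : Q.Obj, Chain Q.Hom X Y → R.Hom (o X) (o Y)

variable {Q R o}

namespace Conv

instance : AddCommGroup (Conv Q R o) :=
  inferInstanceAs (AddCommGroup (∀ X Y : Q.Obj, Chain Q.Hom X Y → R.Tens (o X) (o Y)))

theorem ext {P P' : Conv Q R o} (h : ∀ X Y c, P X Y c = P' X Y c) : P = P' :=
  funext fun X => funext fun Y => funext fun c => h X Y c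

@[simp] theorem add_apply (P P' : Conv Q R o) {X Y : Q.Obj} (c : Chain Q.Hom X Y) :
    (P + P') X Y c = P X Y c + P' X Y c := rfl

@[simp] theorem sub_apply (P P' : Conv Q R o) {X Y : Q.Obj} (c : Chain Q.Hom X Y) :
    (P - P') X Y c = P X Y c - P' X Y c := rfl

@[simp] theorem neg_apply (P : Conv Q R o) {X Y : Q.Obj} (c : Chain Q.Hom X Y) :
    (-P) X Y c = -P X Y c := rfl

@[simp] theorem zero_apply {X Y : Q.Obj} (c : Chain Q.Hom X Y) :
    (0 : Conv Q R o) X Y c = 0 := rfl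

/-- The unit of convolution. -/
def unit : Conv Q R o
  | _, _, Chain.nil => R.tmk Chain.nil
  | _, _, Chain.cons _ _ => 0

instance : One (Conv Q R o) := ⟨unit⟩

instance : Mul (Conv Q R o) :=
  ⟨fun P P' X Z c => c.spl fun Y l r => tmul (P Y Z l) (P' X Y r)⟩

@[simp] theorem one_nil {X : Q.Obj} : (1 : Conv Q R o) X X Chain.nil = R.tmk Chain.nil := rfl

@[simp] theorem one_cons {X Y Z : Q.Obj} (f : Q.Hom Y Z) (c : Chain Q.Hom X Y) :
    (1 : Conv Q R o) X Z (Chain.cons f c) = 0 := rfl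

theorem one_apply_of_length {X Y : Q.Obj} {c : Chain Q.Hom X Y} (h : c.length ≠ 0) :
    (1 : Conv Q R o) X Y c = 0 := by
  cases c with
  | nil => simp at h
  | cons f c => rfl

theorem mul_apply (P P' : Conv Q R o) {X Z : Q.Obj} (c : Chain Q.Hom X Z) :
    (P * P') X Z c = c.spl fun Y l r => tmul (P Y Z l) (P' X Y r) := rfl

instance : Ring (Conv Q R o) where
  __ := (inferInstance : AddCommGroup (Conv Q R o))
  mul_assoc P P' P'' := by
    refine ext fun X Z c => ?_
    simp only [mul_apply, tmul_spl, spl_tmul]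
    rw [Chain.spl_spl]
    simp only [tmul_assoc]
  one_mul P := by
    refine ext fun X Z c => ?_
    rw [mul_apply, Chain.spl_length_zero_left]
    · simp
    · intro Y l r h; simp [one_apply_of_length h]
  mul_one P := by
    refine ext fun X Z c => ?_
    rw [mul_apply, Chain.spl_length_zero_right]
    · simp
    · intro Y l r h; simp [one_apply_of_length h]
  left_distrib P P' P'' := by
    refine ext fun X Z c => ?_
    simp only [mul_apply, add_apply, map_add, Chain.spl_add]
  right_distrib P P' P'' := by
    refine ext fun X Z c => ?_
    simp only [mul_apply, add_apply, map_add, LinearMap.add_apply, Chain.spl_add]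
  zero_mul P := by
    refine ext fun X Z c => ?_
    simp only [mul_apply, zero_apply, map_zero, LinearMap.zero_apply, Chain.spl_zero]
  mul_zero P := by
    refine ext fun X Z c => ?_
    simp only [mul_apply, zero_apply, map_zero, Chain.spl_zero]

/-- Cochains with values in the tensors of length one. -/
def ofCochain : Cochain Q R o →+ Conv Q R o where
  toFun f := fun X Y c => tone (f X Y c)
  map_zero' := ext fun _ _ _ => map_zero _
  map_add' _ _ := ext fun _ _ _ => map_add _ _ _

@[simp] theorem ofCochain_apply (f : Cochain Q R o) {X Y : Q.Obj} (c : Chain Q.Hom X Y) :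
    ofCochain f X Y c = tone (f X Y c) := rfl

/-- `sg 1` applied to the values. -/
def post : Conv Q R o →+* Conv Q R o where
  toFun P := fun X Y c => tsg 1 (P X Y c)
  map_zero' := ext fun _ _ _ => map_zero _
  map_add' _ _ := ext fun _ _ _ => map_add _ _ _
  map_one' := ext fun X Y c => by cases c <;> simp
  map_mul' P P' := ext fun X Y c => by
    simp only [mul_apply, Chain.map_spl, tsg_tmul]
    rfl

@[simp] theorem post_apply (P : Conv Q R o) {X Y : Q.Obj} (c : Chain Q.Hom X Y) :
    post P X Y c = tsg 1 (P X Y c) := rfl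

/-- Precomposition with `sg 1`. -/
def pre : Conv Q R o →+* Conv Q R o where
  toFun P := fun X Y c => P X Y (Q.sgc 1 c)
  map_zero' := rfl
  map_add' _ _ := rfl
  map_one' := ext fun X Y c => by cases c <;> rfl
  map_mul' P P' := ext fun X Y c => by simp only [mul_apply, spl_sgc]; rfl

@[simp] theorem pre_apply (P : Conv Q R o) {X Y : Q.Obj} (c : Chain Q.Hom X Y) :
    pre P X Y c = P X Y (Q.sgc 1 c) := rfl

@[simp] theorem post_post (P : Conv Q R o) : post (post P) = P :=
  ext fun X Y c => by simp only [post_apply, tsg_tsg]; exact tsg_even (by decide) _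

@[simp] theorem pre_pre (P : Conv Q R o) : pre (pre P) = P :=
  ext fun X Y c => by simp

theorem pre_post (P : Conv Q R o) : pre (post P) = post (pre P) := rfl

end Conv
end Conv
end GradedQuiver
end AInf

/-! ### The operations on the shifted modules and the coderivation of the source. -/

namespace AInf

namespace Chain

variable {O : Type*} {H : O → O → Type*} {O' : Type*} {H' : O' → O' → Type*} {M : Type*}
  [AddCommMonoid M]

theorem spl_comm {X Z : O} (c : Chain H X Z) {X' Z' : O'} (c' : Chain H' X' Z')
    (g : ∀ Y, Chain H Y Z → Chain H X Y → ∀ Y', Chain H' Y' Z' → Chain H' X' Y' → M) :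
    (c.spl fun Y l r => c'.spl fun Y' l' r' => g Y l r Y' l' r') =
      c'.spl fun Y' l' r' => c.spl fun Y l r => g Y l r Y' l' r' := by
  simp only [spl]
  induction c.splits with
  | nil => simp
  | cons a t ih => simp [ih]

theorem ite_add_zero {p : Prop} [Decidable p] (a b : M) :
    (if p then 0 else a + b) = (if p then 0 else a) + if p then 0 else b := by
  split_ifs <;> simp

theorem ite_spl {p : Prop} [Decidable p] {X Z : O} (c : Chain H X Z)
    (g : ∀ Y, Chain H Y Z → Chain H X Y → M) :
    (if p then 0 else c.spl g) = c.spl fun Y l r => if p then 0 else g Y l r := by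
  split_ifs
  · rw [spl_zero]
  · rfl

end Chain

namespace GradedQuiver

variable {K : Type w} [CommRing K] (Q : GradedQuiver.{w, u, v} K)

/-- The signs which relate an operation on graded modules and the corresponding operation on the
modules shifted by one. -/
def om {X : Q.Obj} : {Y : Q.Obj} → Chain Q.Hom X Y → Chain Q.Hom X Y
  | _, Chain.nil => Chain.nil
  | _, Chain.cons f c => Chain.cons (Q.sg c.length f) (om c)

@[simp] theorem om_nil {X : Q.Obj} : Q.om (Chain.nil : Chain Q.Hom X X) = Chain.nil := rfl

@[simp] theorem om_cons {X Y Z : Q.Obj} (f : Q.Hom Y Z) (c : Chain Q.Hom X Y) :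
    Q.om (Chain.cons f c) = Chain.cons (Q.sg c.length f) (Q.om c) := rfl

@[simp] theorem length_om {X : Q.Obj} : ∀ {Y : Q.Obj} (c : Chain Q.Hom X Y),
    (Q.om c).length = c.length
  | _, Chain.nil => rfl
  | _, Chain.cons f c => by simp [length_om c]

@[simp] theorem om_om {X : Q.Obj} : ∀ {Y : Q.Obj} (c : Chain Q.Hom X Y), Q.om (Q.om c) = c
  | _, Chain.nil => rfl
  | _, Chain.cons f c => by
    simp only [om_cons, length_om, om_om c, sg_sg]
    rw [Q.sg_even ⟨_, rfl⟩]

theorem om_sgc (k : ℤ) {X : Q.Obj} : ∀ {Y : Q.Obj} (c : Chain Q.Hom X Y),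
    Q.om (Q.sgc k c) = Q.sgc k (Q.om c)
  | _, Chain.nil => rfl
  | _, Chain.cons f c => by simp [om_sgc k c, sg_sg, add_comm]

theorem om_append {W X : Q.Obj} : ∀ {Y : Q.Obj} (l : Chain Q.Hom X Y) (r : Chain Q.Hom W X),
    Q.om (l.append r) = (Q.sgc r.length (Q.om l)).append (Q.om r)
  | _, Chain.nil, _ => rfl
  | _, Chain.cons f l, r => by simp [om_append l r, sg_sg, add_comm]

theorem om_append_cons {W X Y Z : Q.Obj} (l : Chain Q.Hom Y Z) (f : Q.Hom X Y)
    (r : Chain Q.Hom W X) : Q.om (l.append (Chain.cons f r)) =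
      (Q.sgc (r.length + 1) (Q.om l)).append (Chain.cons (Q.sg r.length f) (Q.om r)) := by
  simp [om_append]

theorem spl_om {M : Type*} [AddCommMonoid M] {X : Q.Obj} : ∀ {Z : Q.Obj} (c : Chain Q.Hom X Z)
    (g : ∀ Y, Chain Q.Hom Y Z → Chain Q.Hom X Y → M),
    (Q.om c).spl g = c.spl fun Y l r => g Y (Q.sgc r.length (Q.om l)) (Q.om r)
  | _, Chain.nil, g => by simp
  | _, Chain.cons f c, g => by
    simp only [om_cons, Chain.spl_cons, om_nil, sgc_nil]
    rw [spl_om c]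
    congr 1
    refine Chain.spl_congr' c fun Y l r h => ?_
    rw [sgc_cons, sg_sg, add_comm, ← h]
    push_cast
    rfl

variable {Q} {M : Type*} [AddCommGroup M] [Module K M]

theorem HasDegree.om {X Y : Q.Obj} {c : Chain Q.Hom X Y} {d : ℤ} (h : Q.HasDegree c d) :
    Q.HasDegree (Q.om c) d := by
  induction h with
  | nil => exact .nil
  | cons hf _ ih => exact .cons (sg_mem _ hf) ih

theorem Multilin.om {X Y : Q.Obj} {φ : Chain Q.Hom X Y → M} (h : Multilin φ) :
    Multilin fun c => φ (Q.om c) := fun _ _ l r => by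
  simp only [om_append_cons]
  exact (((h _ _).mk' _) ∘ₗ Q.sg _).isLinear

theorem IsMultilinear.om {R : GradedQuiver.{w, u', v'} K} {a b : Q.Obj → R.Obj} {p : ℤ}
    {φ : ∀ {X Y : Q.Obj}, Chain Q.Hom X Y → R.Hom (a X) (b Y)} (h : Q.IsMultilinear R a b p φ) :
    Q.IsMultilinear R a b p fun c => φ (Q.om c) where
  linear l r := (isMultilinear_multilin h).om l r
  degree c d hc := by simpa using h.degree _ d hc.om

theorem Multilin.map_unit_smul {X Y Z : Q.Obj} {φ : Chain Q.Hom X Z → M} (h : Multilin φ) (n : ℤ)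
    (f : Q.Hom Y Z) (c : Chain Q.Hom X Y) :
    φ (Chain.cons (n.negOnePow • f) c) = n.negOnePow • φ (Chain.cons f c) :=
  map_zsmul ((h Chain.nil c).mk' _) _ f

theorem Multilin.map_koszul (k : ℤ) {X : Q.Obj} : ∀ {Y : Q.Obj} {φ : Chain Q.Hom X Y → M}
    (_ : Multilin φ) (c : Chain Q.Hom X Y),
    φ (Q.koszul k c) = (k * c.length).negOnePow • φ (Q.sgc k c)
  | _, φ, h, Chain.nil => by simp [koszul]
  | _, φ, h, Chain.cons f c => by
    have := (h.cons (Q.twist k f)).map_koszul k c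
    refine this.trans ?_
    rw [twist_eq, h.map_unit_smul, negOnePow_smul_smul, sgc_cons, Chain.length_cons]
    congr 2
    push_cast; ring

theorem length_koszul (k : ℤ) {X Y : Q.Obj} (c : Chain Q.Hom X Y) :
    (Q.koszul k c).length = c.length := Chain.length_map _ c

end GradedQuiver

namespace AInfCat

open GradedQuiver

variable {K : Type w} [CommRing K] (A : AInfCat.{w, u, v} K)

/-- The operations on the shifted modules. -/
def b {X Y : A.Obj} (c : Chain A.Hom X Y) : A.Hom X Y := A.m (A.om c)

theorem m_eq {X Y : A.Obj} (c : Chain A.Hom X Y) : A.m c = A.b (A.om c) := by simp [b]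

@[simp] theorem b_nil (X : A.Obj) : A.b (Chain.nil : Chain A.Hom X X) = 0 := A.m_nil X

theorem b_isMultilinear : A.toGradedQuiver.IsMultilinear A.toGradedQuiver id id 2 A.b :=
  A.isMultilinear.om

theorem b_multilin {X Y : A.Obj} : Multilin (A.b : Chain A.Hom X Y → A.Hom X Y) :=
  isMultilinear_multilin A.b_isMultilinear

theorem b_sgc (k : ℤ) {X Y : A.Obj} (c : Chain A.Hom X Y) :
    A.b (A.sgc k c) = k.negOnePow • A.sg k (A.b c) := by
  rw [A.b_isMultilinear.map_sgc k c]
  exact negOnePow_smul_congr (by ring_nf; exact even_iff_two_dvd.2 ⟨k, by ring⟩) rfl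

/-- The sum of `φ (l ⊗ b(m) ⊗ r)`, Koszul signs included, over all ways to write `c` as
`l ⊗ m ⊗ r` with `m` non-empty. -/
def bsum {M : Type*} [AddCommMonoid M] {X Z : A.Obj} (φ : Chain A.Hom X Z → M)
    (c : Chain A.Hom X Z) : M :=
  c.spl fun _ l r' => r'.spl fun _ m r =>
    if m.length = 0 then 0 else φ ((A.sgc 1 l).append (Chain.cons (A.b m) r))

/-- The prescribed sign, the Koszul sign of `m_k` and the twists in `om` combine to the single
Koszul sign of an odd operation moved past the entries on its left; the remaining exponent is `2 *
l.length`. -/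
theorem precompSum_eq {T : A.Obj → A.Obj → Type v'} [∀ X Y, AddCommGroup (T X Y)]
    [∀ X Y, Module K (T X Y)] (φ : ∀ {X Y : A.Obj}, Chain A.Hom X Y → T X Y)
    (ψ : ∀ {X Y : A.Obj}, Chain A.Hom X Y → T X Y)
    (hψ : ∀ X Y : A.Obj, Multilin fun c : Chain A.Hom X Y => ψ c)
    (h : ∀ {X Y : A.Obj} (c : Chain A.Hom X Y), φ c = ψ (A.om c)) {X Y : A.Obj}
    (c : Chain A.Hom X Y) : precompSum A.toGradedQuiver A.m φ c = A.bsum ψ (A.om c) := by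
  rw [precompSum, Chain.sum_splits₃, bsum, spl_om]
  refine Chain.spl_congr' c fun Z l r' hl => ?_
  rw [spl_om]
  refine Chain.spl_congr' r' fun V m r hr => ?_
  simp only [length_sgc, length_om]
  split_ifs with hm
  · rfl
  · rw [h, om_append_cons, A.b_sgc, ← A.m_eq]
    have key := (((hψ X Y).append_right
      (Chain.cons (A.sg r.length (A.m m)) (A.om r))).sgc (r.length + 1)).om.map_koszul
      (2 - m.length) l
    have key' := ((hψ X Y).append_left
      (A.sgc 1 (A.sgc r'.length (A.om l)))).map_unit_smul r.length (A.sg r.length (A.m m)) (A.om r)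
    refine (congrArg _ key).trans (Eq.trans ?_ key'.symm)
    rw [negOnePow_smul_smul, om_sgc, sgc_sgc, sgc_sgc,
      A.sgc_congr (k := r.length + 1 + (2 - m.length)) (l := 1 + r'.length)]
    · refine negOnePow_smul_congr ?_ rfl
      have : ((r.length : ℤ) + m.length * l.length + (2 - m.length) * l.length - r.length) =
        2 * l.length := by ring
      rw [this]; exact even_two_mul _
    · rw [← hr]; push_cast
      have : ((r.length : ℤ) + 1 + (2 - m.length) - (1 + (m.length + r.length))) =
        2 * (1 - m.length) := by ring
      rw [this]; exact even_two_mul _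

/-- The relations of an `A∞` category on the shifted modules. -/
theorem bsum_b {X Y : A.Obj} (c : Chain A.Hom X Y) : A.bsum A.b c = 0 := by
  by_cases hc : c.length = 0
  · cases c with
    | nil => simp [bsum]
    | cons f c => simp at hc
  · rw [← A.om_om c, ← A.precompSum_eq (T := A.Hom) A.m A.b (fun _ _ => A.b_multilin) A.m_eq]
    exact A.relation _ (by simpa using Nat.pos_of_ne_zero hc)

theorem bsum_cons {M : Type*} [AddCommMonoid M] {X Y Z : A.Obj} (φ : Chain A.Hom X Z → M)
    (f : A.Hom Y Z) (c : Chain A.Hom X Y) : A.bsum φ (Chain.cons f c) =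
      (c.spl fun _ m r => φ (Chain.cons (A.b (Chain.cons f m)) r)) +
        A.bsum (fun c' => φ (Chain.cons (A.sg 1 f) c')) c := by
  rw [bsum, Chain.spl_cons, Chain.spl_cons]
  simp [bsum]

theorem bsum_add {M : Type*} [AddCommMonoid M] {X Z : A.Obj} (φ ψ : Chain A.Hom X Z → M)
    (c : Chain A.Hom X Z) : A.bsum (fun c => φ c + ψ c) c = A.bsum φ c + A.bsum ψ c := by
  simp only [bsum, Chain.ite_add_zero, Chain.spl_add]

theorem map_bsum {M N F : Type*} [AddCommMonoid M] [AddCommMonoid N] [FunLike F M N]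
    [AddMonoidHomClass F M N] (g : F) {X Z : A.Obj} (φ : Chain A.Hom X Z → M)
    (c : Chain A.Hom X Z) : g (A.bsum φ c) = A.bsum (fun c => g (φ c)) c := by
  simp only [bsum, Chain.map_spl]
  refine Chain.spl_congr _ fun _ _ _ _ => Chain.spl_congr _ fun _ _ _ _ => ?_
  split_ifs <;> simp

theorem bsum_congr {M : Type*} [AddCommMonoid M] {X Z : A.Obj} {φ ψ : Chain A.Hom X Z → M}
    (c : Chain A.Hom X Z) (h : ∀ c' : Chain A.Hom X Z, c'.length ≤ c.length → φ c' = ψ c') :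
    A.bsum φ c = A.bsum ψ c := by
  refine Chain.spl_congr' _ fun _ l r' hl => Chain.spl_congr' _ fun _ m r hr => ?_
  split_ifs with hm
  · rfl
  · refine h _ ?_
    simp
    omega

/-- The sum over the operations vanishes if `φ` does on all sequences which are not longer. -/
theorem bsum_eq_zero {M : Type*} [AddCommMonoid M] {X Z : A.Obj} {φ : Chain A.Hom X Z → M}
    (c : Chain A.Hom X Z) (h : ∀ c' : Chain A.Hom X Z, c'.length ≤ c.length → φ c' = 0) :
    A.bsum φ c = 0 := by
  rw [A.bsum_congr c h]
  exact Chain.spl_eq_zero _ fun _ _ _ _ => Chain.spl_eq_zero _ fun _ _ _ _ => by simp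

/-- The coderivation is odd, so it anticommutes with the sign involution. -/
theorem bsum_sgc {M : Type*} [AddCommGroup M] [Module K M] {X Z : A.Obj} {φ : Chain A.Hom X Z → M}
    (h : Multilin φ) (c : Chain A.Hom X Z) :
    A.bsum φ (A.sgc 1 c) = A.bsum (fun c => -φ (A.sgc 1 c)) c := by
  rw [bsum, spl_sgc, bsum]
  refine Chain.spl_congr _ fun _ l r _ => ?_
  rw [spl_sgc]
  refine Chain.spl_congr _ fun _ m r _ => ?_
  simp only [length_sgc, sgc_append, sgc_cons, A.b_sgc]
  rw [(h.append_left _).map_unit_smul]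
  simp

end AInfCat

namespace GradedQuiver.Conv

variable {K : Type w} [CommRing K] {A : AInfCat.{w, u, v} K} {R : GradedQuiver.{w, u', v'} K}
  {o : A.Obj → R.Obj}

/-- Precomposition with the coderivation given by the operations of `A`. -/
def bd : Conv A.toGradedQuiver R o →+ Conv A.toGradedQuiver R o where
  toFun P := fun X Y c => A.bsum (P X Y) c
  map_zero' := ext fun X Y c => A.bsum_eq_zero c fun _ _ => rfl
  map_add' P P' := ext fun X Y c => A.bsum_add _ _ c

theorem bd_apply (P : Conv A.toGradedQuiver R o) {X Y : A.Obj} (c : Chain A.Hom X Y) :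
    bd P X Y c = A.bsum (P X Y) c := rfl

/-- The cut between the two factors lies to the right or to the left of the entry produced by the
operation. In the second case the operation has moved past the arguments of `P`, whence `pre`. -/
theorem bd_mul (P P' : Conv A.toGradedQuiver R o) : bd (P * P') = bd P * P' + pre P * bd P' := by
  refine ext fun X Z c => ?_
  have h1 : (bd P * P') X Z c = c.spl fun _ l r' => r'.spl fun _ m r₁₂ => r₁₂.spl fun _ r₁ r₂ =>
      if m.length = 0 then 0 else
        tmul (P _ _ ((A.sgc 1 l).append (Chain.cons (A.b m) r₁))) (P' _ _ r₂) := by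
    rw [mul_apply]
    simp only [bd_apply, AInfCat.bsum, spl_tmul]
    rw [← Chain.spl_spl]
    refine Chain.spl_congr _ fun _ l r _ => ?_
    rw [← Chain.spl_spl]
    refine Chain.spl_congr _ fun _ m r _ => Chain.spl_congr _ fun _ _ _ _ => ?_
    split_ifs <;> simp
  have h2 : (pre P * bd P') X Z c = c.spl fun _ l r' => r'.spl fun _ m r => l.spl fun _ l₁ l₂ =>
      if m.length = 0 then 0 else
        tmul (P _ _ (A.sgc 1 l₁)) (P' _ _ ((A.sgc 1 l₂).append (Chain.cons (A.b m) r))) := by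
    rw [mul_apply]
    simp only [bd_apply, AInfCat.bsum, tmul_spl, pre_apply]
    rw [Chain.spl_spl]
    refine Chain.spl_congr _ fun _ l r _ => ?_
    rw [Chain.spl_comm]
    refine Chain.spl_congr _ fun _ _ _ _ => Chain.spl_congr _ fun _ _ _ _ => ?_
    split_ifs <;> simp
  rw [add_apply, h1, h2, bd_apply, AInfCat.bsum, ← Chain.spl_add]
  refine Chain.spl_congr _ fun _ l r' _ => ?_
  rw [← Chain.spl_add]
  refine Chain.spl_congr _ fun _ m r _ => ?_
  rw [mul_apply, Chain.spl_append_cons, Chain.ite_add_zero, spl_sgc, Chain.ite_spl, Chain.ite_spl,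
    add_comm]

theorem bd_one : bd (1 : Conv A.toGradedQuiver R o) = 0 := by
  refine ext fun X Z c => ?_
  rw [bd_apply, AInfCat.bsum, zero_apply]
  refine Chain.spl_eq_zero _ fun _ l r _ => Chain.spl_eq_zero _ fun _ _ _ _ => ?_
  split_ifs
  · rfl
  · exact one_apply_of_length (by simp)

theorem bd_post (P : Conv A.toGradedQuiver R o) : bd (post P) = post (bd P) :=
  ext fun X Y c => (A.map_bsum (tsg 1) _ c).symm

end GradedQuiver.Conv

end AInf

/-! ### Geometric series in the convolution ring. -/

namespace AInf
namespace GradedQuiver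

variable {K : Type w} [CommRing K]

namespace Conv

variable {Q : GradedQuiver.{w, u, v} K} {R : GradedQuiver.{w, u', v'} K} {o : Q.Obj → R.Obj}

/-- Agreement on all sequences of length at most `n`. -/
def AgreeTo (n : ℕ) (P P' : Conv Q R o) : Prop :=
  ∀ X Y (c : Chain Q.Hom X Y), c.length ≤ n → P X Y c = P' X Y c

theorem AgreeTo.refl (n : ℕ) (P : Conv Q R o) : AgreeTo n P P := fun _ _ _ _ => rfl

theorem AgreeTo.symm {n : ℕ} {P P' : Conv Q R o} (h : AgreeTo n P P') : AgreeTo n P' P :=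
  fun _ _ c hc => (h _ _ c hc).symm

theorem AgreeTo.trans {n : ℕ} {P P' P'' : Conv Q R o} (h : AgreeTo n P P') (h' : AgreeTo n P' P'') :
    AgreeTo n P P'' := fun _ _ c hc => (h _ _ c hc).trans (h' _ _ c hc)

theorem AgreeTo.mono {m n : ℕ} (hmn : m ≤ n) {P P' : Conv Q R o} (h : AgreeTo n P P') :
    AgreeTo m P P' := fun _ _ c hc => h _ _ c (hc.trans hmn)

theorem AgreeTo.add {n : ℕ} {P₁ P₂ P₁' P₂' : Conv Q R o} (h₁ : AgreeTo n P₁ P₁')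
    (h₂ : AgreeTo n P₂ P₂') : AgreeTo n (P₁ + P₂) (P₁' + P₂') := fun _ _ c hc => by
  rw [add_apply, add_apply, h₁ _ _ c hc, h₂ _ _ c hc]

theorem AgreeTo.neg {n : ℕ} {P P' : Conv Q R o} (h : AgreeTo n P P') : AgreeTo n (-P) (-P') :=
  fun _ _ c hc => by rw [neg_apply, neg_apply, h _ _ c hc]

theorem AgreeTo.mul {n : ℕ} {P₁ P₂ P₁' P₂' : Conv Q R o} (h₁ : AgreeTo n P₁ P₁')
    (h₂ : AgreeTo n P₂ P₂') : AgreeTo n (P₁ * P₂) (P₁' * P₂') := fun _ _ c hc => by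
  rw [mul_apply, mul_apply]
  refine Chain.spl_congr' c fun _ l r h => ?_
  rw [h₁ _ _ l (by omega), h₂ _ _ r (by omega)]

theorem AgreeTo.pow {n : ℕ} {P P' : Conv Q R o} (h : AgreeTo n P P') (i : ℕ) :
    AgreeTo n (P ^ i) (P' ^ i) := by
  induction i with
  | zero => simpa using AgreeTo.refl n 1
  | succ i ih => rw [pow_succ, pow_succ]; exact ih.mul h

theorem AgreeTo.sum {n : ℕ} {ι : Type*} (s : Finset ι) {f g : ι → Conv Q R o}
    (h : ∀ i, AgreeTo n (f i) (g i)) : AgreeTo n (∑ i ∈ s, f i) (∑ i ∈ s, g i) := by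
  classical
  induction s using Finset.induction_on with
  | empty => simpa using AgreeTo.refl n 0
  | insert a s ha ih => rw [Finset.sum_insert ha, Finset.sum_insert ha]; exact (h a).add ih

theorem AgreeTo.post {n : ℕ} {P P' : Conv Q R o} (h : AgreeTo n P P') :
    AgreeTo n (post P) (post P') := fun _ _ c hc => by
  rw [post_apply, post_apply, h _ _ c hc]

/-- Vanishing on empty sequences. -/
def Pos (P : Conv Q R o) : Prop := ∀ X, P X X Chain.nil = 0

theorem Pos.apply {P : Conv Q R o} (h : Pos P) {X Y : Q.Obj} (c : Chain Q.Hom X Y)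
    (hc : c.length = 0) : P X Y c = 0 := by
  cases c with
  | nil => exact h X
  | cons f c => simp at hc

theorem Pos.post {P : Conv Q R o} (h : Pos P) : Pos (post P) := fun X => by
  rw [post_apply, h X, map_zero]

theorem Pos.pre {P : Conv Q R o} (h : Pos P) : Pos (pre P) := fun X => h X

theorem Pos.pow {P : Conv Q R o} (hP : Pos P) (i : ℕ) :
    ∀ {X Y : Q.Obj} (c : Chain Q.Hom X Y), c.length < i → (P ^ i) X Y c = 0 := by
  induction i with
  | zero => intro X Y c h; omega
  | succ i ih =>
    intro X Y c h
    rw [pow_succ', mul_apply]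
    refine (Chain.spl_congr' c fun _ l r hl => ?_).trans (Chain.spl_zero c)
    by_cases h0 : l.length = 0
    · rw [hP.apply l h0, map_zero, LinearMap.zero_apply]
    · rw [ih r (by omega), map_zero]

/-- The sum of all tensor powers of `P`, for `P` vanishing on empty sequences. -/
def hat (P : Conv Q R o) : Conv Q R o := fun X Y c => (∑ i ∈ Finset.range (c.length + 1), P ^ i) X Y c

theorem sum_apply {ι : Type*} (s : Finset ι) (f : ι → Conv Q R o) {X Y : Q.Obj}
    (c : Chain Q.Hom X Y) : (∑ i ∈ s, f i) X Y c = ∑ i ∈ s, f i X Y c := by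
  classical
  induction s using Finset.induction_on with
  | empty => simp
  | insert a s ha ih => rw [Finset.sum_insert ha, Finset.sum_insert ha, add_apply, ih]

theorem Pos.agreeTo_hat {P : Conv Q R o} (hP : Pos P) (n : ℕ) :
    AgreeTo n P.hat (∑ i ∈ Finset.range (n + 1), P ^ i) := fun X Y c hc => by
  rw [hat, sum_apply, sum_apply]
  refine Finset.sum_subset (by simpa using hc) fun i _ hi => hP.pow i c ?_
  simpa using hi

theorem ext_agree {P P' : Conv Q R o} (h : ∀ n, AgreeTo n P P') : P = P' :=
  ext fun X Y c => h c.length X Y c le_rfl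

theorem Pos.sub_mul_hat {P : Conv Q R o} (hP : Pos P) : (1 - P) * P.hat = 1 := by
  refine ext_agree fun n => (((AgreeTo.refl n _).mul (hP.agreeTo_hat n))).trans ?_
  rw [mul_neg_geom_sum]
  intro X Y c hc
  rw [sub_apply, hP.pow _ c (by omega), sub_zero]

theorem Pos.hat_mul_sub {P : Conv Q R o} (hP : Pos P) : P.hat * (1 - P) = 1 := by
  refine ext_agree fun n => (((hP.agreeTo_hat n).mul (AgreeTo.refl n _))).trans ?_
  rw [geom_sum_mul_neg]
  intro X Y c hc
  rw [sub_apply, hP.pow _ c (by omega), sub_zero]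

theorem Pos.hat_eq {P : Conv Q R o} (hP : Pos P) : P.hat = P * P.hat + 1 := by
  have := hP.sub_mul_hat
  rw [sub_mul, one_mul] at this
  rw [← this]; abel

theorem Pos.hat_eq' {P : Conv Q R o} (hP : Pos P) : P.hat = P.hat * P + 1 := by
  have := hP.hat_mul_sub
  rw [mul_sub, mul_one] at this
  rw [← this]; abel

/-- As `1 - P` is invertible with inverse `P.hat`, this solves all the linear recursions obtained by
peeling off a leftmost letter. -/
theorem Pos.eq_hat {P Y Z : Conv Q R o} (hP : Pos P) (h : Y = P * Y + Z) : Y = P.hat * Z := by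
  have : (1 - P) * Y = Z := by rw [sub_mul, one_mul, sub_eq_iff_eq_add, add_comm]; exact h
  rw [← this, ← mul_assoc, hP.hat_mul_sub, one_mul]

theorem AgreeTo.hat {n : ℕ} {P P' : Conv Q R o} (h : AgreeTo n P P') :
    AgreeTo n P.hat P'.hat := fun X Y c hc => by
  rw [Conv.hat, Conv.hat]
  exact AgreeTo.sum _ (fun i => h.pow i) X Y c hc

theorem post_hat (P : Conv Q R o) : post P.hat = (post P).hat := ext fun X Y c => by
  rw [hat, ← Finset.sum_congr rfl fun i _ => map_pow post P i, ← map_sum]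
  rfl

theorem pre_hat (P : Conv Q R o) : pre P.hat = (pre P).hat := ext fun X Y c => by
  rw [hat, ← Finset.sum_congr rfl fun i _ => map_pow pre P i, ← map_sum, pre_apply, pre_apply, hat,
    length_sgc]

/-- `P` takes values in the tensors of length one. -/
def IsLetter (P : Conv Q R o) : Prop := ∃ f : Cochain Q R o, P = ofCochain f

theorem isLetter_ofCochain (f : Cochain Q R o) : IsLetter (ofCochain f) := ⟨f, rfl⟩

theorem post_ofCochain (f : Cochain Q R o) :
    post (ofCochain f) = ofCochain fun X Y c => R.sg 1 (f X Y c) :=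
  ext fun X Y c => by simp

theorem IsLetter.post {P : Conv Q R o} : IsLetter P → IsLetter (post P) := by
  rintro ⟨f, rfl⟩
  exact ⟨_, post_ofCochain f⟩

end Conv

/-! ### Operations on tensors -/

section Operations

variable (B : AInfCat.{w, u', v'} K)

/-- The operations, as a map on tensors. -/
def bT {X Y : B.Obj} : B.Tens X Y →ₗ[K] B.Hom X Y := tlift B.b B.b_multilin

@[simp] theorem bT_tmk {X Y : B.Obj} (c : Chain B.Hom X Y) : bT B (B.tmk c) = B.b c :=
  tlift_tmk _ _ _

theorem bT_tsg {X Y : B.Obj} (x : B.Tens X Y) : bT B (tsg 1 x) = -B.sg 1 (bT B x) := by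
  induction x using tens_induction with
  | hadd x y hx hy => simp [hx, hy]; abel
  | hsmul k x hx => simp [hx]
  | h a => simp [B.b_sgc]

/-- The sum of `b(a ⊗ m) ⊗ r` over all ways to write a tensor as `m ⊗ r`. -/
def tq {X Y Z : B.Obj} : B.Tens Y Z →ₗ[K] B.Tens X Y →ₗ[K] B.Tens X Z :=
  LinearMap.flip <| tlift
    (fun t => t.spl fun _ m r => tmul.flip (B.tmk r) ∘ₗ tone ∘ₗ bT B ∘ₗ tmul.flip (B.tmk m)) <| by
    refine Multilin.spl (fun V r W W' l₁ l₂ => ?_) fun V l W W' r₁ r₂ => ?_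
    · constructor
      · intro x y; ext; simp [(tmk_multilin l₁ l₂).map_add]
      · intro k x; ext; simp [(tmk_multilin l₁ l₂).map_smul]
    · constructor
      · intro x y; ext; simp [(tmk_multilin r₁ r₂).map_add]
      · intro k x; ext; simp [(tmk_multilin r₁ r₂).map_smul]

theorem tq_tmk {X Y Z : B.Obj} (a : B.Tens Y Z) (t : Chain B.Hom X Y) :
    tq B a (B.tmk t) = t.spl fun _ m r => tmul (tone (bT B (tmul a (B.tmk m)))) (B.tmk r) := by
  rw [tq, LinearMap.flip_apply, tlift_tmk, ← LinearMap.applyₗ_apply_apply, Chain.map_spl]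
  rfl

@[simp] theorem tq_nil {Y Z : B.Obj} (a : B.Tens Y Z) :
    tq B a (B.tmk Chain.nil) = tone (bT B a) := by
  rw [tq_tmk, Chain.spl_nil, tmul_nil, tmul_nil]

/-- The operation which consumes all of `a` either stops before `x` or consumes `x` too. -/
theorem tq_tmul {W X Y Z : B.Obj} (a : B.Tens Y Z) (x : B.Hom X Y) (t : B.Tens W X) :
    tq B a (tmul (tone x) t) =
      tmul (tone (bT B a)) (tmul (tone x) t) + tq B (tmul a (tone x)) t := by
  induction t using tens_induction with
  | hadd t t' h h' => simp only [map_add, h, h']; abel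
  | hsmul k t h => simp only [map_smul, h, smul_add]
  | h c =>
    rw [tmul_tone, tq_tmk, tq_tmk, Chain.spl_cons]
    simp [tmul_assoc]

variable {B}

theorem bsum_multilin {M : Type*} [AddCommGroup M] [Module K M] {X Z : B.Obj}
    {φ : Chain B.Hom X Z → M} (h : Multilin φ) : Multilin (B.bsum φ) := by
  refine Multilin.spl (fun V r' W W' l₁ l₂ => ?_) fun V l => Multilin.spl (fun V r W W' m₁ m₂ => ?_)
    fun V m W W' r₁ r₂ => ?_
  · refine isLinearMap_spl r' _ fun _ m r => ?_
    split_ifs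
    · exact (0 : _ →ₗ[K] M).isLinear
    · exact (h.append_right (Chain.cons (B.b m) r)).sgc 1 l₁ l₂
  · simp only [Chain.length_append, Chain.length_cons, add_eq_zero, one_ne_zero, and_false,
      if_false]
    exact (((h (B.sgc 1 l) r).mk' _) ∘ₗ (B.b_multilin m₁ m₂).mk' _).isLinear
  · split_ifs
    · exact (0 : _ →ₗ[K] M).isLinear
    · exact (h.append_left (B.sgc 1 l)).cons (B.b m) r₁ r₂

variable (B)

/-- The coderivation given by the operations. -/
def tD {X Y : B.Obj} : B.Tens X Y →ₗ[K] B.Tens X Y := tlift (B.bsum B.tmk) (bsum_multilin tmk_multilin)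

@[simp] theorem tD_tmk {X Y : B.Obj} (c : Chain B.Hom X Y) : tD B (B.tmk c) = B.bsum B.tmk c :=
  tlift_tmk _ _ _

/-- An operation either starts to the right of `x`, with the sign of passing `x`, or starts at `x`;
the latter terms are collected by `tq`. -/
theorem tD_tmul {X Y Z : B.Obj} (x : B.Hom Y Z) (t : B.Tens X Y) :
    tD B (tmul (tone x) t) =
      tmul (tone (B.sg 1 x)) (tD B t) + tq B (B.tmk Chain.nil) (tmul (tone x) t) := by
  induction t using tens_induction with
  | hadd t t' h h' => simp only [map_add, h, h']; abel
  | hsmul k t h => simp only [map_smul, h, smul_add]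
  | h c =>
    rw [tmul_tone, tD_tmk, tD_tmk, AInfCat.bsum_cons, tq_tmk, Chain.spl_cons, AInfCat.map_bsum,
      add_comm]
    simp

theorem bT_tD {X Y : B.Obj} (t : B.Tens X Y) : bT B (tD B t) = 0 := by
  induction t using tens_induction with
  | hadd t t' h h' => simp only [map_add, h, h', add_zero]
  | hsmul k t h => simp only [map_smul, h, smul_zero]
  | h c =>
    rw [tD_tmk, AInfCat.map_bsum]
    simp only [bT_tmk]
    exact B.bsum_b c

end Operations

namespace Conv

variable {Q : GradedQuiver.{w, u, v} K} {B : AInfCat.{w, u', v'} K} {o : Q.Obj → B.Obj}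

/-- The operations of the target applied to the values. -/
def bc : Conv Q B.toGradedQuiver o →+ Cochain Q B.toGradedQuiver o where
  toFun P := fun X Y c => bT B (P X Y c)
  map_zero' := by funext X Y c; exact map_zero _
  map_add' P P' := by funext X Y c; exact map_add _ _ _

theorem bc_apply (P : Conv Q B.toGradedQuiver o) {X Y : Q.Obj} (c : Chain Q.Hom X Y) :
    bc P X Y c = bT B (P X Y c) := rfl

/-- The operations of the target applied to the values, with values in tensors of length one. -/
def beta : Conv Q B.toGradedQuiver o →+ Conv Q B.toGradedQuiver o := ofCochain.comp bc

theorem beta_apply (P : Conv Q B.toGradedQuiver o) {X Y : Q.Obj} (c : Chain Q.Hom X Y) :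
    beta P X Y c = tone (bT B (P X Y c)) := rfl

theorem beta_eq (P : Conv Q B.toGradedQuiver o) : beta P = ofCochain (bc P) := rfl

theorem beta_post (P : Conv Q B.toGradedQuiver o) : beta (post P) = -post (beta P) :=
  ext fun X Y c => by simp [beta_apply, bT_tsg]

theorem beta_one : beta (1 : Conv Q B.toGradedQuiver o) = 0 := ext fun X Y c => by
  cases c <;> simp [beta_apply]

/-- The convolution of two families with respect to `tq`. -/
def cq (P P' : Conv Q B.toGradedQuiver o) : Conv Q B.toGradedQuiver o :=
  fun _ _ c => c.spl fun _ l r => tq B (P _ _ l) (P' _ _ r)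

theorem cq_add_right (P P' P'' : Conv Q B.toGradedQuiver o) :
    cq P (P' + P'') = cq P P' + cq P P'' :=
  ext fun X Y c => by simp only [cq, add_apply, map_add, Chain.spl_add]

theorem cq_add_left (P P' P'' : Conv Q B.toGradedQuiver o) :
    cq (P + P') P'' = cq P P'' + cq P' P'' :=
  ext fun X Y c => by simp only [cq, add_apply, map_add, LinearMap.add_apply, Chain.spl_add]

theorem cq_one_right (P : Conv Q B.toGradedQuiver o) : cq P 1 = beta P := ext fun X Y c => by
  rw [cq, Chain.spl_length_zero_right]
  · simp [beta_apply]
  · intro Z l r h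
    rw [one_apply_of_length h, map_zero]

theorem IsLetter.cq_mul {x : Conv Q B.toGradedQuiver o} (hx : IsLetter x)
    (P P' : Conv Q B.toGradedQuiver o) :
    cq P (x * P') = beta P * (x * P') + cq (P * x) P' := by
  obtain ⟨f, rfl⟩ := hx
  refine ext fun X Z c => ?_
  simp only [cq, add_apply, mul_apply, Chain.map_spl]
  simp only [ofCochain_apply, tq_tmul, Chain.spl_add]
  congr 1
  rw [Chain.spl_spl]
  refine Chain.spl_congr _ fun Y l r _ => ?_
  exact (Chain.map_spl (LinearMap.applyₗ (P' X Y r) :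
    (B.Tens (o X) (o Y) →ₗ[K] B.Tens (o X) (o Z)) →ₗ[K] B.Tens (o X) (o Z)) l
      fun V l m => tq B (tmul (P V Z l) (tone (f Y V m)))).symm

/-- The coderivation of the target applied to the values. -/
def cD : Conv Q B.toGradedQuiver o →+ Conv Q B.toGradedQuiver o where
  toFun P := fun X Y c => tD B (P X Y c)
  map_zero' := ext fun _ _ _ => map_zero _
  map_add' _ _ := ext fun _ _ _ => map_add _ _ _

theorem cD_apply (P : Conv Q B.toGradedQuiver o) {X Y : Q.Obj} (c : Chain Q.Hom X Y) :
    cD P X Y c = tD B (P X Y c) := rfl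

theorem beta_cD (P : Conv Q B.toGradedQuiver o) : beta (cD P) = 0 := ext fun X Y c => by
  rw [beta_apply, cD_apply, bT_tD, map_zero, zero_apply]

theorem cD_one : cD (1 : Conv Q B.toGradedQuiver o) = 0 := ext fun X Y c => by
  cases c with
  | nil => simp [cD_apply, AInfCat.bsum]
  | cons f c => simp [cD_apply]

theorem IsLetter.cD_mul {x : Conv Q B.toGradedQuiver o} (hx : IsLetter x)
    (P : Conv Q B.toGradedQuiver o) : cD (x * P) = Conv.post x * cD P + cq 1 (x * P) := by
  obtain ⟨f, rfl⟩ := hx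
  refine ext fun X Z c => ?_
  have h1 : cq (1 : Conv Q B.toGradedQuiver o) (ofCochain f * P) X Z c =
      c.spl fun Y l r => tq B (B.tmk Chain.nil) (tmul (tone (f Y Z l)) (P X Y r)) := by
    rw [cq, Chain.spl_length_zero_left, one_nil, mul_apply, Chain.map_spl]
    · rfl
    · intro Y l r h
      rw [one_apply_of_length h, map_zero, LinearMap.zero_apply]
  rw [add_apply, h1, cD_apply, mul_apply, mul_apply, Chain.map_spl, ← Chain.spl_add]
  refine Chain.spl_congr _ fun Y l r _ => ?_
  rw [ofCochain_apply, tD_tmul, post_apply, ofCochain_apply, tsg_tone, cD_apply]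

/-- Telescoping: with `a = a * x.hat - a * x.hat * x`, the rule `IsLetter.cq_mul` for moving a
letter `x` across cancels the unknown terms `cq (a * x.hat) (x * E)`. -/
theorem cq_of_eq {x E Z : Conv Q B.toGradedQuiver o} (hx : IsLetter x) (hp : Pos x)
    (h : E = x * E + Z) (a : Conv Q B.toGradedQuiver o) :
    cq a E = beta (a * x.hat) * (x * E) + cq (a * x.hat) Z := by
  have h1 : a = a * x.hat - a * x.hat * x := by
    rw [mul_assoc, ← mul_sub, ← mul_one_sub, hp.hat_mul_sub, mul_one]
  have h2 := hx.cq_mul (a * x.hat) E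
  have h3 : cq a E + cq (a * x.hat * x) E = cq (a * x.hat) E := by
    rw [← cq_add_left]; congr 1; conv_lhs => enter [1]; rw [h1]
    abel
  have h4 : cq (a * x.hat) E = cq (a * x.hat) (x * E) + cq (a * x.hat) Z := by
    rw [← cq_add_right, ← h]
  rw [eq_sub_of_add_eq h3, h4, h2]
  abel

theorem cD_of_eq {x E Z : Conv Q B.toGradedQuiver o} (hx : IsLetter x) (hp : Pos x)
    (h : E = x * E + Z) : cD E = (post x).hat * (cq 1 E + (cD Z - cq 1 Z)) := by
  refine hp.post.eq_hat ?_
  have h2 : cD E = cD (x * E) + cD Z := by rw [← map_add, ← h]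
  have h3 : cq 1 E = cq 1 (x * E) + cq 1 Z := by rw [← cq_add_right, ← h]
  conv_lhs => rw [h2, hx.cD_mul]
  rw [h3]
  abel

variable {F G H T T' : Conv Q B.toGradedQuiver o}

theorem cq_hat (hF : IsLetter F) (hF₀ : Pos F) (a : Conv Q B.toGradedQuiver o) :
    cq a F.hat = beta (a * F.hat) * F.hat := by
  rw [cq_of_eq hF hF₀ hF₀.hat_eq, cq_one_right]
  conv_rhs => rw [hF₀.hat_eq]
  rw [mul_add, mul_one, ← hF₀.hat_eq]

/-- An operation of the target acts on consecutive factors `F`: those on its left acquire its sign,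
those on its right do not. -/
theorem cD_hat (hF : IsLetter F) (hF₀ : Pos F) :
    cD F.hat = (post F).hat * (beta F.hat * F.hat) := by
  rw [cD_of_eq hF hF₀ hF₀.hat_eq, cD_one, cq_one_right, beta_one, cq_hat hF hF₀, one_mul]
  simp

theorem cq_hat₂ (hF : IsLetter F) (hF₀ : Pos F) (hG : IsLetter G) (hG₀ : Pos G) (hT : IsLetter T)
    (a : Conv Q B.toGradedQuiver o) : cq a (G.hat * (T * F.hat)) =
      beta (a * G.hat) * (G.hat * (T * F.hat)) + beta (a * (G.hat * (T * F.hat))) * F.hat := by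
  have h : G.hat * (T * F.hat) = G * (G.hat * (T * F.hat)) + T * F.hat := by
    conv_lhs => rw [hG₀.hat_eq]
    noncomm_ring
  rw [cq_of_eq hG hG₀ h, hT.cq_mul, cq_hat hF hF₀]
  conv_rhs => enter [1]; rw [h]
  simp only [mul_assoc, mul_add, add_assoc]

theorem cD_hat₂ (hF : IsLetter F) (hF₀ : Pos F) (hG : IsLetter G) (hG₀ : Pos G) (hT : IsLetter T) :
    cD (G.hat * (T * F.hat)) = (post G).hat * (beta G.hat * (G.hat * (T * F.hat)) +
      beta (G.hat * (T * F.hat)) * F.hat + post T * ((post F).hat * (beta F.hat * F.hat))) := by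
  have h : G.hat * (T * F.hat) = G * (G.hat * (T * F.hat)) + T * F.hat := by
    conv_lhs => rw [hG₀.hat_eq]
    noncomm_ring
  rw [cD_of_eq hG hG₀ h, cq_hat₂ hF hF₀ hG hG₀ hT, hT.cD_mul, cD_hat hF hF₀]
  simp

/-- The terms are sorted by the operation's place. It stays among the factors `H`; or it contains
`T'` and ends before `T`; or it contains both `T'` and `T`; or it starts to the right of `T'`. -/
theorem cD_hat₃ (hF : IsLetter F) (hF₀ : Pos F) (hG : IsLetter G) (hG₀ : Pos G) (hH : IsLetter H)
    (hH₀ : Pos H) (hT : IsLetter T) (hT' : IsLetter T') :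
    cD (H.hat * (T' * (G.hat * (T * F.hat)))) = (post H).hat *
      (beta H.hat * (H.hat * (T' * (G.hat * (T * F.hat)))) +
        beta (H.hat * (T' * G.hat)) * (G.hat * (T * F.hat)) +
        beta (H.hat * (T' * (G.hat * (T * F.hat)))) * F.hat +
        post T' * cD (G.hat * (T * F.hat))) := by
  have h : H.hat * (T' * (G.hat * (T * F.hat))) =
      H * (H.hat * (T' * (G.hat * (T * F.hat)))) + T' * (G.hat * (T * F.hat)) := by
    conv_lhs => rw [hH₀.hat_eq]
    noncomm_ring
  rw [cD_of_eq hH hH₀ h, cq_of_eq hH hH₀ h, hT'.cD_mul, hT'.cq_mul, cq_hat₂ hF hF₀ hG hG₀ hT]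
  conv_rhs => enter [2, 1, 1, 1]; rw [h]
  rw [one_mul, mul_assoc H.hat, mul_assoc H.hat]
  generalize G.hat * (T * F.hat) = E
  generalize H.hat * (T' * E) = W
  rw [mul_add (beta H.hat)]
  congr 1
  generalize beta H.hat * (H * W) = x₁
  generalize beta H.hat * (T' * E) = x₂
  generalize beta (H.hat * (T' * G.hat)) * E = x₃
  generalize beta W * F.hat = x₄
  abel

end Conv
end GradedQuiver
end AInf

/-! ### Functors, closed transformations and their composition. -/

namespace AInf

namespace Chain

variable {O : Type*} {H : O → O → Type*} {M : Type*} [AddCommMonoid M]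

theorem spl_eq_right {X Z : O} (c : Chain H X Z) (g : ∀ Y, Chain H Y Z → Chain H X Y → M)
    (h : ∀ Y l r, l.length + r.length = c.length → r.length ≠ 0 → g Y l r = 0) :
    c.spl g = g X c nil := by
  classical
  refine Eq.trans (spl_congr' c fun Y l r hl => (if_pos hl).symm) ((spl_length_zero_right c
    (fun Y l r => if l.length + r.length = c.length then g Y l r else 0) ?_).trans (if_pos (by simp)))
  intro Y l r hr
  split_ifs with hl
  · exact h Y l r hl hr
  · rfl

theorem spl_eq_left {X Z : O} (c : Chain H X Z) (g : ∀ Y, Chain H Y Z → Chain H X Y → M)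
    (h : ∀ Y l r, l.length + r.length = c.length → l.length ≠ 0 → g Y l r = 0) :
    c.spl g = g Z nil c := by
  classical
  refine Eq.trans (spl_congr' c fun Y l r hl => (if_pos hl).symm) ((spl_length_zero_left c
    (fun Y l r => if l.length + r.length = c.length then g Y l r else 0) ?_).trans (if_pos (by simp)))
  intro Y l r hr
  split_ifs with hl
  · exact h Y l r hl hr
  · rfl

end Chain

namespace GradedQuiver

variable {K : Type w} [CommRing K]

section Square

variable (A : AInfCat.{w, u, v} K)

/-- The family of all classes of sequences. -/
def univConv : Conv A.toGradedQuiver A.toGradedQuiver id := fun _ _ c => A.tmk c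

theorem bd_univConv : Conv.bd (univConv A) = Conv.pre (univConv A) *
    (Conv.ofCochain (o := id) (fun _ _ c => A.b c) * univConv A) := by
  refine Conv.ext fun X Z c => ?_
  rw [Conv.bd_apply, AInfCat.bsum, Conv.mul_apply]
  refine Chain.spl_congr _ fun Y l r _ => ?_
  rw [Conv.mul_apply, tmul_spl]
  refine Chain.spl_congr _ fun Y' m r _ => ?_
  simp only [Conv.pre_apply, Conv.ofCochain_apply, univConv]
  split_ifs with hm
  · cases m with
    | nil => simp
    | cons f m => simp at hm
  · rw [tmul_tone, tmul_tmk]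

/-- Two operations applied to disjoint segments cancel in pairs because they are odd, and nested
ones cancel by the relations of `A`. Working with the universal family makes this a computation in
the convolution ring. -/
theorem bd_bd_univConv : Conv.bd (Conv.bd (univConv A)) = 0 := by
  have h1 : Conv.bd (Conv.pre (univConv A)) = -Conv.pre (Conv.bd (univConv A)) := by
    refine Conv.ext fun X Y c => ?_
    rw [Conv.neg_apply, Conv.pre_apply, Conv.bd_apply, Conv.bd_apply,
      A.bsum_sgc (φ := univConv A X Y) tmk_multilin]
    exact (congrArg Neg.neg (A.map_bsum (negAddMonoidHom : A.Tens X Y →+ A.Tens X Y)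
      (fun c => univConv A X Y (A.sgc 1 c)) c)).symm.trans (neg_neg _) |>.symm
  have h2 : Conv.bd (Conv.ofCochain (R := A.toGradedQuiver) (o := id) fun _ _ c => A.b c) = 0 := by
    refine Conv.ext fun X Y c => ?_
    have := A.map_bsum (tone (R := A.toGradedQuiver)) A.b c
    rw [A.bsum_b, map_zero] at this
    exact this.symm
  rw [bd_univConv, Conv.bd_mul, Conv.bd_mul, h1, h2, bd_univConv]
  simp only [map_mul, Conv.pre_pre]
  noncomm_ring

theorem bsum_bsum {M : Type*} [AddCommGroup M] [Module K M] {X Y : A.Obj}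
    {φ : Chain A.Hom X Y → M} (h : Multilin φ) (c : Chain A.Hom X Y) :
    A.bsum (A.bsum φ) c = 0 := by
  have h1 : φ = fun c => tlift φ h (univConv A X Y c) := by
    funext c; exact (tlift_tmk φ h c).symm
  rw [h1]
  have h2 : A.bsum (fun c => tlift φ h (univConv A X Y c)) =
      fun c => tlift φ h (Conv.bd (univConv A) X Y c) :=
    funext fun c => (A.map_bsum (tlift φ h) _ c).symm
  rw [h2, ← A.map_bsum (tlift φ h)]
  have := congrFun (congrFun (congrFun (bd_bd_univConv A) X) Y) c
  exact (congrArg (tlift φ h) this).trans (map_zero _)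

end Square

namespace Conv

variable {A : AInfCat.{w, u, v} K} {B : AInfCat.{w, u', v'} K} {o : A.Obj → B.Obj}
  {F G H T T' : Conv A.toGradedQuiver B.toGradedQuiver o}

theorem beta_bd (P : Conv A.toGradedQuiver B.toGradedQuiver o) : beta (bd P) = bd (beta P) :=
  ext fun X Y c => A.map_bsum (tone.comp (bT B)) _ c

theorem bd_hat (hF : Pos F) : bd F.hat = (pre F).hat * (bd F * F.hat) := by
  refine hF.pre.eq_hat ?_
  conv_lhs => rw [hF.hat_eq, map_add, bd_one, add_zero, bd_mul]
  rw [add_comm]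

/-- The generating family of an `A∞` functor. -/
structure IsFunctor (F : Conv A.toGradedQuiver B.toGradedQuiver o) : Prop where
  letter : IsLetter F
  pos : Pos F
  even : pre F = post F
  relation : beta F.hat = bd F

/-- The generating family of a closed natural transformation (odd for the shifted degrees). -/
structure IsTrans (F G T : Conv A.toGradedQuiver B.toGradedQuiver o) : Prop where
  letter : IsLetter T
  odd : pre T = -post T
  bd_bd : bd (bd T) = 0
  relation : bd T + beta ((post G).hat * (T * F.hat)) = 0

/-- `G` is not assumed to be a functor. Expanding both coderivations, everything cancels against the
equation of `T` and the relation of `F`, except the terms in which the defect of `G` stands to the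
left of `T`. -/
theorem cD_add_bd (hF : IsFunctor F) (hG : IsLetter G) (hG₀ : Pos G) (hG₁ : pre G = post G)
    (hT : IsLetter T) (hT₁ : pre T = -post T)
    (hS : bd T + beta ((post G).hat * (T * F.hat)) = 0) :
    cD ((post G).hat * (T * F.hat)) + bd ((post G).hat * (T * F.hat)) =
      -(G.hat * (post (beta G.hat - bd G) * ((post G).hat * (T * F.hat)))) := by
  have e1 : bd (post G).hat = G.hat * (post (bd G) * (post G).hat) := by
    rw [bd_hat hG₀.post, pre_post, hG₁, post_post, bd_post]
  have e2 : beta (post G).hat = -post (beta G.hat) := by rw [← post_hat, beta_post]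
  have e3 : beta ((post G).hat * (T * F.hat)) = -bd T := by
    rw [← sub_eq_zero, sub_neg_eq_add, add_comm]; exact hS
  rw [cD_hat₂ hF.letter hF.pos hG.post hG₀.post hT, post_post, e2, e3, bd_mul, bd_mul, e1,
    pre_hat, pre_post, hG₁, post_post, hT₁, bd_hat hF.pos, hF.even, hF.relation, map_sub]
  noncomm_ring

/-- The Bianchi identity for the defect of `G`: apply `beta` to `cD_add_bd`. The first term dies
since `beta ∘ cD = 0`. The second becomes `-bd (bd T) = 0` by the equation of `T`. -/
theorem gauge_bianchi (hF : IsFunctor F) (hG : IsLetter G) (hG₀ : Pos G) (hG₁ : pre G = post G)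
    (hT : IsTrans F G T) :
    beta (G.hat * (post (beta G.hat - bd G) * ((post G).hat * (T * F.hat)))) = 0 := by
  have h := congrArg beta (cD_add_bd hF hG hG₀ hG₁ hT.letter hT.odd hT.relation)
  have e3 : beta ((post G).hat * (T * F.hat)) = -bd T := by
    rw [← sub_eq_zero, sub_neg_eq_add, add_comm]; exact hT.relation
  rw [map_add, beta_cD, beta_bd, e3, map_neg, hT.bd_bd, map_neg] at h
  rw [← neg_eq_zero, ← h]; simp

/-- `N` applies the operations to all arrangements with `T` and `T'` both present. Comparing the
coderivations of target and source on such arrangements leaves only `(post H).hat * (N * F.hat)`,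
and `beta` of this comparison is the closedness of `N`. -/
theorem IsTrans.comp (hF : IsFunctor F) (hG : IsFunctor G) (hH : IsFunctor H) (hT : IsTrans F G T)
    (hT' : IsTrans G H T') :
    let N := beta (H.hat * (Conv.post T' * ((Conv.post G).hat * (T * F.hat))))
    pre N = -Conv.post N ∧ bd N + beta ((Conv.post H).hat * (N * F.hat)) = 0 := by
  intro N
  have e1 := cD_add_bd hF hG.letter hG.pos hG.even hT.letter hT.odd hT.relation
  rw [hG.relation, sub_self, map_zero, zero_mul, mul_zero, neg_zero] at e1
  have e2 : beta (H.hat * (Conv.post T' * (Conv.post G).hat)) = Conv.post (bd T') := by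
    have := hT'.relation
    have h1 : H.hat * (Conv.post T' * (Conv.post G).hat) =
        Conv.post ((Conv.post H).hat * (T' * G.hat)) := by
      rw [map_mul, map_mul, post_hat, post_post, post_hat]
    rw [h1, beta_post, ← map_neg, ← sub_eq_zero, ← map_sub]
    rw [← neg_eq_zero, ← map_neg, ← map_zero Conv.post, ← this]
    congr 1; abel
  constructor
  · have e3 : Conv.pre (H.hat * (Conv.post T' * ((Conv.post G).hat * (T * F.hat)))) =
        Conv.post (H.hat * (Conv.post T' * ((Conv.post G).hat * (T * F.hat)))) := by
      simp only [map_mul, pre_hat, post_hat, pre_post, hF.even, hG.even, hH.even, hT.odd, hT'.odd,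
        post_post, map_neg]
      noncomm_ring
    rw [← beta_post, ← e3]
    rfl
  · have e3 := cD_hat₃ hF.letter hF.pos hG.letter.post hG.pos.post hH.letter hH.pos hT.letter
      hT'.letter.post
    rw [eq_neg_of_add_eq_zero_left e1, e2, hH.relation, post_post] at e3
    have e4 : bd (H.hat * (Conv.post T' * ((Conv.post G).hat * (T * F.hat)))) =
        (Conv.post H).hat * (bd H * (H.hat * (Conv.post T' * ((Conv.post G).hat * (T * F.hat))))) +
        (Conv.post H).hat * (Conv.post (bd T') * ((Conv.post G).hat * (T * F.hat))) -
        (Conv.post H).hat * (T' * bd ((Conv.post G).hat * (T * F.hat))) := by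
      rw [bd_mul, bd_mul (Conv.post T'), bd_hat hH.pos, hH.even, pre_hat, hH.even, pre_post,
        hT'.odd, map_neg, post_post, bd_post]
      noncomm_ring
    have e5 : cD (H.hat * (Conv.post T' * ((Conv.post G).hat * (T * F.hat)))) =
        bd (H.hat * (Conv.post T' * ((Conv.post G).hat * (T * F.hat)))) +
          (Conv.post H).hat * (N * F.hat) := by
      rw [e3, e4]
      noncomm_ring
    have e6 := congrArg beta e5
    rw [beta_cD, map_add, beta_bd] at e6
    exact e6.symm

end Conv
end GradedQuiver
end AInf

/-! ### Degrees and strict units. -/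

namespace AInf

theorem Chain.spl_mem {O : Type*} {H : O → O → Type*} {M : Type*} [AddCommMonoid M] {S : Type*}
    [SetLike S M] [AddSubmonoidClass S M] (s : S) {X Z : O} (c : Chain H X Z)
    {g : ∀ Y, Chain H Y Z → Chain H X Y → M} (h : ∀ Y l r, l.append r = c → g Y l r ∈ s) :
    c.spl g ∈ s := by
  induction c with
  | nil => rw [spl_nil]; exact h _ _ _ rfl
  | cons f c ih =>
    rw [spl_cons]
    exact add_mem (h _ _ _ rfl) (ih fun Y l r e => h _ _ _ (by rw [cons_append, e]))

namespace GradedQuiver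

variable {K : Type w} [CommRing K]

section Degree

variable {Q : GradedQuiver.{w, u, v} K}

theorem HasDegree.congr {X Y : Q.Obj} {c : Chain Q.Hom X Y} {d e : ℤ} (h : Q.HasDegree c d)
    (he : d = e) : Q.HasDegree c e := he ▸ h

theorem HasDegree.append {W X Y : Q.Obj} {l : Chain Q.Hom X Y} {r : Chain Q.Hom W X} {d e : ℤ}
    (hl : Q.HasDegree l d) (hr : Q.HasDegree r e) : Q.HasDegree (l.append r) (d + e) := by
  induction hl with
  | nil => simpa using hr
  | cons hf _ ih => exact (HasDegree.cons hf ih).congr (by ring)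

theorem HasDegree.of_cons {X Y Z : Q.Obj} {f : Q.Hom Y Z} {c : Chain Q.Hom X Y} {d : ℤ}
    (h : Q.HasDegree (Chain.cons f c) d) : ∃ d₁ d₂, f ∈ Q.gr _ _ d₁ ∧ Q.HasDegree c d₂ ∧
      d = d₁ + d₂ := by
  cases h with
  | cons hf hc => exact ⟨_, _, hf, hc, rfl⟩

theorem HasDegree.of_append {W X : Q.Obj} : ∀ {Y : Q.Obj} {l : Chain Q.Hom X Y}
    {r : Chain Q.Hom W X} {d : ℤ}, Q.HasDegree (l.append r) d → ∃ d₁ d₂, Q.HasDegree l d₁ ∧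
      Q.HasDegree r d₂ ∧ d = d₁ + d₂
  | _, Chain.nil, r, d, h => ⟨0, d, .nil, h, (zero_add d).symm⟩
  | _, Chain.cons f l, r, d, h => by
    obtain ⟨d₁, d₂, h₁, h₂, rfl⟩ := HasDegree.of_cons h
    obtain ⟨d₃, d₄, h₃, h₄, rfl⟩ := HasDegree.of_append h₂
    exact ⟨_, _, .cons h₁ h₃, h₄, by ring⟩

/-- The tensors of degree `D`, for the degrees shifted by one. -/
def tgr (Q : GradedQuiver.{w, u, v} K) (X Y : Q.Obj) (D : ℤ) : Submodule K (Q.Tens X Y) :=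
  Submodule.span K {x | ∃ c d, Q.HasDegree c d ∧ d - c.length = D ∧ Q.tmk c = x}

theorem HasDegree.tmk_mem {X Y : Q.Obj} {c : Chain Q.Hom X Y} {d : ℤ} (h : Q.HasDegree c d)
    {D : ℤ} (hD : d - c.length = D) : Q.tmk c ∈ Q.tgr X Y D :=
  Submodule.subset_span ⟨c, d, h, hD, rfl⟩

theorem map_tgr_mem {M : Type*} [AddCommGroup M] [Module K M] {X Y : Q.Obj} {D : ℤ}
    (g : Q.Tens X Y →ₗ[K] M) (S : Submodule K M)
    (h : ∀ c d, Q.HasDegree c d → d - c.length = D → g (Q.tmk c) ∈ S) {x : Q.Tens X Y}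
    (hx : x ∈ Q.tgr X Y D) : g x ∈ S := by
  have : Q.tgr X Y D ≤ S.comap g := by
    rw [tgr, Submodule.span_le]
    rintro _ ⟨c, d, hc, hd, rfl⟩
    exact h c d hc hd
  exact this hx

theorem tmul_mem {X Y Z : Q.Obj} {D E F : ℤ} {x : Q.Tens Y Z} {y : Q.Tens X Y}
    (hx : x ∈ Q.tgr Y Z D) (hy : y ∈ Q.tgr X Y E) (hF : F = D + E) : tmul x y ∈ Q.tgr X Z F := by
  rw [← LinearMap.flip_apply]
  refine map_tgr_mem (tmul.flip y) _ (fun c d hc hd => ?_) hx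
  refine map_tgr_mem (tmul (Q.tmk c)) _ (fun c' d' hc' hd' => ?_) hy
  rw [tmul_tmk]
  refine (hc.append hc').tmk_mem ?_
  simp only [Chain.length_append]
  push_cast
  linarith

theorem tone_mem {X Y : Q.Obj} {d D : ℤ} {x : Q.Hom X Y} (hx : x ∈ Q.gr X Y d) (hD : d - 1 = D) :
    tone x ∈ Q.tgr X Y D :=
  (HasDegree.cons hx .nil).tmk_mem (by simpa using hD)

end Degree

theorem bT_mem (B : AInfCat.{w, u', v'} K) {X Y : B.Obj} {D : ℤ} {x : B.Tens X Y}
    (hx : x ∈ B.tgr X Y D) : bT B x ∈ B.gr X Y (D + 2) := by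
  refine map_tgr_mem (bT B) _ (fun c d hc hd => ?_) hx
  rw [bT_tmk]
  have := B.b_isMultilinear.degree c d hc
  rw [← hd, show d - (c.length : ℤ) + 2 = d + 2 - c.length by ring]
  exact this

section Good

variable {Q : GradedQuiver.{w, u, v} K} {R : GradedQuiver.{w, u', v'} K} {o : Q.Obj → R.Obj}

/-- A cochain is multilinear and of degree `p`. -/
abbrev CochainOfDegree (p : ℤ) (f : Cochain Q R o) : Prop :=
  Q.IsMultilinear R o o p fun {X Y} c => f X Y c

theorem CochainOfDegree.multilin {p : ℤ} {f : Cochain Q R o} (h : CochainOfDegree p f)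
    {X Y : Q.Obj} : Multilin (f X Y) := fun _ _ l r => h.linear l r

theorem CochainOfDegree.add {p : ℤ} {f g : Cochain Q R o} (hf : CochainOfDegree p f)
    (hg : CochainOfDegree p g) : CochainOfDegree p (f + g) where
  linear l r := hf.multilin.add hg.multilin l r
  degree c d hc := add_mem (hf.degree c d hc) (hg.degree c d hc)

theorem CochainOfDegree.neg {p : ℤ} {f : Cochain Q R o} (hf : CochainOfDegree p f) :
    CochainOfDegree p (-f) where
  linear l r := hf.multilin.neg l r
  degree c d hc := neg_mem (hf.degree c d hc)

theorem CochainOfDegree.sub {p : ℤ} {f g : Cochain Q R o} (hf : CochainOfDegree p f)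
    (hg : CochainOfDegree p g) : CochainOfDegree p (f - g) := by
  rw [sub_eq_add_neg]; exact hf.add hg.neg

namespace Conv

/-- Multilinearity, and degree `p` for the degrees shifted by one. -/
structure OfDegree (p : ℤ) (P : Conv Q R o) : Prop where
  multilin : ∀ X Y, Multilin (P X Y)
  degree : ∀ {X Y : Q.Obj} (c : Chain Q.Hom X Y) (d : ℤ), Q.HasDegree c d →
    P X Y c ∈ R.tgr (o X) (o Y) (d - c.length + p)

theorem OfDegree.add {p : ℤ} {P P' : Conv Q R o} (h : OfDegree p P) (h' : OfDegree p P') :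
    OfDegree p (P + P') where
  multilin X Y := (h.multilin X Y).add (h'.multilin X Y)
  degree c d hc := add_mem (h.degree c d hc) (h'.degree c d hc)

theorem OfDegree.congr {p q : ℤ} {P : Conv Q R o} (h : OfDegree p P) (e : p = q) : OfDegree q P :=
  e ▸ h

theorem OfDegree.mul {p q : ℤ} {P P' : Conv Q R o} (h : OfDegree p P) (h' : OfDegree q P') :
    OfDegree (p + q) (P * P') where
  multilin X Z := Multilin.spl (fun Y r => (h.multilin Y Z).comp (tmul.flip (P' X Y r)))
    fun Y l => (h'.multilin X Y).comp (tmul (P Y Z l))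
  degree c d hc := by
    rw [mul_apply]
    refine Chain.spl_mem _ c fun Y l r e => ?_
    obtain ⟨d₁, d₂, h₁, h₂, rfl⟩ := HasDegree.of_append (e ▸ hc)
    refine tmul_mem (h.degree l _ h₁) (h'.degree r _ h₂) ?_
    rw [← e, Chain.length_append]
    push_cast
    ring

theorem ofDegree_one : OfDegree 0 (1 : Conv Q R o) where
  multilin X Y V W l r := by
    have : ∀ f : Q.Hom V W, (1 : Conv Q R o) X Y (l.append (Chain.cons f r)) = 0 :=
      fun f => one_apply_of_length (by simp)
    simp only [this]
    exact (0 : _ →ₗ[K] _).isLinear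
  degree c d hc := by
    cases hc with
    | nil => exact HasDegree.nil.tmk_mem (by simp)
    | cons hf hc => rw [one_cons]; exact zero_mem _

theorem OfDegree.pow {P : Conv Q R o} (h : OfDegree 0 P) (i : ℕ) : OfDegree 0 (P ^ i) := by
  induction i with
  | zero => rw [pow_zero]; exact ofDegree_one
  | succ i ih => rw [pow_succ]; exact (ih.mul h).congr (zero_add 0)

theorem OfDegree.sum {p : ℤ} {f : ℕ → Conv Q R o} (h : ∀ i, OfDegree p (f i)) (n : ℕ) :
    OfDegree p (∑ i ∈ Finset.range n, f i) := by
  induction n with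
  | zero =>
    rw [Finset.sum_range_zero]
    exact ⟨fun X Y => multilin_zero, fun c d hc => zero_mem _⟩
  | succ n ih => rw [Finset.sum_range_succ]; exact ih.add (h n)

theorem OfDegree.hat {P : Conv Q R o} (h : OfDegree 0 P) : OfDegree 0 P.hat where
  multilin X Y V W l r := by
    have := (OfDegree.sum h.pow ((l.length + (r.length + 1)) + 1)).multilin X Y l r
    simpa only [Conv.hat, Chain.length_append, Chain.length_cons] using this
  degree c d hc := (OfDegree.sum h.pow (c.length + 1)).degree c d hc

theorem OfDegree.post {p : ℤ} {P : Conv Q R o} (h : OfDegree p P) : OfDegree p (post P) where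
  multilin X Y := (h.multilin X Y).comp (tsg 1)
  degree c d hc := by
    refine map_tgr_mem (tsg 1) _ (fun c' d' hc' hd' => ?_) (h.degree c d hc)
    rw [tsg_tmk]
    exact (hc'.sgc 1).tmk_mem (by simpa using hd')

theorem _root_.AInf.GradedQuiver.CochainOfDegree.ofCochain {p : ℤ} {f : Cochain Q R o}
    (h : CochainOfDegree p f) : OfDegree (p - 1) (ofCochain f) where
  multilin X Y := h.multilin.comp tone
  degree c d hc := tone_mem (h.degree c d hc) (by ring)

end Conv
end Good

namespace Conv

variable {Q : GradedQuiver.{w, u, v} K} {B : AInfCat.{w, u', v'} K} {o : Q.Obj → B.Obj}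

theorem OfDegree.bc {p : ℤ} {P : Conv Q B.toGradedQuiver o} (h : OfDegree p P) :
    CochainOfDegree (p + 2) (bc P) where
  linear l r := ((h.multilin _ _).comp (bT B)) l r
  degree c d hc := by
    have := bT_mem B (h.degree c d hc)
    rw [show d - (c.length : ℤ) + p + 2 = d + (p + 2) - c.length by ring] at this
    exact this

end Conv

section Source

variable {A : AInfCat.{w, u, v} K} {R : GradedQuiver.{w, u', v'} K} {o : A.Obj → R.Obj}

/-- Precomposition of a cochain with the coderivation given by the operations of `A`. -/
def bdc (f : Cochain A.toGradedQuiver R o) : Cochain A.toGradedQuiver R o :=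
  fun X Y c => A.bsum (f X Y) c

theorem bd_ofCochain (f : Cochain A.toGradedQuiver R o) :
    Conv.bd (Conv.ofCochain f) = Conv.ofCochain (bdc f) :=
  Conv.ext fun _ _ c => (A.map_bsum tone _ c).symm

theorem CochainOfDegree.bdc {p : ℤ} {f : Cochain A.toGradedQuiver R o} (h : CochainOfDegree p f) :
    CochainOfDegree (p + 1) (bdc f) where
  linear l r := bsum_multilin h.multilin l r
  degree c d hc := by
    rw [GradedQuiver.bdc]
    refine Chain.spl_mem (R.gr _ _ _) c fun Y l r' e =>
      Chain.spl_mem (R.gr _ _ _) r' fun Y' m r e' => ?_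
    split_ifs with hm
    · exact zero_mem _
    · obtain ⟨d₁, d₂, h₁, h₂, rfl⟩ := HasDegree.of_append (e ▸ hc)
      obtain ⟨d₃, d₄, h₃, h₄, rfl⟩ := HasDegree.of_append (e' ▸ h₂)
      have := h.degree _ _ ((h₁.sgc 1).append (.cons (A.b_isMultilinear.degree m _ h₃) h₄))
      convert this using 1
      rw [← e, ← e']
      simp only [Chain.length_append, Chain.length_cons, length_sgc]
      push_cast
      ring_nf

theorem CochainOfDegree.bd_bd {p : ℤ} {f : Cochain A.toGradedQuiver R o} (h : CochainOfDegree p f) :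
    Conv.bd (Conv.bd (Conv.ofCochain f)) = 0 := by
  rw [bd_ofCochain, bd_ofCochain]
  refine Conv.ext fun X Y c => ?_
  rw [Conv.ofCochain_apply, GradedQuiver.bdc]
  exact (congrArg tone (bsum_bsum A h.multilin c)).trans (map_zero _)

theorem CochainOfDegree.pre {p : ℤ} {f : Cochain A.toGradedQuiver R o} (h : CochainOfDegree p f) :
    Conv.pre (Conv.ofCochain f) = (p + 1).negOnePow • Conv.post (Conv.ofCochain f) := by
  refine Conv.ext fun X Y c => ?_
  have := h.map_sgc 1 c
  rw [one_mul] at this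
  rw [Conv.pre_apply, Conv.ofCochain_apply, this]
  rcases Int.even_or_odd (p + 1) with h | h
  · simp [Int.negOnePow_even _ h]
  · simp [Int.negOnePow_odd _ h]

end Source

/-! ### Strict units -/

section Units

variable {B : AInfCat.{w, u', v'} K}

/-- Tensors of length at least `n`. -/
def tfil (Q : GradedQuiver.{w, u, v} K) (n : ℕ) (X Y : Q.Obj) : Submodule K (Q.Tens X Y) :=
  Submodule.span K {x | ∃ c, n ≤ c.length ∧ Q.tmk c = x}

theorem map_tfil_mem {Q : GradedQuiver.{w, u, v} K} {M : Type*} [AddCommGroup M] [Module K M]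
    {X Y : Q.Obj} {n : ℕ} (g : Q.Tens X Y →ₗ[K] M) (S : Submodule K M)
    (h : ∀ c, n ≤ c.length → g (Q.tmk c) ∈ S) {x : Q.Tens X Y} (hx : x ∈ Q.tfil n X Y) :
    g x ∈ S := by
  have : Q.tfil n X Y ≤ S.comap g := by
    rw [tfil, Submodule.span_le]
    rintro _ ⟨c, hc, rfl⟩
    exact h c hc
  exact this hx

theorem sg_strictUnit {X : B.Obj} {e : B.Hom X X} (he : B.IsStrictUnit e) (k : ℤ) :
    B.sg k e = k.negOnePow • e := by
  rw [sg_of_mem k he.mem]; simp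

theorem b_strictUnit_of_length {X Y Z : B.Obj} {e : B.Hom X X} (he : B.IsStrictUnit e)
    (l : Chain B.Hom X Z) (r : Chain B.Hom Y X) (h : l.length + r.length ≠ 1) :
    B.b (l.append (Chain.cons e r)) = 0 := by
  rw [AInfCat.b, om_append_cons, sg_strictUnit he]
  have hm : Multilin (B.m : Chain B.Hom Y Z → _) := isMultilinear_multilin B.isMultilinear
  rw [(hm.append_left _).map_unit_smul, he.vanish, smul_zero]
  simp only [Chain.length_append, Chain.length_cons, length_sgc, length_om]
  omega

theorem b_strictUnit_right {X Y : B.Obj} {e : B.Hom X X} (he : B.IsStrictUnit e) (f : B.Hom X Y) :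
    B.b (Chain.cons f (Chain.cons e Chain.nil)) = B.sg 1 f := by
  rw [AInfCat.b]
  simp only [om_cons, om_nil, Chain.length_cons, Chain.length_nil, Nat.cast_zero, zero_add,
    Nat.cast_one, sg_zero]
  exact he.right (B.sg 1 f)

theorem b_strictUnit_left {X Y : B.Obj} {e : B.Hom X X} (he : B.IsStrictUnit e) (f : B.Hom Y X) :
    B.b (Chain.cons e (Chain.cons f Chain.nil)) = -f := by
  have hm : Multilin (B.m : Chain B.Hom Y X → _) := isMultilinear_multilin B.isMultilinear
  rw [AInfCat.b]
  simp only [om_cons, om_nil, sg_strictUnit he, Chain.length_cons,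
    Chain.length_nil, Nat.cast_zero, zero_add, Nat.cast_one, sg_zero, Int.negOnePow_one,
    Units.neg_smul, one_smul]
  exact (map_neg ((hm Chain.nil (Chain.single f)).mk' _) e).trans (congrArg Neg.neg (he.left f))

theorem bT_tone_strictUnit {X Y : B.Obj} {e : B.Hom X X} (he : B.IsStrictUnit e) (f : B.Hom X Y) :
    bT B (tmul (tone f) (tone e)) = B.sg 1 f := by
  rw [tone_apply e, tmul_tone, bT_tmk]
  exact b_strictUnit_right he f

theorem bT_strictUnit_tone {X Y : B.Obj} {e : B.Hom X X} (he : B.IsStrictUnit e) (f : B.Hom Y X) :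
    bT B (tmul (tone e) (tone f)) = -f := by
  rw [tone_apply f, tmul_tone, bT_tmk]
  exact b_strictUnit_left he f

/-- A strict unit with at least two further arguments is outside the reach of `m_2`. Stating this
through the length filtration allows `x` and `y` to be sums of tensors of different lengths. -/
theorem bT_strictUnit {X Y Z : B.Obj} {e : B.Hom X X} (he : B.IsStrictUnit e) {m n : ℕ}
    (h : 2 ≤ m + n) {x : B.Tens X Z} {y : B.Tens Y X} (hx : x ∈ B.tfil m X Z)
    (hy : y ∈ B.tfil n Y X) : bT B (tmul x (tmul (tone e) y)) = 0 := by
  rw [← Submodule.mem_bot K]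
  refine map_tfil_mem (bT B ∘ₗ tmul.flip (tmul (tone e) y)) _ (fun c hc => ?_) hx
  refine map_tfil_mem (bT B ∘ₗ tmul (B.tmk c) ∘ₗ tmul (tone e)) _ (fun c' hc' => ?_) hy
  simp only [LinearMap.comp_apply, tmul_tone, tmul_tmk, bT_tmk]
  exact (Submodule.mem_bot K).2 (b_strictUnit_of_length he c c' (by omega))

namespace Conv

variable {Q : GradedQuiver.{w, u, v} K} {o : Q.Obj → B.Obj}

/-- `P` takes values in the tensors of length at least `n`. -/
def Fil {R : GradedQuiver.{w, u', v'} K} {o : Q.Obj → R.Obj} (n : ℕ) (P : Conv Q R o) : Prop :=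
  ∀ X Y (c : Chain Q.Hom X Y), P X Y c ∈ R.tfil n (o X) (o Y)

theorem fil_zero {R : GradedQuiver.{w, u', v'} K} {o : Q.Obj → R.Obj} (P : Conv Q R o) :
    Fil 0 P := fun X Y c => by
  induction P X Y c using tens_induction with
  | h c => exact Submodule.subset_span ⟨c, Nat.zero_le _, rfl⟩
  | hadd x y hx hy => exact add_mem hx hy
  | hsmul k x hx => exact Submodule.smul_mem _ k hx

theorem IsLetter.fil {R : GradedQuiver.{w, u', v'} K} {o : Q.Obj → R.Obj} {P : Conv Q R o} :
    IsLetter P → Fil 1 P := by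
  rintro ⟨f, rfl⟩ X Y c
  exact Submodule.subset_span ⟨_, le_rfl, rfl⟩

theorem Fil.mul {R : GradedQuiver.{w, u', v'} K} {o : Q.Obj → R.Obj} {P P' : Conv Q R o} {m n : ℕ}
    (h : Fil m P) (h' : Fil n P') : Fil (m + n) (P * P') := fun X Y c => by
  rw [mul_apply]
  refine Chain.spl_mem _ c fun Z l r e => ?_
  rw [← LinearMap.flip_apply]
  refine map_tfil_mem (tmul.flip (P' X Z r)) _ (fun a ha => ?_) (h _ _ l)
  refine map_tfil_mem (tmul (R.tmk a)) _ (fun a' ha' => ?_) (h' _ _ r)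
  rw [tmul_tmk]
  exact Submodule.subset_span ⟨_, by simp only [Chain.length_append]; omega, rfl⟩

/-- The cochain given by units on empty sequences. -/
def unitCochain (Q : GradedQuiver.{w, u, v} K) (o : Q.Obj → B.Obj) (e : ∀ Y, B.Hom Y Y) :
    Cochain Q B.toGradedQuiver o
  | X, _, Chain.nil => e (o X)
  | _, _, Chain.cons _ _ => 0

variable (Q o) in
/-- The family given by units on empty sequences. -/
def eps (e : ∀ Y, B.Hom Y Y) : Conv Q B.toGradedQuiver o := ofCochain (unitCochain Q o e)

@[simp] theorem eps_nil (e : ∀ Y, B.Hom Y Y) (X : Q.Obj) :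
    eps Q o e X X Chain.nil = tone (e (o X)) := rfl

theorem eps_of_length (e : ∀ Y, B.Hom Y Y) {X Y : Q.Obj} {c : Chain Q.Hom X Y}
    (h : c.length ≠ 0) : eps Q o e X Y c = 0 := by
  cases c with
  | nil => simp at h
  | cons f c => exact map_zero tone

variable {e : ∀ Y, B.Hom Y Y}

theorem eps_mul_apply (P : Conv Q B.toGradedQuiver o) {X Y : Q.Obj} (c : Chain Q.Hom X Y) :
    (eps Q o e * P) X Y c = tmul (tone (e (o Y))) (P X Y c) := by
  rw [mul_apply, Chain.spl_length_zero_left]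
  · rfl
  · intro Z l r h
    rw [eps_of_length e h, map_zero, LinearMap.zero_apply]

theorem mul_eps_apply (P : Conv Q B.toGradedQuiver o) {X Y : Q.Obj} (c : Chain Q.Hom X Y) :
    (P * eps Q o e) X Y c = tmul (P X Y c) (tone (e (o X))) := by
  rw [mul_apply, Chain.spl_length_zero_right]
  · rfl
  · intro Z l r h
    rw [eps_of_length e h, map_zero]

theorem beta_eps_of_fil (he : ∀ Y, B.IsStrictUnit (e Y)) {m n : ℕ} (h : 2 ≤ m + n)
    {P P' : Conv Q B.toGradedQuiver o}
    (hP : Fil m P) (hP' : Fil n P') : beta (P * (eps Q o e * P')) = 0 := ext fun X Y c => by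
  rw [beta_apply, mul_apply, Chain.map_spl, Chain.spl_eq_zero, map_zero, zero_apply]
  intro Z l r _
  rw [eps_mul_apply, bT_strictUnit (he _) h (hP _ _ l) (hP' _ _ r)]

theorem beta_mul_eps (he : ∀ Y, B.IsStrictUnit (e Y)) {P : Conv Q B.toGradedQuiver o} (hP : IsLetter P) :
    beta (P * eps Q o e) = post P := by
  obtain ⟨f, rfl⟩ := hP
  refine ext fun X Y c => ?_
  rw [beta_apply, mul_eps_apply, ofCochain_apply, bT_tone_strictUnit (he _)]
  rw [post_apply, ofCochain_apply, tsg_tone]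

theorem beta_eps_mul (he : ∀ Y, B.IsStrictUnit (e Y)) {P : Conv Q B.toGradedQuiver o} (hP : IsLetter P) :
    beta (eps Q o e * P) = -P := by
  obtain ⟨f, rfl⟩ := hP
  refine ext fun X Y c => ?_
  rw [beta_apply, eps_mul_apply, ofCochain_apply, bT_strictUnit_tone (he _)]
  rw [neg_apply, ofCochain_apply, map_neg]

theorem beta_eps (he : ∀ Y, B.IsStrictUnit (e Y)) : beta (eps Q o e) = 0 := ext fun X Y c => by
  cases c with
  | nil =>
    have := b_strictUnit_of_length (he (o X)) Chain.nil Chain.nil (by simp)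
    rw [beta_apply, eps_nil, tone_apply (e (o X)), bT_tmk, zero_apply]
    exact (congrArg tone this).trans (map_zero _)
  | cons f c => rw [beta_apply, eps_of_length e (by simp), map_zero, map_zero, zero_apply]

/-- Only `m_2` sees a strict unit, so `G ⊗ e` and `e ⊗ F` are the only arrangements which
contribute; their opposite signs come from the shift. -/
theorem beta_hat_eps_hat (he : ∀ Y, B.IsStrictUnit (e Y)) {F G : Conv Q B.toGradedQuiver o} (hF : IsLetter F) (hF₀ : Pos F)
    (hG : IsLetter G) (hG₀ : Pos G) :
    beta (G.hat * (eps Q o e * F.hat)) = post G - F := by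
  -- The arrangements are separated by the number of letters beside the unit: at least two (three
  -- terms), exactly one (two terms), none.
  have e1 : G.hat * (eps Q o e * F.hat) = G.hat * (G * G) * (eps Q o e * F.hat) +
      G * (eps Q o e * (F * F.hat)) + G * eps Q o e + 1 * (eps Q o e * (F * F * F.hat)) +
      eps Q o e * F + eps Q o e := by
    have h1 : G.hat = G.hat * (G * G) + G + 1 := by
      conv_lhs => rw [hG₀.hat_eq', hG₀.hat_eq']
      noncomm_ring
    have h2 : F.hat = F * F * F.hat + F + 1 := by
      conv_lhs => rw [hF₀.hat_eq, hF₀.hat_eq]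
      noncomm_ring
    have h3 : eps Q o e * F.hat = 1 * (eps Q o e * (F * F * F.hat)) + eps Q o e * F + eps Q o e := by
      conv_lhs => rw [h2]
      noncomm_ring
    have h4 : G * (eps Q o e * F.hat) = G * (eps Q o e * (F * F.hat)) + G * eps Q o e := by
      conv_lhs => rw [hF₀.hat_eq]
      noncomm_ring
    conv_lhs => rw [h1, add_mul, add_mul, one_mul, h4]
    conv_lhs => enter [2]; rw [h3]
    abel
  rw [e1]
  simp only [map_add]
  rw [beta_eps_of_fil he le_rfl ((fil_zero G.hat).mul (hG.fil.mul hG.fil)) (fil_zero F.hat),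
    beta_eps_of_fil he le_rfl hG.fil (hF.fil.mul (fil_zero F.hat)), beta_mul_eps he hG,
    beta_eps_of_fil he le_rfl (fil_zero 1) ((hF.fil.mul hF.fil).mul (fil_zero F.hat)),
    beta_eps_mul he hF, beta_eps he]
  abel

end Conv

end Units
end GradedQuiver
end AInf

/-! ### Gauge transformations of functors. -/

namespace AInf
namespace GradedQuiver

variable {K : Type w} [CommRing K]

namespace Conv

variable {Q : GradedQuiver.{w, u, v} K} {R : GradedQuiver.{w, u', v'} K} {o : Q.Obj → R.Obj}

theorem Pos.mul_left {P : Conv Q R o} (h : Pos P) (P' : Conv Q R o) : Pos (P * P') := fun X => by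
  rw [mul_apply, Chain.spl_nil, h X, map_zero, LinearMap.zero_apply]

theorem Pos.mul_right {P : Conv Q R o} (h : Pos P) (P' : Conv Q R o) : Pos (P' * P) := fun X => by
  rw [mul_apply, Chain.spl_nil, h X, map_zero]

theorem Pos.add {P P' : Conv Q R o} (h : Pos P) (h' : Pos P') : Pos (P + P') := fun X => by
  rw [add_apply, h X, h' X, add_zero]

@[simp] theorem hat_nil (P : Conv Q R o) (X : Q.Obj) : P.hat X X Chain.nil = R.tmk Chain.nil := by
  simp [hat]

/-- `Z` takes at least one entry, which leaves shorter sequences for the other factor. This gain of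
one makes the gauge equation recursive. -/
theorem AgreeTo.mul_pos {n : ℕ} {P P' Z : Conv Q R o} (h : AgreeTo n P P') (hZ : Pos Z) :
    AgreeTo (n + 1) (P * Z) (P' * Z) := fun X Y c hc => by
  rw [mul_apply, mul_apply]
  refine Chain.spl_congr' c fun W l r hl => ?_
  by_cases h0 : r.length = 0
  · rw [hZ.apply r h0, map_zero, map_zero]
  · rw [h _ _ l (by omega)]

theorem AgreeTo.beta {B : AInfCat.{w, u', v'} K} {o : Q.Obj → B.Obj} {n : ℕ}
    {P P' : Conv Q B.toGradedQuiver o} (h : AgreeTo n P P') : AgreeTo n (beta P) (beta P') :=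
  fun _ _ c hc => by rw [beta_apply, beta_apply, h _ _ c hc]

theorem AgreeTo.bd {A : AInfCat.{w, u, v} K} {o : A.Obj → R.Obj} {n : ℕ}
    {P P' : Conv A.toGradedQuiver R o} (h : AgreeTo n P P') : AgreeTo n (bd P) (bd P') :=
  fun _ _ c hc => A.bsum_congr c fun c' hc' => h _ _ c' (hc'.trans hc)

theorem Pos.beta {B : AInfCat.{w, u', v'} K} {o : Q.Obj → B.Obj}
    {P : Conv Q B.toGradedQuiver o} (h : Pos P) : Pos (beta P) := fun X => by
  rw [beta_apply, h X, map_zero, map_zero]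

theorem pos_bd {A : AInfCat.{w, u, v} K} {o : A.Obj → R.Obj} (P : Conv A.toGradedQuiver R o) :
    Pos (bd P) := fun X => by
  simp [bd_apply, AInfCat.bsum]

/-- Reading off the entry of a sequence of length one, and zero on all other lengths, is multilinear
and gives a retraction of `tone`. -/
theorem tone_injective {X Y : R.Obj} : Function.Injective (tone : R.Hom X Y → R.Tens X Y) := by
  let φ : ∀ {X Y : R.Obj}, Chain R.Hom X Y → R.Hom X Y := fun {X Y} c =>
    match Y, c with
    | _, Chain.cons f Chain.nil => f
    | _, _ => 0
  have hφ : Multilin (φ : Chain R.Hom X Y → R.Hom X Y) := by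
    intro V W l r
    cases l with
    | nil =>
      cases r with
      | nil => exact LinearMap.id.isLinear
      | cons g r => exact (0 : _ →ₗ[K] R.Hom X Y).isLinear
    | cons g l =>
      cases l with
      | nil => exact (0 : _ →ₗ[K] R.Hom X Y).isLinear
      | cons g' l => exact (0 : _ →ₗ[K] R.Hom X Y).isLinear
  intro f g h
  have := congrArg (tlift φ hφ) h
  rw [tone_apply, tone_apply, tlift_tmk, tlift_tmk] at this
  exact this

theorem ofCochain_injective : Function.Injective (ofCochain : Cochain Q R o → Conv Q R o) := by
  intro f g h
  funext X Y c
  exact tone_injective (congrFun (congrFun (congrFun h X) Y) c)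

end Conv

variable {A : AInfCat.{w, u, v} K} {B : AInfCat.{w, u', v'} K} {o : A.Obj → B.Obj}

open Conv

/-- The cochain of an `A∞` functor, on the shifted modules. -/
structure IsFunctorCochain (f : Cochain A.toGradedQuiver B.toGradedQuiver o) : Prop where
  degree : CochainOfDegree 1 f
  nil : ∀ X, f X X Chain.nil = 0
  relation : beta (ofCochain f).hat = bd (ofCochain f)

theorem pos_ofCochain {Q : GradedQuiver.{w, u, v} K} {R : GradedQuiver.{w, u', v'} K}
    {o : Q.Obj → R.Obj} {f : Cochain Q R o} (h : ∀ X, f X X Chain.nil = 0) : Pos (ofCochain f) :=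
  fun X => by rw [ofCochain_apply, h X, map_zero]

theorem CochainOfDegree.even {f : Cochain A.toGradedQuiver B.toGradedQuiver o}
    (h : CochainOfDegree 1 f) : Conv.pre (Conv.ofCochain f) = post (Conv.ofCochain f) := by
  rw [h.pre]; simp [show (1 : ℤ) + 1 = 2 by norm_num, Int.negOnePow_even 2 (by decide)]

theorem CochainOfDegree.odd {f : Cochain A.toGradedQuiver B.toGradedQuiver o}
    (h : CochainOfDegree 0 f) : Conv.pre (Conv.ofCochain f) = -post (Conv.ofCochain f) := by
  rw [h.pre]; simp

theorem IsFunctorCochain.isFunctor {f : Cochain A.toGradedQuiver B.toGradedQuiver o}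
    (h : IsFunctorCochain f) : IsFunctor (ofCochain f) :=
  ⟨isLetter_ofCochain f, pos_ofCochain h.nil, CochainOfDegree.even h.degree, h.relation⟩

/-- The cochain of a closed natural transformation of degree `0` with `-e` as component on empty
sequences. -/
structure IsTransCochain (e : ∀ Y, B.Hom Y Y) (f g τ : Cochain A.toGradedQuiver B.toGradedQuiver o) :
    Prop where
  degree : CochainOfDegree 0 τ
  nil : ∀ X, τ X X Chain.nil = -e (o X)
  relation : bd (ofCochain τ) + beta ((post (ofCochain g)).hat * (ofCochain τ *
    (ofCochain f).hat)) = 0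

theorem IsTransCochain.isTrans {e : ∀ Y, B.Hom Y Y}
    {f g τ : Cochain A.toGradedQuiver B.toGradedQuiver o} (h : IsTransCochain e f g τ) :
    IsTrans (ofCochain f) (ofCochain g) (ofCochain τ) :=
  ⟨isLetter_ofCochain τ, CochainOfDegree.odd h.degree, h.degree.bd_bd, h.relation⟩

section Gauge

variable (f t : Cochain A.toGradedQuiver B.toGradedQuiver o)

/-- The right hand side of the equation which characterizes the gauge transform of `f` by `t`. -/
def gaugeMap (g : Cochain A.toGradedQuiver B.toGradedQuiver o) :
    Cochain A.toGradedQuiver B.toGradedQuiver o :=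
  f + bdc t + bc ((post (ofCochain g)).hat * (ofCochain t * (ofCochain f).hat))

/-- The gauge transform of `f` by `t`. -/
def gauge : Cochain A.toGradedQuiver B.toGradedQuiver o :=
  -- Each iteration settles one more length, and `f` is already correct in length zero, so as many
  -- iterations as entries suffice.
  fun X Y c => ((gaugeMap f t)^[c.length] f) X Y c

variable {f t}

theorem ofCochain_gaugeMap (g : Cochain A.toGradedQuiver B.toGradedQuiver o) :
    ofCochain (gaugeMap f t g) = ofCochain f + bd (ofCochain t) +
      beta ((post (ofCochain g)).hat * (ofCochain t * (ofCochain f).hat)) := by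
  rw [gaugeMap, map_add, map_add, bd_ofCochain, beta_eq]

/-- Since `t` consumes an entry, the right hand side in length `n + 1` only involves `g` in lengths
up to `n`. -/
theorem agreeTo_gaugeMap (ht : ∀ X, t X X Chain.nil = 0) {n : ℕ}
    {g g' : Cochain A.toGradedQuiver B.toGradedQuiver o}
    (h : AgreeTo n (ofCochain g) (ofCochain g')) :
    AgreeTo (n + 1) (ofCochain (gaugeMap f t g)) (ofCochain (gaugeMap f t g')) := by
  rw [ofCochain_gaugeMap, ofCochain_gaugeMap]
  exact (AgreeTo.refl _ _).add (h.post.hat.mul_pos ((pos_ofCochain ht).mul_left _)).beta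

theorem gaugeMap_nil (hf : ∀ X, f X X Chain.nil = 0) (ht : ∀ X, t X X Chain.nil = 0)
    (g : Cochain A.toGradedQuiver B.toGradedQuiver o) (X : A.Obj) :
    gaugeMap f t g X X Chain.nil = 0 := by
  refine tone_injective ?_
  rw [map_zero, ← ofCochain_apply, ofCochain_gaugeMap]
  exact ((pos_ofCochain hf).add (pos_bd _)).add
    ((((pos_ofCochain ht).mul_left _).mul_right _).beta) X

theorem agreeTo_gauge (hf : ∀ X, f X X Chain.nil = 0) (ht : ∀ X, t X X Chain.nil = 0) (n : ℕ) :
    AgreeTo n (ofCochain (gauge f t)) (ofCochain ((gaugeMap f t)^[n] f)) := by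
  have h1 : ∀ n, AgreeTo n (ofCochain ((gaugeMap f t)^[n] f))
      (ofCochain ((gaugeMap f t)^[n + 1] f)) := by
    intro n
    induction n with
    | zero =>
      intro X Y c hc
      exact ((pos_ofCochain hf).apply c (by omega)).trans ((pos_ofCochain (gaugeMap_nil hf ht f)).apply c (by omega)).symm
    | succ n ih =>
      rw [Function.iterate_succ_apply', Function.iterate_succ_apply' _ (n + 1)]
      exact agreeTo_gaugeMap ht ih
  have h2 : ∀ m n, m ≤ n → AgreeTo m (ofCochain ((gaugeMap f t)^[m] f))
      (ofCochain ((gaugeMap f t)^[n] f)) := by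
    intro m n hmn
    induction n, hmn using Nat.le_induction with
    | base => exact AgreeTo.refl _ _
    | succ n hn ih => exact ih.trans ((h1 n).mono hn)
  intro X Y c hc
  exact h2 _ _ hc X Y c le_rfl

theorem gaugeMap_gauge (hf : ∀ X, f X X Chain.nil = 0) (ht : ∀ X, t X X Chain.nil = 0) :
    gaugeMap f t (gauge f t) = gauge f t := by
  refine ofCochain_injective (ext_agree fun n => ?_)
  have h1 := (agreeTo_gaugeMap (f := f) ht (agreeTo_gauge hf ht n)).mono n.le_succ
  rw [← Function.iterate_succ_apply' (gaugeMap f t)] at h1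
  exact h1.trans ((agreeTo_gauge hf ht (n + 1)).mono n.le_succ).symm

theorem CochainOfDegree.gaugeMap {g : Cochain A.toGradedQuiver B.toGradedQuiver o}
    (hf : CochainOfDegree 1 f) (ht : CochainOfDegree 0 t) (hg : CochainOfDegree 1 g) :
    CochainOfDegree 1 (gaugeMap f t g) :=
  (hf.add ht.bdc).add ((hg.ofCochain.post.hat.mul (ht.ofCochain.mul hf.ofCochain.hat)).bc)

theorem CochainOfDegree.gauge (hf : CochainOfDegree 1 f) (ht : CochainOfDegree 0 t) :
    CochainOfDegree 1 (gauge f t) := by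
  have h : ∀ n, CochainOfDegree 1 ((GradedQuiver.gaugeMap f t)^[n] f) := by
    intro n
    induction n with
    | zero => exact hf
    | succ n ih => rw [Function.iterate_succ_apply']; exact hf.gaugeMap ht ih
  constructor
  · intro W X Y Z l r
    have := (h (l.length + (r.length + 1))).linear l r
    simpa only [GradedQuiver.gauge, Chain.length_append, Chain.length_cons] using this
  · intro X Y c d hc
    exact (h c.length).degree c d hc

theorem gauge_nil (hf : ∀ X, f X X Chain.nil = 0) (X : A.Obj) : gauge f t X X Chain.nil = 0 := hf X

/-- The transformation of a functor to its gauge transform is closed. -/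
theorem relation_of_gauge {e : ∀ Y, B.Hom Y Y} (he : ∀ Y, B.IsStrictUnit (e Y))
    {g : Cochain A.toGradedQuiver B.toGradedQuiver o}
    (hf : ∀ X, f X X Chain.nil = 0) (hg : ∀ X, g X X Chain.nil = 0) :
    bd (ofCochain (t - unitCochain A.toGradedQuiver o e)) + beta ((post (ofCochain g)).hat *
      (ofCochain (t - unitCochain A.toGradedQuiver o e) * (ofCochain f).hat)) =
      ofCochain (gaugeMap f t g) - ofCochain g := by
  have h1 : bd (eps A.toGradedQuiver o e) = 0 := by
    refine ext fun X Y c => ?_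
    rw [bd_apply, AInfCat.bsum, Conv.zero_apply]
    refine Chain.spl_eq_zero _ fun _ l r _ => Chain.spl_eq_zero _ fun _ _ _ _ => ?_
    split_ifs
    · rfl
    · exact eps_of_length e (by simp)
  -- The unit part contributes `post (post g) - f = g - f`, which is subtracted from the terms in
  -- `t`.
  rw [map_sub, map_sub, ← eps, h1, sub_mul, mul_sub, map_sub,
    beta_hat_eps_hat he (isLetter_ofCochain f) (pos_ofCochain hf) (isLetter_ofCochain g).post
    (pos_ofCochain hg).post, post_post, ofCochain_gaugeMap]
  abel

theorem unitCochain_degree {e : ∀ Y, B.Hom Y Y} (he : ∀ Y, B.IsStrictUnit (e Y)) :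
    CochainOfDegree 0 (unitCochain A.toGradedQuiver o e) where
  linear {W X Y Z} l r := by
    have : ∀ f : A.Hom X Y, unitCochain A.toGradedQuiver o e W Z (l.append (Chain.cons f r)) = 0 :=
      fun f => by cases l <;> rfl
    simp only [this]
    exact (0 : _ →ₗ[K] _).isLinear
  degree c d hc := by
    cases hc with
    | nil => exact (he _).mem
    | cons hf hc => exact zero_mem _

/-- In the lowest length where `r` is nonzero, only the term with `P` and `P'` on empty sequences
survives. It is multiplication of `r` by minus a unit, hence injective in `r`. -/
theorem eq_zero_of_beta {e : ∀ Y, B.Hom Y Y} (he : ∀ Y, B.IsStrictUnit (e Y))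
    {P P' r : Conv A.toGradedQuiver B.toGradedQuiver o} (hr : IsLetter r)
    (hP : ∀ X, P X X Chain.nil = B.tmk Chain.nil) (hP' : ∀ X, P' X X Chain.nil = -tone (e (o X)))
    (h : beta (P * (post r * P')) = 0) : r = 0 := by
  obtain ⟨f, rfl⟩ := hr
  have key : ∀ n X Y (c : Chain A.Hom X Y), c.length ≤ n → ofCochain f X Y c = 0 := by
    intro n
    induction n using Nat.strong_induction_on with
    | _ n ih =>
      intro X Y c hc
      have h0 : ∀ X Y (c' : Chain A.Hom X Y), c'.length < c.length → ofCochain f X Y c' = 0 :=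
        fun X Y c' hc' => ih c'.length (by omega) X Y c' le_rfl
      have h1 : ∀ X Y (c' : Chain A.Hom X Y), c'.length < c.length →
          (post (ofCochain f) * P') X Y c' = 0 := by
        intro X Y c' hc'
        rw [mul_apply]
        refine (Chain.spl_congr' c' fun W l r hl => ?_).trans (Chain.spl_zero c')
        rw [post_apply, h0 _ _ l (by omega), map_zero, map_zero, LinearMap.zero_apply]
      -- Any other splitting gives `r` fewer entries than `c` has, and vanishes by induction.
      have h2 : (P * (post (ofCochain f) * P')) X Y c = -tmul (tone (B.sg 1 (f X Y c)))
          (tone (e (o X))) := by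
        rw [mul_apply, Chain.spl_eq_left, hP, nil_tmul, mul_apply, Chain.spl_eq_right, hP', map_neg,
          post_apply, ofCochain_apply, tsg_tone]
        · intro W l r hl hr
          rw [post_apply, h0 _ _ l (by omega), map_zero, map_zero, LinearMap.zero_apply]
        · intro W l r hl hl'
          rw [h1 _ _ r (by omega), map_zero]
      have h3 := congrFun (congrFun (congrFun h X) Y) c
      rw [beta_apply, h2, map_neg, bT_tone_strictUnit (he _), sg_one_one, map_neg] at h3
      exact neg_eq_zero.1 h3
  exact ext fun X Y c => key _ X Y c le_rfl

/-- The gauge transform of a functor is a functor, and it comes with a closed transformation. -/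
theorem IsFunctorCochain.gauge {e : ∀ Y, B.Hom Y Y} (he : ∀ Y, B.IsStrictUnit (e Y))
    (hf : IsFunctorCochain f) (ht : CochainOfDegree 0 t) (ht₀ : ∀ X, t X X Chain.nil = 0) :
    IsFunctorCochain (gauge f t) ∧
      IsTransCochain e f (gauge f t) (t - unitCochain A.toGradedQuiver o e) := by
  have hg := hf.degree.gauge ht
  have hg₀ : ∀ X, GradedQuiver.gauge f t X X Chain.nil = 0 := gauge_nil hf.nil
  have hτ : IsTransCochain e f (GradedQuiver.gauge f t) (t - unitCochain A.toGradedQuiver o e) := by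
    refine ⟨ht.sub (unitCochain_degree he), fun X => ?_, ?_⟩
    · exact (congrArg (· - e (o X)) (ht₀ X)).trans (zero_sub _)
    · rw [relation_of_gauge he hf.nil hg₀, gaugeMap_gauge hf.nil ht₀, sub_self]
  refine ⟨⟨hg, hg₀, ?_⟩, hτ⟩
  have h := gauge_bianchi hf.isFunctor (isLetter_ofCochain _) (pos_ofCochain hg₀) (CochainOfDegree.even hg) hτ.isTrans
  rw [← sub_eq_zero]
  refine eq_zero_of_beta he ?_ (hat_nil _) (fun X => ?_) h
  · rw [beta_eq, bd_ofCochain, ← map_sub]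
    exact isLetter_ofCochain _
  · rw [mul_apply, Chain.spl_nil, hat_nil, nil_tmul, mul_apply, Chain.spl_nil, hat_nil, tmul_nil,
      ofCochain_apply, hτ.nil, map_neg]

/-- The composition of two closed transformations. -/
def transComp (f g h τ τ' : Cochain A.toGradedQuiver B.toGradedQuiver o) :
    Cochain A.toGradedQuiver B.toGradedQuiver o :=
  -bc ((ofCochain h).hat * (post (ofCochain τ') * ((post (ofCochain g)).hat *
    (ofCochain τ * (ofCochain f).hat))))

theorem IsTransCochain.comp {e : ∀ Y, B.Hom Y Y} (he : ∀ Y, B.IsStrictUnit (e Y))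
    {f g h τ τ' : Cochain A.toGradedQuiver B.toGradedQuiver o} (hf : IsFunctorCochain f)
    (hg : IsFunctorCochain g) (hh : IsFunctorCochain h) (hτ : IsTransCochain e f g τ)
    (hτ' : IsTransCochain e g h τ') : IsTransCochain e f h (transComp f g h τ τ') := by
  have key := IsTrans.comp hf.isFunctor hg.isFunctor hh.isFunctor hτ.isTrans hτ'.isTrans
  refine ⟨?_, fun X => ?_, ?_⟩
  · exact ((hh.degree.ofCochain.hat.mul (hτ'.degree.ofCochain.post.mul
      (hg.degree.ofCochain.post.hat.mul (hτ.degree.ofCochain.mul hf.degree.ofCochain.hat)))).bc).neg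
  · change -bT B _ = _
    rw [mul_apply, Chain.spl_nil, hat_nil, nil_tmul, mul_apply, Chain.spl_nil, mul_apply,
      Chain.spl_nil, hat_nil, nil_tmul, mul_apply, Chain.spl_nil, hat_nil, tmul_nil, post_apply,
      ofCochain_apply, ofCochain_apply, hτ.nil, hτ'.nil]
    -- The shifted sign turns `-e` into `e` in the left factor, and `b (e ⊗ -e) = e`; the sign in
    -- `transComp` restores the normalization `-e`.
    rw [tsg_tone, map_neg, sg_strictUnit (he _), Int.negOnePow_one, Units.neg_smul, one_smul,
      neg_neg, map_neg, map_neg, map_neg, neg_neg,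
      bT_strictUnit_tone (he _)]
  · rw [transComp, map_neg, ← beta_eq, map_neg, neg_mul, mul_neg, map_neg, ← neg_add,
      key.2, neg_zero]

end Gauge
end GradedQuiver
end AInf

/-! ### Sequences which contain a strict unit. -/

namespace AInf

theorem Chain.spl_ite_length {O : Type*} {H : O → O → Type*} {M : Type*} [AddCommMonoid M] {X Y : O}
    (r : Chain H X Y) : ∀ {Z : O} (l : Chain H Y Z) (g : ∀ W, Chain H W Z → Chain H X W → M),
      ((l.append r).spl fun W a b => if a.length = l.length then g W a b else 0) = g Y l r
  | _, nil, g => by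
    rw [nil_append, spl_length_zero_left]
    · simp
    · intro W a b h; simp [h]
  | _, cons x l, g => by
    rw [cons_append, spl_cons, length_cons, length_nil, if_neg (by simp), zero_add]
    simpa using spl_ite_length r l fun W a b => g W (cons x a) b

namespace AInfCat

variable {K : Type w} [CommRing K] {A : AInfCat.{w, u, v} K}

theorem bsum_neg {M : Type*} [AddCommGroup M] {X Z : A.Obj} (φ : Chain A.Hom X Z → M)
    (c : Chain A.Hom X Z) : A.bsum (fun c => -φ c) c = -A.bsum φ c := by
  rw [eq_neg_iff_add_eq_zero, ← bsum_add, bsum_eq_zero]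
  exact fun c' _ => neg_add_cancel (φ c')

theorem b_strictUnit {X : A.Obj} {e : A.Hom X X} (he : A.IsStrictUnit e) :
    A.b (Chain.cons e Chain.nil) = 0 :=
  GradedQuiver.b_strictUnit_of_length he Chain.nil Chain.nil (by simp)

/-- Among the operations which contain the unit, only those multiplying it with its left or its
right neighbour are nonzero. Both delete the unit, with opposite signs, so they cancel unless the
unit is at an end. -/
theorem bsum_strictUnit_aux {M : Type*} [AddCommGroup M] [Module K M] {X Y : A.Obj} {e : A.Hom Y Y}
    (he : A.IsStrictUnit e) (r : Chain A.Hom X Y) : ∀ {Z : A.Obj} {φ : Chain A.Hom X Z → M},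
      GradedQuiver.Multilin φ → ∀ l : Chain A.Hom Y Z,
      (l.spl fun _ l₁ l₂ => r.spl fun _ r₁ r₂ =>
        φ ((A.sgc 1 l₁).append (Chain.cons (A.b (l₂.append (Chain.cons e r₁))) r₂))) =
      (if l.length = 0 then 0 else φ ((A.sgc 1 l).append r)) -
        if r.length = 0 then 0 else φ ((A.sgc 1 l).append r)
  | _, φ, hφ, Chain.nil => by
    cases r with
    | nil =>
      have := hφ.map_zero Chain.nil Chain.nil
      simpa [b_strictUnit he] using this
    | cons y r =>
      have h0 := hφ.map_zero Chain.nil (Chain.cons y r)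
      have h1 := fun k : ℤ => hφ.map_unit_smul k y r
      have h2 := h1 1
      simp only [Int.negOnePow_one, Units.neg_smul, one_smul] at h2
      simp only [Chain.spl_nil, Chain.nil_append, GradedQuiver.sgc_nil, Chain.spl_cons,
        Chain.length_nil, if_true, Chain.length_cons, Nat.add_eq_zero_iff, one_ne_zero, and_false,
        if_false]
      rw [b_strictUnit he, Chain.spl_length_zero_left, GradedQuiver.b_strictUnit_left he, h2]
      · simpa using h0
      · intro W a b ha
        have := GradedQuiver.b_strictUnit_of_length he Chain.nil (Chain.cons y a) (by simp [ha])
        rw [Chain.nil_append] at this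
        rw [this]
        exact hφ.map_zero Chain.nil b
  | _, φ, hφ, Chain.cons x l => by
    have ih := bsum_strictUnit_aux he r (hφ.cons (A.sg 1 x)) l
    rw [Chain.spl_cons]
    simp only [GradedQuiver.sgc_cons, GradedQuiver.sgc_nil, Chain.cons_append, Chain.nil_append]
    rw [ih]
    cases l with
    | nil =>
      rw [Chain.spl_length_zero_left]
      · simp only [Chain.nil_append, GradedQuiver.sgc_nil, Chain.length_nil, Chain.length_cons]
        rw [GradedQuiver.b_strictUnit_right he]
        simp [sub_eq_add_neg]
      · intro W a b ha
        have := GradedQuiver.b_strictUnit_of_length he (Chain.cons x Chain.nil) a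
          (by simp [ha])
        rw [Chain.cons_append] at this
        rw [this]
        exact hφ.map_zero Chain.nil b
    | cons x' l =>
      rw [Chain.spl_eq_zero]
      · simp
      · intro W a b _
        have := GradedQuiver.b_strictUnit_of_length he (Chain.cons x (Chain.cons x' l)) a
          (by simp; omega)
        rw [Chain.cons_append] at this
        rw [this]
        exact hφ.map_zero Chain.nil b

/-- The coderivation on sequences which contain a strict unit. -/
theorem bsum_strictUnit {M : Type*} [AddCommGroup M] [Module K M] {X Y Z : A.Obj} {e : A.Hom Y Y}
    (he : A.IsStrictUnit e) {φ : Chain A.Hom X Z → M} (hφ : GradedQuiver.Multilin φ)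
    (l : Chain A.Hom Y Z) (r : Chain A.Hom X Y) :
    A.bsum φ (l.append (Chain.cons e r)) = A.bsum (fun c => φ (c.append (Chain.cons e r))) l -
      A.bsum (fun c => φ ((A.sgc 1 l).append (Chain.cons e c))) r +
      ((if l.length = 0 then 0 else φ ((A.sgc 1 l).append r)) -
        if r.length = 0 then 0 else φ ((A.sgc 1 l).append r)) := by
  rw [← bsum_strictUnit_aux he r hφ l, bsum, Chain.spl_append_cons]
  have h1 : (r.spl fun V r₁ r₂ => r₂.spl fun W m r => if m.length = 0 then 0 else
      φ ((A.sgc 1 (l.append (Chain.cons e r₁))).append (Chain.cons (A.b m) r))) =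
      -A.bsum (fun c => φ ((A.sgc 1 l).append (Chain.cons e c))) r := by
    rw [eq_neg_iff_add_eq_zero, bsum, ← Chain.spl_add]
    refine Chain.spl_eq_zero _ fun V r₁ r₂ _ => ?_
    rw [← Chain.spl_add]
    refine Chain.spl_eq_zero _ fun W m r _ => ?_
    split_ifs
    · exact add_zero 0
    · have := (hφ.append_left (A.sgc 1 l)).map_unit_smul 1 e
        ((A.sgc 1 r₁).append (Chain.cons (A.b m) r))
      simp only [GradedQuiver.sgc_append, GradedQuiver.sgc_cons, Chain.append_assoc,
        Chain.cons_append, GradedQuiver.sg_strictUnit he]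
      rw [this]
      simp
  rw [h1]
  simp only [Chain.spl_append_cons, Chain.spl_add]
  have h2 : ∀ {V W : A.Obj} (l : Chain A.Hom Y V) (r : Chain A.Hom W Y),
    (l.append (Chain.cons e r)).length ≠ 0 := fun l r => by simp
  simp only [h2, if_false]
  simp only [bsum, Chain.append_assoc, Chain.cons_append]
  abel

end AInfCat

namespace GradedQuiver

variable {K : Type w} [CommRing K] {A : AInfCat.{w, u, v} K} {B : AInfCat.{w, u', v'} K}
  {o : A.Obj → B.Obj}

namespace Conv

theorem unitCochain_of_length {Q : GradedQuiver.{w, u, v} K} {o : Q.Obj → B.Obj}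
    (e : ∀ Y, B.Hom Y Y) {X Y : Q.Obj} {c : Chain Q.Hom X Y} (h : c.length ≠ 0) :
    unitCochain Q o e X Y c = 0 := by
  cases c with
  | nil => simp at h
  | cons f c => rfl

theorem mul_append_cons {Q : GradedQuiver.{w, u, v} K} {R : GradedQuiver.{w, u', v'} K}
    {o : Q.Obj → R.Obj} (P P' : Conv Q R o) {X Y Y' Z : Q.Obj} (l : Chain Q.Hom Y Z)
    (x : Q.Hom Y' Y) (r : Chain Q.Hom X Y') : (P * P') X Z (l.append (Chain.cons x r)) =
      (l.spl fun _ l₁ l₂ => tmul (P _ _ l₁) (P' _ _ (l₂.append (Chain.cons x r)))) +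
        r.spl fun _ r₁ r₂ => tmul (P _ _ (l.append (Chain.cons x r₁))) (P' _ _ r₂) :=
  Chain.spl_append_cons x r l _

theorem Pos.hat_apply {Q : GradedQuiver.{w, u, v} K} {R : GradedQuiver.{w, u', v'} K}
    {o : Q.Obj → R.Obj} {P : Conv Q R o} (hP : Pos P) {X Y : Q.Obj} {c : Chain Q.Hom X Y}
    (hc : c.length ≠ 0) : P.hat X Y c = (P * P.hat) X Y c := by
  conv_lhs => rw [hP.hat_eq, add_apply, one_apply_of_length hc, add_zero]

variable (eA : ∀ X, A.Hom X X) (eB : ∀ Y, B.Hom Y Y)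

/-- The leftmost block either ends inside `l`, where the hypothesis applies to what remains of `l`,
or it contains the unit. -/
theorem Pos.hat_append_cons {P : Conv A.toGradedQuiver B.toGradedQuiver o} (hP : Pos P)
    {X Y Z : A.Obj} (l : Chain A.Hom Y Z) (r : Chain A.Hom X Y)
    (h : ∀ W (l' : Chain A.Hom Y W), l'.length < l.length →
      P.hat X W (l'.append (Chain.cons (eA Y) r)) =
        tmul (P.hat _ _ l') (tmul (tone (eB (o Y))) (P.hat _ _ r))) :
    P.hat X Z (l.append (Chain.cons (eA Y) r)) =
      tmul ((P * P.hat) _ _ l) (tmul (tone (eB (o Y))) (P.hat _ _ r)) +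
        r.spl fun _ r₁ r₂ => tmul (P _ _ (l.append (Chain.cons (eA Y) r₁))) (P.hat _ _ r₂) := by
  rw [hP.hat_apply (by simp), mul_append_cons, mul_apply, spl_tmul]
  congr 1
  refine Chain.spl_congr' l fun W l₁ l₂ hl => ?_
  by_cases h0 : l₁.length = 0
  · rw [hP.apply l₁ h0]; simp
  · rw [h _ l₂ (by omega), tmul_assoc]

/-- If `P` is compatible with the units in question, a block which contains the unit contributes
only when it is the unit alone, so `P.hat` factors at the unit. -/
theorem Pos.hat_normal {P : Conv A.toGradedQuiver B.toGradedQuiver o} (hP : Pos P)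
    {X Y : A.Obj} (r : Chain A.Hom X Y) (n : ℕ)
    (h : ∀ W V (l' : Chain A.Hom Y W) (r' : Chain A.Hom V Y), l'.length ≤ n →
      r'.length ≤ r.length → P V W (l'.append (Chain.cons (eA Y) r')) =
        eps A.toGradedQuiver o eB V W (l'.append r')) :
    ∀ {Z : A.Obj} (l : Chain A.Hom Y Z), l.length ≤ n →
      P.hat X Z (l.append (Chain.cons (eA Y) r)) =
        tmul (P.hat _ _ l) (tmul (tone (eB (o Y))) (P.hat _ _ r)) := by
  have key : ∀ k ≤ n, ∀ {Z : A.Obj} (l : Chain A.Hom Y Z), l.length = k →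
      P.hat X Z (l.append (Chain.cons (eA Y) r)) =
        tmul (P.hat _ _ l) (tmul (tone (eB (o Y))) (P.hat _ _ r)) := by
    intro k
    induction k using Nat.strong_induction_on with
    | _ k ih =>
      intro hk Z l hl
      rw [hP.hat_append_cons eA eB l r fun W l' hl' => ih l'.length (by omega) (by omega) l' rfl]
      have h1 : (r.spl fun _ r₁ r₂ => tmul (P _ _ (l.append (Chain.cons (eA Y) r₁)))
          (P.hat _ _ r₂)) = r.spl fun _ r₁ r₂ =>
            tmul (eps A.toGradedQuiver o eB _ _ (l.append r₁)) (P.hat _ _ r₂) :=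
        Chain.spl_congr' r fun W r₁ r₂ hr => by rw [h _ _ l r₁ (by omega) (by omega)]
      rw [h1]
      cases l with
      | nil =>
        rw [hP.mul_left _ _, hat_nil, map_zero, LinearMap.zero_apply, zero_add, nil_tmul]
        exact eps_mul_apply P.hat r
      | cons x l =>
        rw [Chain.spl_eq_zero, add_zero, ← hP.hat_apply (by simp)]
        intro W r₁ r₂ _
        rw [eps_of_length eB (by simp), map_zero, LinearMap.zero_apply]
  exact fun {Z} l hl => key _ hl l rfl

end Conv
end GradedQuiver
end AInf

/-! ### Inserting units: the gauge parameter for one more position. -/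

namespace AInf
namespace GradedQuiver

variable {K : Type w} [CommRing K] {A : AInfCat.{w, u, v} K} {B : AInfCat.{w, u', v'} K}
  {o : A.Obj → B.Obj}

namespace Conv

section
variable {Q : GradedQuiver.{w, u, v} K} {o : Q.Obj → B.Obj} {e : ∀ Y, B.Hom Y Y}
  {F G H T : Conv Q B.toGradedQuiver o}

theorem beta_eps_hat (he : ∀ Y, B.IsStrictUnit (e Y)) (hF : IsLetter F) (hF₀ : Pos F) :
    beta (eps Q o e * F.hat) = -F := by
  have h : eps Q o e * F.hat = 1 * (eps Q o e * (F * F * F.hat)) + eps Q o e * F + eps Q o e := by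
    have h2 : F.hat = F * F * F.hat + F + 1 := by
      conv_lhs => rw [hF₀.hat_eq, hF₀.hat_eq]
      noncomm_ring
    conv_lhs => rw [h2]
    noncomm_ring
  rw [h, map_add, map_add,
    beta_eps_of_fil he le_rfl (fil_zero 1) ((hF.fil.mul hF.fil).mul (fil_zero F.hat)),
    beta_eps_mul he hF, beta_eps he, zero_add, add_zero]

theorem beta_eps_hat₂ (he : ∀ Y, B.IsStrictUnit (e Y)) (hF : IsLetter F) (hF₀ : Pos F)
    (hG : IsLetter G) (hG₀ : Pos G) (hT : IsLetter T) :
    beta (eps Q o e * (G.hat * (T * F.hat))) = -T := by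
  have h : eps Q o e * (G.hat * (T * F.hat)) = 1 * (eps Q o e * (G * G.hat * (T * F.hat))) +
      1 * (eps Q o e * (T * (F * F.hat))) + eps Q o e * T := by
    have h1 : G.hat * (T * F.hat) = G * G.hat * (T * F.hat) + (T * (F * F.hat) + T) := by
      conv_lhs => rw [hG₀.hat_eq, add_mul, one_mul]
      conv_lhs => enter [2]; rw [hF₀.hat_eq]
      noncomm_ring
    rw [h1]
    noncomm_ring
  rw [h, map_add, map_add, beta_eps_of_fil he le_rfl (fil_zero 1)
      ((hG.fil.mul (fil_zero G.hat)).mul (hT.fil.mul (fil_zero F.hat))),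
    beta_eps_of_fil he le_rfl (fil_zero 1) (hT.fil.mul (hF.fil.mul (fil_zero F.hat))),
    beta_eps_mul he hT, zero_add, zero_add]

/-- Composition with the identity transformation: beside the unit and `T` there is no room for
another letter. -/
theorem beta_hat_eps_hat₂ (he : ∀ Y, B.IsStrictUnit (e Y)) (hF : IsLetter F) (hF₀ : Pos F)
    (hG : IsLetter G) (hG₀ : Pos G) (hH : IsLetter H) (hH₀ : Pos H) (hT : IsLetter T) :
    beta (H.hat * (eps Q o e * (G.hat * (T * F.hat)))) = -T := by
  have h : H.hat * (eps Q o e * (G.hat * (T * F.hat))) =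
      H * H.hat * (eps Q o e * (G.hat * (T * F.hat))) + eps Q o e * (G.hat * (T * F.hat)) := by
    conv_lhs => rw [hH₀.hat_eq, add_mul, one_mul]
  rw [h, map_add, beta_eps_hat₂ he hF hF₀ hG hG₀ hT, beta_eps_of_fil he le_rfl
    (hH.fil.mul (fil_zero H.hat)) ((fil_zero G.hat).mul (hT.fil.mul (fil_zero F.hat))), zero_add]

end

end Conv

open Conv

section Stage

variable (eA : ∀ X, A.Hom X X) (eB : ∀ Y, B.Hom Y Y)

/-- Compatibility with units, for units among the last `n` arguments. -/
def NormalTo (n : ℕ) (f : Cochain A.toGradedQuiver B.toGradedQuiver o) : Prop :=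
  ∀ ⦃X Y Z : A.Obj⦄ (l : Chain A.Hom Y Z) (r : Chain A.Hom X Y),
    l.length < n ∨ l.length + r.length = 0 →
      f X Z (l.append (Chain.cons (eA Y) r)) =
        unitCochain A.toGradedQuiver o eB X Z (l.append r)

/-- The transformation which serves to make a functor compatible with units at one more position. -/
def stage (n : ℕ) (f : Cochain A.toGradedQuiver B.toGradedQuiver o) :
    Cochain A.toGradedQuiver B.toGradedQuiver o := fun X Y c =>
  if c.length = 0 then 0 else
    -c.spl fun W l r => if l.length = n then f X Y ((A.sgc 1 l).append (Chain.cons (eA W) r)) else 0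

variable {eA eB} {n : ℕ} {f : Cochain A.toGradedQuiver B.toGradedQuiver o}

theorem stage_nil (X : A.Obj) : stage eA n f X X Chain.nil = 0 := rfl

theorem stage_of_lt {X Y : A.Obj} {c : Chain A.Hom X Y} (h : c.length < n) :
    stage eA n f X Y c = 0 := by
  rw [stage, Chain.spl_congr' c (g' := fun _ _ _ => 0), Chain.spl_zero]
  · simp
  · intro W l r hl
    rw [if_neg (by omega)]

theorem stage_append {X Y Z : A.Obj} {l : Chain A.Hom Y Z} {r : Chain A.Hom X Y}
    (hl : l.length = n) (h : l.length + r.length ≠ 0) : stage eA n f X Z (l.append r) =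
      -f X Z ((A.sgc 1 l).append (Chain.cons (eA Y) r)) := by
  subst hl
  rw [stage, if_neg (by simpa using h)]
  exact congrArg Neg.neg (Chain.spl_ite_length r l fun W a b =>
    f X Z ((A.sgc 1 a).append (Chain.cons (eA W) b)))

theorem map_append_sg_strictUnit {M : Type*} [AddCommGroup M] [Module K M] {X Y Z : A.Obj}
    {φ : Chain A.Hom X Z → M} (hφ : Multilin φ) {e : A.Hom Y Y} (he : A.IsStrictUnit e)
    (l : Chain A.Hom Y Z) (r : Chain A.Hom X Y) :
    φ (l.append (Chain.cons (A.sg 1 e) r)) = -φ (l.append (Chain.cons e r)) := by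
  rw [sg_strictUnit he, (hφ.append_left l).map_unit_smul]
  simp

/-- If `l` has length `n`, the new unit is inserted just before the old one. If `l` is shorter, the
new unit goes further right, but the old one is still among the first `n` arguments of `f`; both
sides vanish. -/
theorem stage_append_cons (heA : ∀ X, A.IsStrictUnit (eA X)) (hf : CochainOfDegree 1 f)
    (hn : NormalTo eA eB n f) {X Y Z : A.Obj} {l : Chain A.Hom Y Z} (r : Chain A.Hom X Y)
    (hl : l.length ≤ n) : stage eA n f X Z (l.append (Chain.cons (eA Y) r)) =
      -f X Z ((A.sgc 1 l).append (Chain.cons (eA Y) (Chain.cons (eA Y) r))) := by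
  rcases hl.eq_or_lt with hl | hl
  · exact stage_append hl (by simp)
  · rw [hn (A.sgc 1 l) (Chain.cons (eA Y) r) (Or.inl (by simpa using hl)),
      unitCochain_of_length _ (by simp), neg_zero, stage, if_neg (by simp), Chain.spl_append_cons,
      Chain.spl_congr' l (g' := fun _ _ _ => 0), Chain.spl_zero, zero_add, Chain.spl_eq_zero,
      neg_zero]
    · intro W r₁ r₂ _
      rw [sgc_append, sgc_cons, Chain.append_assoc, Chain.cons_append,
        map_append_sg_strictUnit hf.multilin (heA Y), hn _ _ (Or.inl (by simpa using hl)),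
        unitCochain_of_length _ (by simp), neg_zero, ite_self]
    · intro W l₁ l₂ h
      rw [if_neg (by omega)]

theorem stage_degree (heA : ∀ X, A.IsStrictUnit (eA X)) (hf : CochainOfDegree 1 f) :
    CochainOfDegree 0 (stage eA n f) where
  linear {X' X Y Y'} l r := by
    have h1 : Multilin fun c : Chain A.Hom X' Y' => -c.spl fun W l r =>
        if l.length = n then f X' Y' ((A.sgc 1 l).append (Chain.cons (eA W) r)) else 0 := by
      refine (Multilin.spl (fun W r V V' l₁ l₂ => ?_) fun W l V V' r₁ r₂ => ?_).neg
      · simp only [Chain.length_append, Chain.length_cons]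
        split_ifs
        · exact (hf.multilin.append_right (Chain.cons (eA W) r)).sgc 1 l₁ l₂
        · exact (0 : _ →ₗ[K] _).isLinear
      · split_ifs
        · exact (hf.multilin.append_left (A.sgc 1 l)).cons (eA W) r₁ r₂
        · exact (0 : _ →ₗ[K] _).isLinear
    have h2 : ∀ x : A.Hom X Y, (l.append (Chain.cons x r)).length ≠ 0 := by simp
    simp only [stage, h2, if_false]
    exact h1 l r
  degree c d hc := by
    rw [stage]
    split_ifs
    · exact zero_mem _
    · refine neg_mem (Chain.spl_mem _ c fun W l r e => ?_)
      split_ifs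
      · obtain ⟨d₁, d₂, h₁, h₂, rfl⟩ := HasDegree.of_append (e ▸ hc)
        have := hf.degree _ _ ((h₁.sgc 1).append (.cons (heA W).mem h₂))
        rw [← e]
        simp only [Chain.length_append, Chain.length_cons, length_sgc] at this ⊢
        convert this using 1
        push_cast
        congr 1
        ring
      · exact zero_mem _

end Stage
end GradedQuiver
end AInf

/-! ### The inductive step of the normalization. -/

namespace AInf
namespace GradedQuiver

variable {K : Type w} [CommRing K] {A : AInfCat.{w, u, v} K} {B : AInfCat.{w, u', v'} K}
  {o : A.Obj → B.Obj}

open Conv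

section Stage

variable {eA : ∀ X, A.Hom X X} {eB : ∀ Y, B.Hom Y Y} {n : ℕ}
  {f g t : Cochain A.toGradedQuiver B.toGradedQuiver o}

theorem bdc_append_strictUnit {p : ℤ} (heA : ∀ X, A.IsStrictUnit (eA X)) (ht : CochainOfDegree p t)
    {X Y Z : A.Obj} (l : Chain A.Hom Y Z) (r : Chain A.Hom X Y) :
    bdc t X Z (l.append (Chain.cons (eA Y) r)) =
      A.bsum (fun c => t X Z (c.append (Chain.cons (eA Y) r))) l -
      A.bsum (fun c => t X Z ((A.sgc 1 l).append (Chain.cons (eA Y) c))) r +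
      ((if l.length = 0 then 0 else t X Z ((A.sgc 1 l).append r)) -
        if r.length = 0 then 0 else t X Z ((A.sgc 1 l).append r)) :=
  A.bsum_strictUnit (heA Y) ht.multilin l r

/-- The formula for a single unit is applied at the left unit, whose right neighbour is the other
unit, and then at the right unit. The unconditional last term is the product of the left unit with
its right neighbour. -/
theorem bdc_append_strictUnit₂ (heA : ∀ X, A.IsStrictUnit (eA X)) (hf : CochainOfDegree 1 f)
    {X Y Z : A.Obj} (l : Chain A.Hom Y Z) (r : Chain A.Hom X Y) :
    bdc f X Z ((A.sgc 1 l).append (Chain.cons (eA Y) (Chain.cons (eA Y) r))) =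
      A.bsum (fun c => -f X Z ((A.sgc 1 c).append (Chain.cons (eA Y) (Chain.cons (eA Y) r)))) l +
      A.bsum (fun c => f X Z (l.append (Chain.cons (eA Y) (Chain.cons (eA Y) c)))) r +
      (if r.length = 0 then 0 else f X Z (l.append (Chain.cons (eA Y) r))) +
      (if l.length = 0 then 0 else f X Z (l.append (Chain.cons (eA Y) r))) -
      f X Z (l.append (Chain.cons (eA Y) r)) := by
  have hm : Multilin (f X Z) := hf.multilin
  rw [bdc_append_strictUnit heA hf, A.bsum_sgc (hm.append_right _)]
  have h := A.bsum_strictUnit (heA Y) ((hm.append_left l).cons (eA Y)) Chain.nil r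
  simp only [Chain.nil_append, sgc_nil, Chain.length_nil, if_true] at h
  simp only [sgc_one_one, length_sgc, Chain.length_cons, Nat.add_eq_zero_iff, one_ne_zero,
    and_false, if_false]
  rw [h]
  simp only [AInfCat.bsum, Chain.spl_nil, Chain.length_nil, if_true]
  abel

/-- If the leftmost block ends inside `l`, the first unit becomes a strict unit of the target with
factors on both sides, which the operations kill. Hence the leftmost block contains `l` and the
first unit; it either stops there or contains the second unit as well. -/
theorem hat_append_strictUnit (heB : ∀ Y, B.IsStrictUnit (eB Y)) (hf₀ : ∀ X, f X X Chain.nil = 0)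
    (hn : NormalTo eA eB n f) {X Y Z : A.Obj} (l : Chain A.Hom Y Z) (r : Chain A.Hom X Y)
    (hl : l.length ≤ n) :
    bT B ((ofCochain f).hat X Z (l.append (Chain.cons (eA Y) (Chain.cons (eA Y) r)))) =
      bT B (tmul (tone (f _ _ (l.append (Chain.cons (eA Y) Chain.nil))))
        ((ofCochain f).hat _ _ (Chain.cons (eA Y) r))) +
      bT B (r.spl fun _ r₁ r₂ => tmul (tone (f _ _
        (l.append (Chain.cons (eA Y) (Chain.cons (eA Y) r₁))))) ((ofCochain f).hat _ _ r₂)) := by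
  have hp := pos_ofCochain hf₀
  rw [hp.hat_append_cons eA eB, map_add, Chain.spl_cons, map_add]
  · have h1 : bT B (tmul ((ofCochain f * (ofCochain f).hat) Y Z l) (tmul (tone (eB (o Y)))
        ((ofCochain f).hat X Y (Chain.cons (eA Y) r)))) = 0 := by
      rw [hp.hat_apply (c := Chain.cons (eA Y) r) (by simp)]
      exact bT_strictUnit (heB _) le_rfl (((isLetter_ofCochain f).fil.mul (fil_zero _)) _ _ _)
        (((isLetter_ofCochain f).fil.mul (fil_zero _)) _ _ _)
    rw [h1, zero_add]
    rfl
  · intro W l' hl'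
    refine hp.hat_normal eA eB _ l'.length (fun V V' l'' r' h _ => ?_) l' le_rfl
    rw [ofCochain_apply, hn l'' r' (Or.inl (by omega))]
    rfl

theorem IsFunctorCochain.bT_hat (hf : IsFunctorCochain f) {X Y : A.Obj} (c : Chain A.Hom X Y) :
    bT B ((ofCochain f).hat X Y c) = bdc f X Y c := by
  have h := hf.relation
  rw [beta_eq, bd_ofCochain] at h
  exact congrFun (congrFun (congrFun (ofCochain_injective h) X) Y) c

theorem gaugeMap_apply (g : Cochain A.toGradedQuiver B.toGradedQuiver o) {X Y : A.Obj}
    (c : Chain A.Hom X Y) : gaugeMap f t g X Y c = f X Y c + bdc t X Y c +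
      bT B (((post (ofCochain g)).hat * (ofCochain t * (ofCochain f).hat)) X Y c) := rfl

theorem bT_strictUnit_hat (heB : ∀ Y, B.IsStrictUnit (eB Y)) (hf₀ : ∀ X, f X X Chain.nil = 0)
    {X Y : A.Obj} (c : Chain A.Hom X Y) :
    bT B (tmul (tone (eB (o Y))) ((ofCochain f).hat X Y c)) = -f X Y c := by
  have h := congrFun (congrFun (congrFun (beta_eps_hat heB (isLetter_ofCochain f)
    (pos_ofCochain hf₀)) X) Y) c
  rw [beta_apply, eps_mul_apply, Conv.neg_apply, ofCochain_apply, ← map_neg] at h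
  exact tone_injective h

theorem bT_strictUnit_hat₂ (heB : ∀ Y, B.IsStrictUnit (eB Y)) (hf₀ : ∀ X, f X X Chain.nil = 0)
    (hg₀ : ∀ X, g X X Chain.nil = 0) {X Y : A.Obj} (c : Chain A.Hom X Y) :
    bT B (tmul (tone (eB (o Y))) (((post (ofCochain g)).hat *
      (ofCochain t * (ofCochain f).hat)) X Y c)) = -t X Y c := by
  have h := congrFun (congrFun (congrFun (beta_eps_hat₂ heB (isLetter_ofCochain f)
    (pos_ofCochain hf₀) (isLetter_ofCochain g).post (pos_ofCochain hg₀).post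
    (isLetter_ofCochain t)) X) Y) c
  rw [beta_apply, eps_mul_apply, Conv.neg_apply, ofCochain_apply, ← map_neg] at h
  exact tone_injective h

/-- The part of the gauge equation in which the unit is to the left of the transformation. -/
theorem bT_gauge_left (heB : ∀ Y, B.IsStrictUnit (eB Y)) (hf₀ : ∀ X, f X X Chain.nil = 0)
    (hg₀ : ∀ X, g X X Chain.nil = 0) (ht₀ : ∀ X, t X X Chain.nil = 0)
    {X Y Z : A.Obj} (l : Chain A.Hom Y Z) (r : Chain A.Hom X Y)
    (h : ∀ ⦃W V : A.Obj⦄ (l' : Chain A.Hom Y W) (r' : Chain A.Hom V Y), l'.length ≤ l.length →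
      r'.length < r.length → g V W (l'.append (Chain.cons (eA Y) r')) =
        unitCochain A.toGradedQuiver o eB V W (l'.append r')) :
    bT B (r.spl fun _ r₁ r₂ =>
        tmul ((post (ofCochain g)).hat _ _ (l.append (Chain.cons (eA Y) r₁)))
          ((ofCochain t * (ofCochain f).hat) _ _ r₂)) =
      if l.length = 0 then t X Z ((A.sgc 1 l).append r) else 0 := by
  have h1 : (r.spl fun _ r₁ r₂ =>
        tmul ((post (ofCochain g)).hat _ _ (l.append (Chain.cons (eA Y) r₁)))
          ((ofCochain t * (ofCochain f).hat) _ _ r₂)) =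
      tmul (-(post (ofCochain g)).hat _ _ l) (tmul (tone (eB (o Y)))
        (((post (ofCochain g)).hat * (ofCochain t * (ofCochain f).hat)) _ _ r)) := by
    rw [mul_apply, tmul_spl, tmul_spl]
    refine Chain.spl_congr' r fun W r₁ r₂ hr => ?_
    -- The transformation `t` needs an entry from `r₂`, so `g` only meets `r₁` shorter than `r`,
    -- where normality is given.
    by_cases h0 : r₂.length = 0
    · rw [((pos_ofCochain ht₀).mul_left _).apply r₂ h0]
      simp
    · have h2 := (pos_ofCochain hg₀).hat_normal eA eB r₁ l.length (fun V V' l' r' hl' hr' => by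
        rw [ofCochain_apply, h l' r' hl' (by omega)]; rfl) l le_rfl
      rw [← post_hat, post_apply, h2, tsg_tmul, tsg_tmul, tsg_tone, sg_strictUnit (heB _)]
      simp [tmul_assoc]
  rw [h1]
  cases l with
  | nil =>
    rw [hat_nil, map_neg, LinearMap.neg_apply, nil_tmul, map_neg,
      bT_strictUnit_hat₂ heB hf₀ hg₀, neg_neg]
    rfl
  | cons x l =>
    rw [if_neg (by simp), (pos_ofCochain hg₀).post.hat_apply (by simp)]
    refine bT_strictUnit (m := 1 + 0) (n := 0 + (1 + 0)) (heB _) le_rfl (neg_mem (((isLetter_ofCochain g).post.fil.mul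
      (fil_zero _)) _ _ _)) ?_
    exact ((fil_zero _).mul ((isLetter_ofCochain t).fil.mul (fil_zero _))) _ _ _

/-- The gauge equation is evaluated on `l ⊗ e ⊗ r`. At the new position, where `l` has length `n`,
the terms of `bd t` are values of `f` with two adjacent units. They are rewritten with the functor
equation of `f` on `σ l ⊗ e ⊗ e ⊗ r`, after which everything cancels except the required unit. -/
theorem normalTo_gauge (heA : ∀ X, A.IsStrictUnit (eA X)) (heB : ∀ Y, B.IsStrictUnit (eB Y))
    (hf : IsFunctorCochain f) (hn : NormalTo eA eB n f) :
    NormalTo eA eB (n + 1) (gauge f (stage eA n f)) := by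
  have hfe : ∀ X, f X X (Chain.cons (eA X) Chain.nil) = eB (o X) := fun X =>
    hn Chain.nil Chain.nil (Or.inr rfl)
  have ht₀ : ∀ X, stage eA n f X X Chain.nil = 0 := fun X => stage_nil X
  have ht := stage_degree (n := n) heA hf.degree
  have hg₀ : ∀ X, gauge f (stage eA n f) X X Chain.nil = 0 := gauge_nil hf.nil
  have hg := gaugeMap_gauge hf.nil ht₀
  have hs : ∀ {X Y Z : A.Obj} (c : Chain A.Hom Y Z) (r : Chain A.Hom X Y), c.length ≤ n →
      stage eA n f X Z (c.append (Chain.cons (eA Y) r)) =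
      -f X Z ((A.sgc 1 c).append (Chain.cons (eA Y) (Chain.cons (eA Y) r))) :=
    fun c r hc => stage_append_cons heA hf.degree hn r hc
  have hs' : ∀ {X Y Z : A.Obj} (c : Chain A.Hom Y Z) (r : Chain A.Hom X Y), c.length < n →
      stage eA n f X Z (c.append (Chain.cons (eA Y) r)) = 0 := fun {X Y Z} c r hc => by
    rw [hs c r hc.le, hn _ _ (Or.inl (by simpa using hc)), unitCochain_of_length _ (by simp),
      neg_zero]
  -- From here on only the fixed point equation and the vanishing on empty sequences are used.
  generalize hgg : gauge f (stage eA n f) = g at hg hg₀ ⊢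
  clear hgg
  have key : ∀ N ⦃X Y Z : A.Obj⦄ (l : Chain A.Hom Y Z) (r : Chain A.Hom X Y), r.length = N →
      l.length ≤ n → g X Z (l.append (Chain.cons (eA Y) r)) =
        unitCochain A.toGradedQuiver o eB X Z (l.append r) := by
    -- The induction is on the length of `r`: on the right hand side `g` is evaluated at a unit only
    -- with fewer entries after it.
    intro N
    induction N using Nat.strong_induction_on with
    | _ N ih =>
      intro X Y Z l r hr hl
      have hC := bT_gauge_left (t := stage eA n f) heB hf.nil hg₀ ht₀ l r
        fun W V l' r' hl' hr' => ih _ (by omega) l' r' rfl (by omega)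
      conv_lhs => rw [← hg]
      rw [gaugeMap_apply, mul_append_cons, map_add, hC, bdc_append_strictUnit heA ht]
      -- `S` is the part on the right of the transformation
      have hS : ∀ {W : A.Obj} (l' : Chain A.Hom Y W), l'.length < n →
          (ofCochain (stage eA n f) * (ofCochain f).hat) X W
            (l'.append (Chain.cons (eA Y) r)) = 0 := by
        intro W l' hl'
        rw [mul_append_cons, Chain.spl_congr' l' (g' := fun _ _ _ => 0), Chain.spl_zero, zero_add,
          Chain.spl_eq_zero]
        · intro V r₁ r₂ _
          rw [ofCochain_apply, hs' _ _ hl', map_zero, map_zero, LinearMap.zero_apply]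
        · intro V l₁ l₂ h
          rw [ofCochain_apply, stage_of_lt (by omega), map_zero, map_zero, LinearMap.zero_apply]
      rcases hl.eq_or_lt with hl | hl
      · have h1 : A.bsum (fun c => stage eA n f X Z (c.append (Chain.cons (eA Y) r))) l =
            A.bsum (fun c => -f X Z ((A.sgc 1 c).append
              (Chain.cons (eA Y) (Chain.cons (eA Y) r)))) l :=
          A.bsum_congr l fun c hc => hs c r (by omega)
        have h2 : A.bsum (fun c => stage eA n f X Z ((A.sgc 1 l).append (Chain.cons (eA Y) c))) r =
            -A.bsum (fun c => f X Z (l.append (Chain.cons (eA Y) (Chain.cons (eA Y) c)))) r := by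
          rw [← A.bsum_neg]
          refine A.bsum_congr r fun c _ => ?_
          rw [hs _ _ (by simpa using hl.le), sgc_one_one]
        -- The functor equation of `f` on `σ l ⊗ e ⊗ e ⊗ r`, solved for the two sums which make up
        -- `bd t` on `l ⊗ e ⊗ r`.
        have h3 := hat_append_strictUnit (eA := eA) heB hf.nil hn (A.sgc 1 l) r (by simpa using hl.le)
        rw [hf.bT_hat, bdc_append_strictUnit₂ heA hf.degree, add_sub_assoc, add_assoc,
          ← eq_sub_iff_add_eq] at h3
        have h4 : (ofCochain (stage eA n f) * (ofCochain f).hat) X Z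
            (l.append (Chain.cons (eA Y) r)) = tmul (tone (stage eA n f Y Z l))
              ((ofCochain f).hat X Y (Chain.cons (eA Y) r)) + tmul (-B.tmk Chain.nil)
                (r.spl fun _ r₁ r₂ => tmul (tone (f _ _ ((A.sgc 1 l).append
                  (Chain.cons (eA Y) (Chain.cons (eA Y) r₁))))) ((ofCochain f).hat _ _ r₂)) := by
          rw [mul_append_cons, tmul_spl]
          congr 1
          · rw [Chain.spl_congr' l (g' := fun W l₁ l₂ => if l₁.length = l.length then tmul
              (ofCochain (stage eA n f) _ _ l₁) ((ofCochain f).hat _ _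
                (l₂.append (Chain.cons (eA Y) r))) else 0)]
            · have := Chain.spl_ite_length Chain.nil l fun W l₁ l₂ => tmul
                (ofCochain (stage eA n f) _ _ l₁) ((ofCochain f).hat _ _
                  (l₂.append (Chain.cons (eA Y) r)))
              rw [Chain.append_nil] at this
              exact this
            · intro W l₁ l₂ h
              split_ifs with h'
              · rfl
              · rw [ofCochain_apply, stage_of_lt (by omega), map_zero, map_zero,
                  LinearMap.zero_apply]
          · refine Chain.spl_congr r fun W r₁ r₂ _ => ?_
            rw [ofCochain_apply, hs l r₁ hl.le]
            simp
        -- A factor `g` to the left of the transformation leaves it fewer than `n` entries before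
        -- the unit, where it vanishes.
        have h5 : (l.spl fun _ l₁ l₂ => tmul ((post (ofCochain g)).hat _ _ l₁)
            ((ofCochain (stage eA n f) * (ofCochain f).hat) _ _ (l₂.append (Chain.cons (eA Y) r)))) =
            (ofCochain (stage eA n f) * (ofCochain f).hat) X Z
              (l.append (Chain.cons (eA Y) r)) := by
          cases l with
          | nil => rw [Chain.spl_nil, hat_nil, nil_tmul]
          | cons x l =>
            rw [Chain.spl_cons, hat_nil, nil_tmul, Chain.spl_congr' l (g' := fun _ _ _ => 0),
              Chain.spl_zero, add_zero]
            intro W l₁ l₂ h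
            rw [hS l₂ (by rw [← hl, Chain.length_cons]; omega), map_zero]
        rw [h1, h2, sub_neg_eq_add, h3, h5, h4, map_add, map_neg, LinearMap.neg_apply, nil_tmul,
          map_neg]
        generalize bT B (r.spl fun _ r₁ r₂ => tmul (tone (f _ _ ((A.sgc 1 l).append
          (Chain.cons (eA Y) (Chain.cons (eA Y) r₁))))) ((ofCochain f).hat _ _ r₂)) = S
        -- For empty `l`, so `n = 0`, the term with `f (e)` is multiplication by a strict unit. For
        -- nonempty `l`, `f (σ l ⊗ e) = -t l`, and that term cancels the one in which the
        -- transformation takes exactly `l`.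
        cases l with
        | nil =>
          have h6 := bT_strictUnit_hat (f := f) heB hf.nil (Chain.cons (eA Y) r)
          simp only [sgc_nil, Chain.nil_append, hfe, h6, ht₀, map_zero, LinearMap.zero_apply,
            Chain.length_nil, if_true]
          cases r with
          | nil => simp [hfe, ht₀, unitCochain]
          | cons y r =>
            have h7 := stage_append (eA := eA) (f := f) (l := Chain.nil) (r := Chain.cons y r) hl
              (by simp)
            simp only [sgc_nil, Chain.nil_append] at h7
            rw [h7]
            simp [unitCochain]
        | cons x l =>
          have h6 := stage_append (eA := eA) (f := f) (l := Chain.cons x l) (r := Chain.nil) hl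
            (by simp)
          have h7 := stage_append (eA := eA) (f := f) (l := A.sgc 1 (Chain.cons x l)) (r := r)
            (by simpa using hl) (by simp)
          rw [Chain.append_nil] at h6
          rw [sgc_one_one] at h7
          rw [h6, h7, unitCochain_of_length _ (by simp)]
          simp only [Chain.length_cons, Nat.add_eq_zero_iff, one_ne_zero, and_false, if_false,
            map_neg, LinearMap.neg_apply]
          split_ifs <;> abel
      -- At the old positions `f` is already normal. Only the terms deleting the unit remain: they
      -- cancel each other if `l` and `r` are nonempty, cancel against `hC` if only `l` is empty,
      -- and vanish if `r` is empty.
      · rw [hn l r (Or.inl hl), A.bsum_eq_zero l fun c hc => hs' c r (by omega),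
          A.bsum_eq_zero r fun c _ => hs' _ c (by simpa using hl), Chain.spl_congr' l
            (g' := fun _ _ _ => 0) fun W l₁ l₂ h => by rw [hS l₂ (by omega), map_zero],
          Chain.spl_zero, map_zero]
        by_cases hr : r.length = 0
        · rw [stage_of_lt (by simp; omega)]
          simp
        · by_cases hl : l.length = 0 <;> simp [hr, hl]
  exact fun X Y Z l r h => key _ l r rfl (by omega)

end Stage
end GradedQuiver
end AInf

/-! ### Stationary sequences of functors and their limits. -/

namespace AInf
namespace GradedQuiver

variable {K : Type w} [CommRing K] {A : AInfCat.{w, u, v} K} {B : AInfCat.{w, u', v'} K}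
  {o : A.Obj → B.Obj}

open Conv

section Locality

variable {f g h t τ : Cochain A.toGradedQuiver B.toGradedQuiver o} {m : ℕ}

theorem agreeTo_gauge_self (hf : ∀ X, f X X Chain.nil = 0) (ht₀ : ∀ X, t X X Chain.nil = 0)
    (ht : AgreeTo m (ofCochain t) 0) : AgreeTo m (ofCochain (gauge f t)) (ofCochain f) := by
  rw [← gaugeMap_gauge hf ht₀, ofCochain_gaugeMap]
  have h1 := ((AgreeTo.refl m (ofCochain f)).add ht.bd).add (((AgreeTo.refl m
    (post (ofCochain (gauge f t))).hat).mul (ht.mul (AgreeTo.refl m (ofCochain f).hat))).beta)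
  simpa only [zero_mul, mul_zero, map_zero, add_zero] using h1

theorem post_eps {e : ∀ Y, B.Hom Y Y} (he : ∀ Y, B.IsStrictUnit (e Y)) :
    post (eps A.toGradedQuiver o e) = -eps A.toGradedQuiver o e := Conv.ext fun X Y c => by
  cases c with
  | nil =>
    rw [post_apply, Conv.neg_apply, eps_nil, tsg_tone, sg_strictUnit (he _)]
    simp
  | cons x c =>
    rw [post_apply, Conv.neg_apply, eps_of_length e (by simp), map_zero, neg_zero]

/-- In lengths up to `m` the second transformation is minus the unit, and composition with it is the
identity. Hence the composites along the tower stabilize with the functors. -/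
theorem agreeTo_transComp {e : ∀ Y, B.Hom Y Y} (he : ∀ Y, B.IsStrictUnit (e Y))
    (hf : ∀ X, f X X Chain.nil = 0) (hg : ∀ X, g X X Chain.nil = 0)
    (hh : ∀ X, h X X Chain.nil = 0) (ht : AgreeTo m (ofCochain t) 0) :
    AgreeTo m (ofCochain (transComp f g h τ (t - unitCochain A.toGradedQuiver o e)))
      (ofCochain τ) := by
  rw [transComp, map_neg, ← beta_eq, map_sub, map_sub, ← eps, post_eps he]
  have h1 := ((((AgreeTo.refl m (ofCochain h).hat).mul ((ht.post.add (AgreeTo.refl m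
    (eps A.toGradedQuiver o e))).mul (AgreeTo.refl m ((post (ofCochain g)).hat *
      (ofCochain τ * (ofCochain f).hat)))))).beta).neg
  rw [map_zero, zero_add, beta_hat_eps_hat₂ he (isLetter_ofCochain f) (pos_ofCochain hf)
    (isLetter_ofCochain g).post (pos_ofCochain hg).post (isLetter_ofCochain h) (pos_ofCochain hh)
    (isLetter_ofCochain τ), neg_neg] at h1
  rwa [sub_neg_eq_add]

end Locality

section Limit

variable {Q : GradedQuiver.{w, u, v} K} {R : GradedQuiver.{w, u', v'} K} {o : Q.Obj → R.Obj}

/-- The limit of a sequence of cochains which is stationary on sequences of bounded length. -/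
def Cochain.limit (F : ℕ → Cochain Q R o) : Cochain Q R o :=
  -- The gauge parameter of index `n` vanishes only in lengths below `n`, so length `m` is
  -- stationary from index `m + 1` on.
  fun X Y c => F (c.length + 1) X Y c

theorem CochainOfDegree.limit {p : ℤ} {F : ℕ → Cochain Q R o} (h : ∀ n, CochainOfDegree p (F n)) :
    CochainOfDegree p (Cochain.limit F) where
  linear l r := by
    have := (h (l.length + (r.length + 1) + 1)).linear l r
    simpa only [Cochain.limit, Chain.length_append, Chain.length_cons] using this
  degree c d hc := (h (c.length + 1)).degree c d hc

theorem agreeTo_limit {F : ℕ → Cochain Q R o}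
    (h : ∀ m n, m < n → AgreeTo m (ofCochain (F (n + 1))) (ofCochain (F n))) {m n : ℕ} (hmn : m < n) :
    AgreeTo m (ofCochain (Cochain.limit F)) (ofCochain (F n)) := fun X Y c hc => by
  have key : ∀ k, c.length + 1 ≤ k → ofCochain (F (c.length + 1)) X Y c = ofCochain (F k) X Y c := by
    intro k hk
    induction k, hk using Nat.le_induction with
    | base => rfl
    | succ k hk ih => rw [ih, h _ k hk X Y c le_rfl]
  exact key n (by omega)

end Limit

theorem IsFunctorCochain.limit {F : ℕ → Cochain A.toGradedQuiver B.toGradedQuiver o}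
    (hF : ∀ n, IsFunctorCochain (F n))
    (h : ∀ m n, m < n → AgreeTo m (ofCochain (F (n + 1))) (ofCochain (F n))) :
    IsFunctorCochain (Cochain.limit F) where
  degree := CochainOfDegree.limit fun n => (hF n).degree
  nil X := (hF 1).nil X
  relation := ext_agree fun n => by
    have h1 := agreeTo_limit h n.lt_succ_self
    refine h1.hat.beta.trans ?_
    rw [(hF _).relation]
    exact h1.symm.bd

theorem IsTransCochain.limit {e : ∀ Y, B.Hom Y Y} {f : Cochain A.toGradedQuiver B.toGradedQuiver o}
    {F T : ℕ → Cochain A.toGradedQuiver B.toGradedQuiver o}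
    (hT : ∀ n, IsTransCochain e f (F n) (T n))
    (h : ∀ m n, m < n → AgreeTo m (ofCochain (F (n + 1))) (ofCochain (F n)))
    (h' : ∀ m n, m < n → AgreeTo m (ofCochain (T (n + 1))) (ofCochain (T n))) :
    IsTransCochain e f (Cochain.limit F) (Cochain.limit T) where
  degree := CochainOfDegree.limit fun n => (hT n).degree
  nil X := (hT 1).nil X
  relation := ext_agree fun n => by
    have h1 := agreeTo_limit h n.lt_succ_self
    have h2 := agreeTo_limit h' n.lt_succ_self
    rw [← (hT (n + 1)).relation]
    exact h2.bd.add ((h1.post.hat.mul (h2.mul (AgreeTo.refl n _))).beta)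

section Tower

variable (eA : ∀ X, A.Hom X X) (eB : ∀ Y, B.Hom Y Y)

/-- Functors which are compatible with units at more and more positions. -/
def tower (f : Cochain A.toGradedQuiver B.toGradedQuiver o) :
    ℕ → Cochain A.toGradedQuiver B.toGradedQuiver o
  | 0 => f
  | n + 1 => gauge (tower f n) (stage eA n (tower f n))

/-- The transformations to the functors in the tower. -/
def towerTrans (f g τ : Cochain A.toGradedQuiver B.toGradedQuiver o) :
    ℕ → Cochain A.toGradedQuiver B.toGradedQuiver o
  | 0 => τ
  | n + 1 => transComp f (tower eA g n) (tower eA g (n + 1)) (towerTrans f g τ n)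
      (stage eA n (tower eA g n) - unitCochain A.toGradedQuiver o eB)

variable {eA eB} {f g τ : Cochain A.toGradedQuiver B.toGradedQuiver o}

theorem agreeTo_stage {m n : ℕ} (h : m < n) :
    AgreeTo m (ofCochain (stage eA n f)) 0 := fun X Y c hc => by
  rw [ofCochain_apply, stage_of_lt (by omega), map_zero, Conv.zero_apply]

theorem tower_spec (heA : ∀ X, A.IsStrictUnit (eA X)) (heB : ∀ Y, B.IsStrictUnit (eB Y))
    (hg : IsFunctorCochain g) (hn : NormalTo eA eB 0 g) (n : ℕ) :
    IsFunctorCochain (tower eA g n) ∧ NormalTo eA eB n (tower eA g n) := by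
  induction n with
  | zero => exact ⟨hg, hn⟩
  | succ n ih => exact ⟨(ih.1.gauge heB (stage_degree heA ih.1.degree) stage_nil).1,
      normalTo_gauge heA heB ih.1 ih.2⟩

theorem towerTrans_spec (heA : ∀ X, A.IsStrictUnit (eA X)) (heB : ∀ Y, B.IsStrictUnit (eB Y))
    (hf : IsFunctorCochain f) (hg : IsFunctorCochain g) (hn : NormalTo eA eB 0 g)
    (hτ : IsTransCochain eB f g τ) (n : ℕ) :
    IsTransCochain eB f (tower eA g n) (towerTrans eA eB f g τ n) := by
  induction n with
  | zero => exact hτ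
  | succ n ih =>
    have h := (tower_spec heA heB hg hn n).1
    exact ih.comp heB hf h (tower_spec heA heB hg hn (n + 1)).1
      (h.gauge heB (stage_degree heA h.degree) stage_nil).2

/-- A functor which preserves the units can be made compatible with all units. -/
theorem exists_normal (heA : ∀ X, A.IsStrictUnit (eA X)) (heB : ∀ Y, B.IsStrictUnit (eB Y))
    (hf : IsFunctorCochain f) (hg : IsFunctorCochain g) (hn : NormalTo eA eB 0 g)
    (hτ : IsTransCochain eB f g τ) :
    ∃ g' τ' : Cochain A.toGradedQuiver B.toGradedQuiver o, IsFunctorCochain g' ∧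
      (∀ n, NormalTo eA eB n g') ∧ IsTransCochain eB f g' τ' := by
  have h := tower_spec heA heB hg hn
  have h1 : ∀ m n, m < n → AgreeTo m (ofCochain (tower eA g (n + 1))) (ofCochain (tower eA g n)) :=
    fun m n hmn => agreeTo_gauge_self (h n).1.nil stage_nil (agreeTo_stage hmn)
  have h2 : ∀ m n, m < n → AgreeTo m (ofCochain (towerTrans eA eB f g τ (n + 1)))
      (ofCochain (towerTrans eA eB f g τ n)) := fun m n hmn =>
    agreeTo_transComp heB hf.nil (h n).1.nil (h (n + 1)).1.nil (agreeTo_stage hmn)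
  refine ⟨_, _, IsFunctorCochain.limit (fun n => (h n).1) h1, fun n X Y Z l r _ => ?_,
    IsTransCochain.limit (towerTrans_spec heA heB hf hg hn hτ) h1 h2⟩
  -- On this sequence the limit is the functor of index `l.length + r.length + 2`, which is normal
  -- at every position of the sequence.
  exact (h _).2 l r (Or.inl (by simp))

end Tower
end GradedQuiver
end AInf

/-! ### Cohomological units, split units and the correction in length one. -/

namespace AInf
namespace GradedQuiver

variable {K : Type w} [CommRing K]

section Projection

variable (Q : GradedQuiver.{w, u, v} K)

/-- The component of degree `k`. -/
def projTo (k : ℤ) (X Y : Q.Obj) : Q.Hom X Y →ₗ[K] Q.gr X Y k :=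
  letI := (Q.isInternal X Y).chooseDecomposition
  DirectSum.component K ℤ (fun i => Q.gr X Y i) k ∘ₗ
    (DirectSum.decomposeLinearEquiv (Q.gr X Y)).toLinearMap

variable {Q}

theorem projTo_of_mem {k : ℤ} {X Y : Q.Obj} {x : Q.Hom X Y} (hx : x ∈ Q.gr X Y k) :
    Q.projTo k X Y x = ⟨x, hx⟩ := by
  let _ := (Q.isInternal X Y).chooseDecomposition
  simp only [projTo, LinearMap.comp_apply, LinearEquiv.coe_coe,
    DirectSum.decomposeLinearEquiv_apply, DirectSum.decompose_of_mem _ hx]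
  exact DirectSum.component.lof_self K k _

theorem projTo_of_ne {k d : ℤ} (h : d ≠ k) {X Y : Q.Obj} {x : Q.Hom X Y} (hx : x ∈ Q.gr X Y d) :
    Q.projTo k X Y x = 0 := by
  let _ := (Q.isInternal X Y).chooseDecomposition
  simp only [projTo, LinearMap.comp_apply, LinearEquiv.coe_coe,
    DirectSum.decomposeLinearEquiv_apply, DirectSum.decompose_of_mem _ hx]
  exact (DirectSum.component.of K k d _).trans (dif_neg h)

end Projection

variable {A : AInfCat.{w, u, v} K} {B : AInfCat.{w, u', v'} K} {o : A.Obj → B.Obj}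

/-- The differential as a linear map. -/
theorem isLinearMap_d (X Y : B.Obj) : IsLinearMap K (B.d : B.Hom X Y → B.Hom X Y) :=
  B.isMultilinear.linear Chain.nil Chain.nil

theorem d_mem {X Y : B.Obj} {k : ℤ} {x : B.Hom X Y} (hx : x ∈ B.gr X Y k) :
    B.d x ∈ B.gr X Y (k + 1) := by
  have := B.isMultilinear.degree (Chain.single x) _ (.cons hx .nil)
  rw [show k + 0 + 2 - ((Chain.single x).length : ℤ) = k + 1 by simp [Chain.single]; ring] at this
  exact this

/-- A primitive need not be homogeneous, but the differential commutes with the projections to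
homogeneous components, so its component of degree `k` is again a primitive. -/
theorem exists_mem_of_cohomologous {X Y : B.Obj} {k : ℤ} {x y : B.Hom X Y} (h : B.Cohomologous x y)
    (hx : x ∈ B.gr X Y (k + 1)) (hy : y ∈ B.gr X Y (k + 1)) :
    ∃ z ∈ B.gr X Y k, x - y = B.d z := by
  obtain ⟨z, hz⟩ := h
  refine ⟨B.projTo k X Y z, (B.projTo k X Y z).2, ?_⟩
  have key : (B.gr X Y (k + 1)).subtype ∘ₗ B.projTo (k + 1) X Y ∘ₗ (isLinearMap_d X Y).mk' _ =
      (isLinearMap_d X Y).mk' _ ∘ₗ (B.gr X Y k).subtype ∘ₗ B.projTo k X Y := by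
    refine hom_ext fun d w hw => ?_
    simp only [LinearMap.comp_apply, IsLinearMap.mk'_apply]
    by_cases hd : d = k
    · subst hd
      rw [projTo_of_mem hw, projTo_of_mem (d_mem hw)]
      rfl
    · rw [projTo_of_ne hd hw, projTo_of_ne (by omega) (d_mem hw), map_zero, map_zero]
      exact (isLinearMap_d X Y).map_zero.symm
  have h := LinearMap.congr_fun key z
  simp only [LinearMap.comp_apply, IsLinearMap.mk'_apply, ← hz,
    projTo_of_mem (sub_mem hx hy)] at h
  exact h

theorem isCohUnit_of_isStrictUnit {X : A.Obj} {e : A.Hom X X} (he : A.IsStrictUnit e) :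
    A.IsCohUnit e where
  mem := he.mem
  closed := he.vanish Chain.nil Chain.nil (by simp)
  right f _ := ⟨0, by rw [he.right, sub_self]; exact (isLinearMap_d _ _).map_zero.symm⟩
  left f _ := ⟨0, by rw [he.left, sub_self]; exact (isLinearMap_d _ _).map_zero.symm⟩

/-- The product of `u` and `e` equals `u` because `e` is a strict unit, and is cohomologous to `e`
because `u` is a unit in cohomology. -/
theorem exists_homotopy_of_isCohUnit {X : B.Obj} {u e : B.Hom X X} (hu : B.IsCohUnit u)
    (he : B.IsStrictUnit e) : ∃ h ∈ B.gr X X (-1), u - e = B.d h := by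
  refine exists_mem_of_cohomologous (k := -1) ?_ hu.mem he.mem
  have := hu.left e (isCohUnit_of_isStrictUnit he).closed
  rwa [he.right] at this

/-- This is the only use of the splitting: it extends a value prescribed at the unit to a linear map
on all endomorphisms. -/
theorem exists_coord (hA : A.HasSplitUnits) {X : A.Obj} {e : A.Hom X X} (he : A.IsStrictUnit e) :
    ∃ ρ : A.Hom X X →ₗ[K] K, ρ e = 1 ∧ ∀ d ≠ 0, ∀ x ∈ A.gr X X d, ρ x = 0 := by
  obtain ⟨⟨φ⟩, r, hr⟩ := hA.2 X e he
  obtain ⟨b, hb⟩ := Submodule.mem_span_singleton.1 (φ 1).2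
  have he' : e ∈ Submodule.span K {e} := Submodule.mem_span_singleton_self e
  -- The isomorphism need not send `1` to `e`. With `φ 1 = b • e`, the factor `b` corrects this: `b
  -- • φ.symm e = φ.symm (b • e) = 1`.
  refine ⟨b • (φ.symm.toLinearMap ∘ₗ r ∘ₗ A.projTo 0 X X), ?_, fun d hd x hx => ?_⟩
  · have h1 : r (A.projTo 0 X X e) = ⟨e, he'⟩ := by
      rw [projTo_of_mem he.mem]
      exact LinearMap.congr_fun hr ⟨e, he'⟩
    have h2 : φ 1 = b • ⟨e, he'⟩ := Subtype.ext hb.symm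
    simp only [LinearMap.smul_apply, LinearMap.comp_apply, h1, LinearEquiv.coe_coe]
    rw [← map_smul, ← h2, LinearEquiv.symm_apply_apply]
  · simp [projTo_of_ne hd hx]

open Conv

/-- The cochain which is given on sequences of length one and vanishes on all others. -/
def singleCochain (s : ∀ X Y, A.Hom X Y →ₗ[K] B.Hom (o X) (o Y)) :
    Cochain A.toGradedQuiver B.toGradedQuiver o
  | X, Y, Chain.cons x Chain.nil => s X Y x
  | _, _, _ => 0

theorem singleCochain_degree {s : ∀ X Y, A.Hom X Y →ₗ[K] B.Hom (o X) (o Y)}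
    (hs : ∀ X Y d, ∀ x ∈ A.gr X Y d, s X Y x ∈ B.gr _ _ (d - 1)) :
    CochainOfDegree 0 (singleCochain s) where
  linear {W X Y Z} l r := by
    cases l with
    | nil =>
      cases r with
      | nil => exact (s _ _).isLinear
      | cons g r => exact (0 : _ →ₗ[K] B.Hom (o W) (o Y)).isLinear
    | cons g l =>
      cases l with
      | nil => exact (0 : _ →ₗ[K] B.Hom (o W) (o Z)).isLinear
      | cons g' l => exact (0 : _ →ₗ[K] B.Hom (o W) (o Z)).isLinear
  degree c d hc := by
    cases hc with
    | nil => exact zero_mem _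
    | cons hf hc =>
      cases hc with
      | nil =>
        have := hs _ _ _ _ hf
        change s _ _ _ ∈ _
        simpa using this
      | cons hf' hc => exact zero_mem _

/-- On a single unit `bd t` vanishes since the unit is closed, and of the nonlinear term only the
differential of `t (e)` is left. -/
theorem gauge_single {f t : Cochain A.toGradedQuiver B.toGradedQuiver o}
    (hf : ∀ X, f X X Chain.nil = 0) (ht₀ : ∀ X, t X X Chain.nil = 0) (ht : CochainOfDegree 0 t)
    {eA : ∀ X, A.Hom X X} (heA : ∀ X, A.IsStrictUnit (eA X)) (X : A.Obj) :
    gauge f t X X (Chain.cons (eA X) Chain.nil) = f X X (Chain.cons (eA X) Chain.nil) +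
      B.b (Chain.single (t X X (Chain.cons (eA X) Chain.nil))) := by
  have h := bdc_append_strictUnit heA ht (Chain.nil : Chain A.Hom X X) Chain.nil
  simp only [Chain.nil_append, AInfCat.bsum, Chain.spl_nil, Chain.length_nil, if_true, sub_self,
    add_zero] at h
  rw [← gaugeMap_gauge hf ht₀, gaugeMap_apply, h, add_zero, mul_apply, Chain.spl_cons,
    Chain.spl_nil, (pos_ofCochain ht₀).mul_left _ X, map_zero, add_zero, hat_nil, nil_tmul, mul_apply,
    Chain.spl_cons, Chain.spl_nil, hat_nil, tmul_nil, ofCochain_apply, ht₀, map_zero, map_zero,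
    LinearMap.zero_apply, zero_add, ofCochain_apply, tone_apply, bT_tmk]

theorem b_single {X Y : B.Obj} (x : B.Hom X Y) : B.b (Chain.single x) = B.d x := by
  simp [AInfCat.b, AInfCat.d, Chain.single]

theorem exists_normal_zero {eA : ∀ X, A.Hom X X} {eB : ∀ Y, B.Hom Y Y}
    (heA : ∀ X, A.IsStrictUnit (eA X)) (heB : ∀ Y, B.IsStrictUnit (eB Y)) (hA : A.HasSplitUnits)
    {f : Cochain A.toGradedQuiver B.toGradedQuiver o} (hf : IsFunctorCochain f)
    (hu : ∀ X, B.IsCohUnit (f X X (Chain.single (eA X)))) :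
    ∃ g τ : Cochain A.toGradedQuiver B.toGradedQuiver o, IsFunctorCochain g ∧
      NormalTo eA eB 0 g ∧ IsTransCochain eB f g τ := by
  classical
  choose h hh hd using fun X => exists_homotopy_of_isCohUnit (hu X) (heB (o X))
  choose ρ hρ hρ' using fun X => exists_coord hA (heA X)
  -- With `f (e) - e = d h`, the value `-h` at the unit changes `f (e)` by `-d h`. The map has
  -- degree `-1` since `ρ` is supported in degree `0`.
  let s : ∀ X Y, A.Hom X Y →ₗ[K] B.Hom (o X) (o Y) := fun X Y =>
    if e : X = Y then e ▸ (ρ X).smulRight (-h X) else 0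
  have hs : ∀ X, s X X = (ρ X).smulRight (-h X) := fun X => dif_pos rfl
  have ht : CochainOfDegree 0 (singleCochain s) := by
    refine singleCochain_degree fun X Y d x hx => ?_
    by_cases e : X = Y
    · subst e
      rw [hs, LinearMap.smulRight_apply]
      by_cases hd : d = 0
      · subst hd
        exact Submodule.smul_mem _ _ (neg_mem (hh X))
      · rw [hρ' X d hd x hx, zero_smul]
        exact zero_mem _
    · rw [show s X Y = 0 from dif_neg e]
      exact zero_mem _
  have ht₀ : ∀ X, singleCochain s X X Chain.nil = 0 := fun X => rfl
  have hg := hf.gauge heB ht ht₀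
  refine ⟨_, _, hg.1, ?_, hg.2⟩
  intro X Y Z l r hlr
  cases l with
  | cons x l => simp at hlr
  | nil =>
    cases r with
    | cons x r => simp at hlr
    | nil =>
      have h1 : singleCochain s X X (Chain.cons (eA X) Chain.nil) = -h X := by
        change s X X (eA X) = _
        rw [hs, LinearMap.smulRight_apply, hρ, one_smul]
      have h2 : B.d (-h X) = -B.d (h X) := (isLinearMap_d _ _).map_neg _
      rw [Chain.nil_append, gauge_single hf.nil ht₀ ht heA, h1, b_single, h2, ← hd]
      change f X X (Chain.single (eA X)) + _ = eB (o X)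
      abel

end GradedQuiver
end AInf

/-! ### Translation of the signs of block decompositions. -/

namespace AInf

theorem list_sum_map {ι M N F : Type*} [AddCommMonoid M] [AddCommMonoid N] [FunLike F M N]
    [AddMonoidHomClass F M N] (φ : F) (L : List ι) (x : ι → M) :
    (L.map fun a => φ (x a)).sum = φ (L.map x).sum := by
  rw [map_list_sum, List.map_map]
  rfl

namespace Chain

variable {O : Type*} {H : O → O → Type*}

theorem total_of_mem_blocks {X : O} : ∀ {Y : O} (c : Chain H X Y) (I : Chain (Chain H) X Y),
    I ∈ c.blocks → total I = c.length
  | _, nil, I, h => by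
    rw [blocks, List.mem_singleton] at h
    subst h
    rfl
  | _, cons f c, I, h => by
    rw [blocks, List.mem_flatMap] at h
    obtain ⟨J, hJ, h⟩ := h
    have ih := total_of_mem_blocks c J hJ
    cases J with
    | nil =>
      simp only [extendBlocks, List.mem_singleton] at h
      subst h
      simp only [total, single, length_cons, length_nil] at ih ⊢
      push_cast
      linarith
    | cons b J =>
      simp only [extendBlocks, List.mem_cons, List.not_mem_nil, or_false] at h
      rcases h with rfl | rfl <;> simp only [total, single, length_cons, length_nil] at ih ⊢ <;>
        push_cast at ih ⊢ <;> linarith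

theorem defect_eq {X : O} : ∀ {Y : O} (I : Chain (Chain H) X Y), defect I = I.length - total I
  | _, nil => rfl
  | _, cons b I => by
    rw [defect, total, defect_eq I, length_cons]
    push_cast
    ring

/-- Each additional block changes the difference by a product of two consecutive integers. -/
theorem even_rightSign_sub (n : ℤ) {X : O} : ∀ {Y : O} (I : Chain (Chain H) X Y),
    Even (rightSign n I - ((n - total I) * defect I + blockSign I))
  | _, nil => by simp [rightSign, total, defect, blockSign]
  | _, cons b I => by
    have ih := even_rightSign_sub n I
    rw [rightSign, total, defect, blockSign]
    have h : (1 - (b.length : ℤ)) * (n - total I) + rightSign n I -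
        ((n - (b.length + total I)) * (1 - b.length + defect I) +
          (defect I * b.length + blockSign I)) =
        (rightSign n I - ((n - total I) * defect I + blockSign I)) + b.length * (1 - b.length) := by
      ring
    rw [h]
    refine ih.add ?_
    have := Int.even_mul_succ_self (-(b.length : ℤ))
    rw [show -(b.length : ℤ) * (-b.length + 1) = -(b.length * (1 - b.length)) by ring, even_neg] at this
    exact this

end Chain

namespace GradedQuiver

variable {K : Type w} [CommRing K] {Q : GradedQuiver.{w, u, v} K} {R : GradedQuiver.{w, u', v'} K}
  {o : Q.Obj → R.Obj}

open Conv

theorem length_mapBlocks (F : ∀ {X Y : Q.Obj}, Chain Q.Hom X Y → R.Hom (o X) (o Y)) {X : Q.Obj} :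
    ∀ {Y : Q.Obj} (I : Chain (Chain Q.Hom) X Y), (mapBlocks Q R o F I).length = I.length
  | _, Chain.nil => rfl
  | _, Chain.cons b I => congrArg (· + 1) (length_mapBlocks F I)

theorem CochainOfDegree.map_sgc_one {f : Cochain Q R o} (hf : CochainOfDegree 1 f) (k : ℤ)
    {X Y : Q.Obj} (c : Chain Q.Hom X Y) : f X Y (Q.sgc k c) = R.sg k (f X Y c) := by
  rw [hf.map_sgc k c, Int.negOnePow_even _ ⟨k, by ring⟩, one_smul]

theorem CochainOfDegree.tsg_hat {f : Cochain Q R o} (hf : CochainOfDegree 1 f) (k : ℤ)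
    {X Y : Q.Obj} (c : Chain Q.Hom X Y) :
    tsg k ((Conv.ofCochain f).hat X Y c) = (Conv.ofCochain f).hat X Y (Q.sgc k c) := by
  have h1 : Conv.pre (Conv.ofCochain f) = Conv.post (Conv.ofCochain f) := Conv.ext fun X Y c => by
    rw [pre_apply, post_apply, ofCochain_apply, ofCochain_apply, hf.map_sgc_one, tsg_tone]
  rcases Int.even_or_odd k with h | h
  · rw [tsg_even h, sgc_even Q h]
  · have h2 : Even (k - 1) := h.sub_odd odd_one
    have h3 : post (Conv.ofCochain f).hat = Conv.pre (Conv.ofCochain f).hat := by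
      rw [post_hat, pre_hat, h1]
    rw [tsg_congr h2, sgc_congr Q h2]
    exact congrFun (congrFun (congrFun h3 X) Y) c

/-- The sum over all decompositions in blocks, in terms of the shifted modules. -/
theorem sum_blocks_om {F : ∀ {X Y : Q.Obj}, Chain Q.Hom X Y → R.Hom (o X) (o Y)}
    {f : Cochain Q R o} (hf : CochainOfDegree 1 f) (hf₀ : ∀ X, f X X Chain.nil = 0)
    (hF : ∀ {X Y : Q.Obj} (c : Chain Q.Hom X Y), F c = f X Y (Q.om c)) {X Y : Q.Obj}
    (c : Chain Q.Hom X Y) :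
    (c.blocks.map fun I => (Chain.blockSign I).negOnePow • R.tmk (R.om (mapBlocks Q R o F I))).sum =
      (ofCochain f).hat X Y (Q.om c) := by
  have hp := pos_ofCochain hf₀
  have key : ∀ N {Y : Q.Obj} (c : Chain Q.Hom X Y), c.length = N →
      (c.blocks.map fun I =>
        (Chain.blockSign I).negOnePow • R.tmk (R.om (mapBlocks Q R o F I))).sum =
          (ofCochain f).hat X Y (Q.om c) := by
    intro N
    induction N using Nat.strong_induction_on with
    | _ N ih =>
      intro Y c hc
      cases c with
      | nil => simp [Chain.blocks, Chain.blockSign, mapBlocks]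
      | cons x c =>
        rw [Chain.sum_blocks_cons, hp.hat_apply (by simp), mul_apply, spl_om, Chain.spl_cons, om_nil,
          sgc_nil, hp, map_zero, LinearMap.zero_apply, zero_add]
        refine Chain.spl_congr' c fun W l r hl => ?_
        rw [← ih r.length (by rw [← hc, Chain.length_cons]; omega) r rfl, ← list_sum_map]
        refine congrArg List.sum (List.map_congr_left fun I hI => ?_)
        have hm : Multilin fun c : Chain Q.Hom W Y => F c := by
          simp only [hF]
          exact hf.multilin.om
        -- The image of the block passes `I.length` entries, and its arguments carry the Koszul
        -- exponent `defect I = I.length - r.length`. Together these have the parity of `r.length`,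
        -- which is the exponent in the splitting of `om`.
        have h1 : R.sg I.length (F (Q.sgc (Chain.defect I) (Chain.cons x l))) =
            f _ _ (Q.sgc r.length (Q.om (Chain.cons x l))) := by
          rw [hF, om_sgc, hf.map_sgc_one, hf.map_sgc_one, sg_sg, R.sg_congr]
          rw [Chain.defect_eq, Chain.total_of_mem_blocks r I hI]
          exact ⟨I.length - r.length, by ring⟩
        rw [mapBlocks, hm.map_koszul, om_cons, length_mapBlocks, Chain.blockSign]
        have h2 : ∀ (n : ℤ) (y : R.Hom (o W) (o Y)), R.sg I.length (n.negOnePow • y) =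
            n.negOnePow • R.sg I.length y := fun n y => map_zsmul (R.sg I.length) _ y
        rw [h2, tmk_multilin.map_unit_smul, negOnePow_smul_smul, h1, ← tmul_tone]
        refine Eq.trans ?_ (map_zsmul (tmul _) _ _).symm
        refine negOnePow_smul_congr ?_ rfl
        exact ⟨Chain.defect I * (Chain.cons x l).length, by ring⟩
  exact key _ c rfl

end GradedQuiver
end AInf

/-! ### Functors and homotopies in terms of cochains on the shifted modules. -/

namespace AInf

variable {K : Type w} [CommRing K] {A : AInfCat.{w, u, v} K} {B : AInfCat.{w, u', v'} K}

open GradedQuiver GradedQuiver.Conv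

theorem map_negOnePow_smul {M N : Type*} [AddCommGroup M] [Module K M] [AddCommGroup N] [Module K N]
    (φ : M →ₗ[K] N) (n : ℤ) (x : M) : φ (n.negOnePow • x) = n.negOnePow • φ x :=
  map_zsmul φ _ x

section Relation

variable {o : A.Obj → B.Obj} {F : ∀ {X Y : A.Obj}, Chain A.Hom X Y → B.Hom (o X) (o Y)}
  {f : Cochain A.toGradedQuiver B.toGradedQuiver o}

theorem precompSum_eq_bdc {p : ℤ} (hf : CochainOfDegree p f)
    (hF : ∀ {X Y : A.Obj} (c : Chain A.Hom X Y), F c = f X Y (A.om c)) {X Y : A.Obj}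
    (c : Chain A.Hom X Y) :
    precompSum A.toGradedQuiver A.m (T := fun X Y => B.Hom (o X) (o Y)) F c =
      bdc f X Y (A.om c) :=
  A.precompSum_eq (T := fun X Y => B.Hom (o X) (o Y)) F (fun {X Y} c => f X Y c)
    (fun _ _ => hf.multilin) hF c

theorem sum_blocks_m (hf : CochainOfDegree 1 f) (hf₀ : ∀ X, f X X Chain.nil = 0)
    (hF : ∀ {X Y : A.Obj} (c : Chain A.Hom X Y), F c = f X Y (A.om c)) {X Y : A.Obj}
    (c : Chain A.Hom X Y) : (c.blocks.map fun I => (Chain.blockSign I).negOnePow •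
      B.m (mapBlocks A.toGradedQuiver B.toGradedQuiver o F I)).sum =
        bT B ((ofCochain f).hat X Y (A.om c)) := by
  rw [← sum_blocks_om hf hf₀ hF, ← list_sum_map]
  refine congrArg List.sum (List.map_congr_left fun I _ => ?_)
  rw [map_negOnePow_smul, bT_tmk, B.m_eq]

end Relation

/-- The cochain of an `A∞` functor on the shifted modules. -/
def AInfFunctor.cochain (F : AInfFunctor A B) :
    Cochain A.toGradedQuiver B.toGradedQuiver F.obj := fun _ _ c => F.map (A.om c)

theorem AInfFunctor.map_eq (F : AInfFunctor A B) {X Y : A.Obj} (c : Chain A.Hom X Y) :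
    F.map c = F.cochain X Y (A.om c) := by
  rw [AInfFunctor.cochain, om_om]

theorem AInfFunctor.isFunctorCochain (F : AInfFunctor A B) : IsFunctorCochain F.cochain where
  degree := F.isMultilinear.om
  nil := F.map_nil
  relation := by
    rw [beta_eq, bd_ofCochain]
    congr 1
    funext X Y c
    rw [bc_apply]
    by_cases hc : 0 < c.length
    · rw [← A.om_om c, ← sum_blocks_m (f := F.cochain) F.isMultilinear.om F.map_nil F.map_eq,
        ← precompSum_eq_bdc (f := F.cochain) F.isMultilinear.om F.map_eq]
      exact (F.relation _ (by simpa using hc)).symm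
    · cases c with
      | nil =>
        have : A.bsum (F.cochain X X) (Chain.nil : Chain A.Hom X X) = 0 := by simp [AInfCat.bsum]
        rw [hat_nil, bT_tmk, AInfCat.b_nil]
        exact this.symm
      | cons x c => simp at hc

/-- The `A∞` functor given by a cochain. -/
def _root_.AInf.GradedQuiver.IsFunctorCochain.functor {o : A.Obj → B.Obj}
    {f : Cochain A.toGradedQuiver B.toGradedQuiver o} (hf : IsFunctorCochain f) :
    AInfFunctor A B where
  obj := o
  map c := f _ _ (A.om c)
  map_nil := hf.nil
  isMultilinear := hf.degree.om
  relation c _ := by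
    rw [sum_blocks_m hf.degree hf.nil fun _ => rfl, precompSum_eq_bdc hf.degree fun _ => rfl,
      hf.bT_hat]

section Trans

variable {F : AInfFunctor A B} {g t : Cochain A.toGradedQuiver B.toGradedQuiver F.obj}
  (hg : IsFunctorCochain g)

/-- The prenatural transformation given by a cochain. -/
def prenatTrans (ht : CochainOfDegree 0 t) : PrenatTrans F hg.functor 0 where
  app c := t _ _ (A.om c)
  isMultilinear := IsMultilinear.om ht

/-- For fixed blocks `I` of `r`, the sum over the blocks of `l` is again a value of the hat of `g`.
The sign of each summand is a constant times the sign attached to `J`, so it passes through this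
sum. -/
theorem sum_term (ht : CochainOfDegree 0 t) {X Y Z W : A.Obj} (l : Chain A.Hom Z W)
    (m : Chain A.Hom Y Z) (r : Chain A.Hom X Y) (I : Chain (Chain A.Hom) X Y) (hI : I ∈ r.blocks) :
    ((A.koszul ((0 - m.length) + Chain.defect I) l).blocks.map fun J =>
      (prenatTrans hg ht).term J m I).sum =
    bT B (tmul (post (ofCochain g).hat _ _ (A.sgc (m.length + r.length) (A.om l)))
      (tmul (tone (t _ _ (A.sgc r.length (A.om m)))) ((Chain.blockSign I).negOnePow •
        B.tmk (B.om (mapBlocks A.toGradedQuiver B.toGradedQuiver F.obj F.map I))))) := by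
  have hR := Chain.total_of_mem_blocks r I hI
  have hd := Chain.defect_eq I
  have hs := Chain.even_rightSign_sub (l.length + m.length + Chain.total I) I
  rw [hR] at hd hs
  set d := Chain.defect I
  set MI := mapBlocks A.toGradedQuiver B.toGradedQuiver F.obj F.map I
  have hMI : MI.length = I.length := length_mapBlocks _ I
  have hy : B.sg I.length (t _ _ (A.om (A.koszul d m))) =
      (d * m.length + d).negOnePow • B.sg r.length (t _ _ (A.om m)) := by
    have h1 := (Multilin.om (ht.multilin (X := Y) (Y := Z))).map_koszul d m
    refine (congrArg _ h1).trans ?_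
    rw [map_negOnePow_smul, om_sgc, ht.map_sgc d, map_negOnePow_smul, negOnePow_smul_smul, sg_sg,
      B.sg_congr (k := I.length + d) (l := r.length) ⟨I.length - r.length, by rw [hd]; ring⟩]
    congr 2
    ring
  have hz : t _ _ (A.sgc r.length (A.om m)) =
      (r.length : ℤ).negOnePow • B.sg r.length (t _ _ (A.om m)) := by
    rw [ht.map_sgc r.length]
    congr 2
    ring
  have hl : tsg (I.length + 1) ((ofCochain g).hat _ _ (A.om (A.koszul (0 - m.length + d) l))) =
      ((0 - m.length + d) * l.length).negOnePow •
        post (ofCochain g).hat _ _ (A.sgc (m.length + r.length) (A.om l)) := by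
    have h1 := (Multilin.om (hg.degree.ofCochain.hat.multilin Z W)).map_koszul (0 - m.length + d) l
    refine (congrArg _ h1).trans ?_
    rw [map_negOnePow_smul, om_sgc, hg.degree.tsg_hat, post_apply, hg.degree.tsg_hat, sgc_sgc,
      sgc_sgc, A.sgc_congr]
    rw [hd]
    exact ⟨I.length - r.length - m.length, by ring⟩
  let Ψ : B.Tens (F.obj Z) (F.obj W) →ₗ[K] B.Hom (F.obj X) (F.obj W) :=
    bT B ∘ₗ tmul.flip (tmul (tone (B.sg I.length (t _ _ (A.om (A.koszul d m)))))
      (B.tmk (B.om MI))) ∘ₗ tsg (I.length + 1)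
  let G : ∀ {X Y : A.Obj}, Chain A.Hom X Y → B.Hom (F.obj X) (F.obj Y) := fun c => g _ _ (A.om c)
  -- The part of the exponent which does not depend on `J`: the total length of the blocks of `J` is
  -- `l.length`.
  let ε : ℤ := 0 + I.length * (0 - 1) + Chain.rightSign (l.length + m.length + r.length) I +
    (0 - m.length) * l.length
  have h1 : ∀ J ∈ (A.koszul (0 - m.length + d) l).blocks, (prenatTrans hg ht).term J m I =
      (ε.negOnePow • Ψ) ((Chain.blockSign J).negOnePow •
        B.tmk (B.om (mapBlocks A.toGradedQuiver B.toGradedQuiver F.obj G J))) := by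
    intro J hJ
    have hL := Chain.total_of_mem_blocks _ J hJ
    rw [length_koszul] at hL
    change (0 + I.length * (0 - 1) + Chain.rightSign (Chain.total J + m.length + Chain.total I) I +
      (0 - m.length) * Chain.total J + Chain.blockSign J).negOnePow •
      B.m ((mapBlocks A.toGradedQuiver B.toGradedQuiver F.obj G J).append
        (Chain.cons (t _ _ (A.om (A.koszul d m))) MI)) = _
    rw [map_negOnePow_smul, LinearMap.smul_apply, negOnePow_smul_smul, hL, hR,
      add_comm (Chain.blockSign J)]
    congr 1
    rw [B.m_eq, om_append_cons, ← bT_tmk, ← tmul_tmk, ← tmul_tone, ← tsg_tmk, hMI]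
    rfl
  refine (congrArg List.sum (List.map_congr_left h1)).trans ?_
  refine (list_sum_map (ε.negOnePow • Ψ) _ _).trans ?_
  have h2 := sum_blocks_om (F := G) hg.degree hg.nil (fun _ => rfl)
    (A.koszul (0 - m.length + d) l)
  rw [LinearMap.smul_apply]
  refine (congrArg (fun x => ε.negOnePow • Ψ x) h2).trans ?_
  simp only [Ψ, LinearMap.comp_apply, LinearMap.flip_apply]
  rw [hl, hy, hz]
  simp only [map_negOnePow_smul, LinearMap.smul_apply, negOnePow_smul_smul]
  refine negOnePow_smul_congr ?_ rfl
  -- Modulo two, `rightSign` is expressed by `blockSign` and `defect`; all other contributions are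
  -- even.
  have h3 : ε + ((0 - m.length + d) * l.length + (d * m.length + d)) -
      (r.length + Chain.blockSign I) =
      (Chain.rightSign (l.length + m.length + r.length) I -
        ((l.length + m.length + r.length - r.length) * d + Chain.blockSign I)) +
        2 * (d * l.length + d * m.length - m.length * l.length - r.length) := by
    simp only [ε, hd]
    ring
  have h4 := hs.add (even_two_mul (d * l.length + d * m.length - m.length * l.length - r.length))
  rw [← h3] at h4
  ring_nf at h4 ⊢
  exact h4

/-- Identifies the differential of a degree `0` transformation with the correction terms in the
gauge equation, so that homotopic functors are gauge equivalent. -/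
theorem diff_eq (ht : CochainOfDegree 0 t) {X Y : A.Obj} (c : Chain A.Hom X Y) :
    (prenatTrans hg ht).diff c = bdc t X Y (A.om c) +
      bT B (((post (ofCochain g)).hat * (ofCochain t * (ofCochain F.cochain).hat)) X Y (A.om c)) := by
  refine congrArg₂ (· + ·) (precompSum_eq_bdc ht (fun _ => rfl) c) ?_
  refine (Chain.sum_splits₃ c _).trans ?_
  rw [mul_apply, Chain.map_spl, spl_om]
  refine Chain.spl_congr' c fun Z l r' hl => ?_
  rw [mul_apply, tmul_spl, Chain.map_spl, spl_om]
  refine Chain.spl_congr' r' fun V m r hr => ?_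
  refine (congrArg List.sum (List.map_congr_left fun I hI => sum_term hg ht l m r I hI)).trans ?_
  rw [← hr, ← sum_blocks_om (f := F.cochain) F.isMultilinear.om F.map_nil F.map_eq]
  push_cast
  rw [← post_hat]
  refine list_sum_map (bT B ∘ₗ tmul (post (ofCochain g).hat _ _
    (A.sgc (m.length + r.length) (A.om l))) ∘ₗ tmul (tone (t _ _ (A.sgc r.length (A.om m))))) _ _

/-- Adding the units to `τ` makes it vanish on empty sequences, as a homotopy must. By
`relation_of_gauge`, closedness of `τ` then says that `g` solves the gauge equation. -/
theorem homotopic_functor {e : ∀ Y, B.Hom Y Y} (he : ∀ Y, B.IsStrictUnit (e Y))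
    {τ : Cochain A.toGradedQuiver B.toGradedQuiver F.obj}
    (hτ : IsTransCochain e F.cochain g τ) : F.Homotopic hg.functor := by
  have ht : CochainOfDegree 0 (τ + unitCochain A.toGradedQuiver F.obj e) :=
    hτ.degree.add (unitCochain_degree he)
  have ht₀ : ∀ X, (τ + unitCochain A.toGradedQuiver F.obj e) X X Chain.nil = 0 := fun X => by
    refine (congrArg (· + e (F.obj X)) (hτ.nil X)).trans (neg_add_cancel _)
  have hr := relation_of_gauge (t := τ + unitCochain A.toGradedQuiver F.obj e) he
    (f := F.cochain) F.map_nil hg.nil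
  rw [add_sub_cancel_right, hτ.relation] at hr
  have hr' := ofCochain_injective (sub_eq_zero.1 hr.symm)
  refine ⟨fun _ => rfl, prenatTrans hg ht, ht₀, fun {X Y} c _ => ?_⟩
  refine (congrFun (congrFun (congrFun hr' X) Y) (A.om c)).symm.trans ?_
  rw [gaugeMap_apply, diff_eq, add_assoc]
  exact congrArg (· + _) (F.map_eq c).symm

end Trans

theorem _root_.AInf.GradedQuiver.IsFunctorCochain.functor_isStrictlyUnital {o : A.Obj → B.Obj}
    {g : Cochain A.toGradedQuiver B.toGradedQuiver o} (hg : IsFunctorCochain g)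
    {eA : ∀ X, A.Hom X X} {eB : ∀ Y, B.Hom Y Y} (heA : ∀ X, A.IsStrictUnit (eA X))
    (heB : ∀ Y, B.IsStrictUnit (eB Y)) (hn : ∀ n, NormalTo eA eB n g) :
    hg.functor.IsStrictlyUnital := by
  refine ⟨fun X => ⟨_, heA X⟩, fun Y => ⟨_, heB Y⟩, fun X e he => ?_⟩
  obtain rfl := he.eq (heA X)
  -- Passing to the shifted modules only multiplies the unit by a sign, because it is homogeneous;
  -- normality at the position after `l` then applies.
  have key : ∀ {Y Z : A.Obj} (l : Chain A.Hom X Z) (r : Chain A.Hom Y X),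
      hg.functor.map (l.append (Chain.cons (eA X) r)) = (r.length : ℤ).negOnePow •
        unitCochain A.toGradedQuiver o eB Y Z ((A.sgc (r.length + 1) (A.om l)).append (A.om r)) := by
    intro Y Z l r
    change g _ _ (A.om _) = _
    rw [om_append_cons, sg_strictUnit (heA X)]
    refine (map_zsmul ((hg.degree.multilin _ _).mk' _) _ _).trans ?_
    exact congrArg _ (hn (l.length + 1) _ _ (Or.inl (by simp)))
  constructor
  · have h := key (Chain.nil : Chain A.Hom X X) Chain.nil
    rw [show hg.functor.map (Chain.single (eA X)) = eB (o X) from h.trans (by simp; rfl)]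
    exact heB _
  · intro Y Z l r hlr
    have h : ((A.sgc (r.length + 1) (A.om l)).append (A.om r)).length ≠ 0 := by
      simp only [Chain.length_append, Chain.length_cons, length_sgc, length_om] at hlr ⊢
      omega
    rw [key, unitCochain_of_length _ h, smul_zero]
    rfl

end AInf

end

theorem mainTheorem9 {K : Type w} [CommRing K]
    (A : AInf.AInfCat.{w, u, v} K) (B : AInf.AInfCat.{w, u', v'} K)
    (hA : A.IsStrictlyUnital) (hB : B.IsStrictlyUnital) (hsplit : A.HasSplitUnits)
    (F : AInf.AInfFunctor A B) (hF : F.IsUnital) :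
    ∃ G : AInf.AInfFunctor A B, G.IsStrictlyUnital ∧ F.Homotopic G := by
  choose eA heA using hA
  choose eB heB using hB
  have hu : ∀ X, B.IsCohUnit (F.cochain X X (AInf.Chain.single (eA X))) := fun X => by
    have h := hF.2.2 X (eA X) (AInf.GradedQuiver.isCohUnit_of_isStrictUnit (heA X))
    rw [F.map_eq] at h
    simpa [AInf.Chain.single] using h
  obtain ⟨f, σ, hf, hn, hσ⟩ :=
    AInf.GradedQuiver.exists_normal_zero heA heB hsplit F.isFunctorCochain hu
  obtain ⟨g, τ, hg, hN, hτ⟩ :=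
    AInf.GradedQuiver.exists_normal heA heB F.isFunctorCochain hf hn hσ
  exact ⟨hg.functor, hg.functor_isStrictlyUnital heA heB hN,
    AInf.homotopic_functor hg heB hτ⟩
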